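/- Let $\mathcal I$ be a finite index set, $n$ a positive integer, and let $A(x)=(a_{ij}(x))_{1\le i,j\le n}$, $x\in\mathbb R^{\mathcal I}$, be a complex $n\times n$ matrix whose entries $a_{ij}:\mathbb R^{\mathcal I}\to\mathbb C$ are $C^2$. Let $f(z)=\sum_{m\ge 0}b_mz^m$ be an entire function, and for a square matrix $B$ put $f(B)=\sum_m b_mB^m$. Write $\|\cdot\|$ for the operator norm of matrices with respect to Euclidean norms, and for $c_1,c_2\ge 0$ let $\mathcal L(c_1,c_2)$ be the class of laws of the random variables $u(\xi)$, where $\xi$ is standard gaussian and $u:\mathbb R\to\mathbb R$ is $C^2$ with $|u'|\le c_1$ and $|u''|\le c_2$ everywhere. Let $$\mathcal R=\Bigl\{\alpha\in\mathbb C^{\mathcal I}:\sum_{u}|\alpha_u|^2=1\Bigr\},\qquad \mathcal S=\Bigl\{\beta\in\mathbb C^{n\times n}:\sum_{i,j}|\beta_{ij}|^2=1\Bigr\},$$ and for $x\in\mathbb R^{\mathcal I}$ let $$\gamma_0(x)=\sup_{u\in\mathcal I,\ \|B\|=1}\Bigl|\operatorname{Tr}\Bigl(B\,\frac{\partial A}{\partial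 x_u}(x)\Bigr)\Bigr|,\qquad \gamma_1(x)=\sup_{\alpha\in\mathcal R,\ \beta\in\mathcal S}\Bigl|\sum_{u}\sum_{i,j}\alpha_u\beta_{ij}\frac{\partial a_{ij}}{\partial x_u}(x)\Bigr|,$$ $$\gamma_2(x)=\sup_{\alpha,\alpha'\in\mathcal R,\ \beta\in\mathcal S}\Bigl|\sum_{u,v}\sum_{i,j}\alpha_u\alpha'_v\beta_{ij}\frac{\partial^2a_{ij}}{\partial x_u\partial x_v}(x)\Bigr|,$$ where a supremum over an empty set is $0$. Let $f_1(z)=\sum_{m\ge1}m|b_m|z^{m-1}$ and $f_2(z)=\sum_{m\ge2}m(m-1)|b_m|z^{m-2}$, let $\lambda(x)=\|A(x)\|$ and $r(x)=\operatorname{rank}A(x)$, and put $$\eta_0=\gamma_0 f_1(\lambda),\qquad \eta_1=\gamma_1f_1(\lambda)\sqrt r,\qquad \eta_2=\gamma_2f_1(\lambda)\sqrt r+\gamma_1^2f_2(\lambda).$$ Let $X=(X_u)_{u\in\mathcal I}$ be a random vector and define $$\kappa_0=\bigl(\mathbb E\,\eta_0(X)^2\eta_1(X)^2\bigr)^{1/2},\qquad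 \kappa_1=\bigl(\mathbb E\,\eta_1(X)^4\bigr)^{1/4},\qquad \kappa_2=\bigl(\mathbb E\,\eta_2(X)^4\bigr)^{1/4},$$ which take values in $[0,\infty]$. Suppose that $W=\operatorname{Re}\operatorname{Tr}f(A(X))$ has finite fourth moment, let $\sigma^2=\operatorname{Var}(W)$, and let $Z$ be a normal random variable with the same mean and variance as $W$. Let $d_{TV}(W,Z)=\sup_B|\mathbb P(W\in B)-\mathbb P(Z\in B)|$, the supremum being over all Borel sets $B\subseteq\mathbb R$. The bounds below are read in $[0,\infty]$, with $0\cdot\infty=0$, $0/0=0$, and $t/0=\infty$ for $t>0$. (a) If the $X_u$ are independent and the law of each of them belongs to $\mathcal L(c_1,c_2)$, for some finite $c_1,c_2\ge0$, then $$d_{TV}(W,Z)\le\frac{2\sqrt5\,\bigl(c_1c_2\kappa_0+c_1^3\kappa_1\kappa_2\bigr)}{\sigma^2}.$$ (b) If instead $X$ is a gaussian random vector with mean $0$ and (possibly singular) covariance matrix $\Sigma$, then $$d_{TV}(W,Z)\le\frac{2\sqrt5\,\|\Sigma\|^{3/2}\kappa_1\kappa_2}{\sigma^2}.$$ -/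

import Mathlib

open MeasureTheory ProbabilityTheory
open scoped ENNReal NNReal

namespace MatrixCLT

noncomputable section

/-- The class `𝓛(c₁, c₂)` of laws of `u(Z)`, with `Z` standard gaussian and `u` of class `C²` with
`|u'| ≤ c₁` and `|u''| ≤ c₂`. -/
def ClassL (c₁ c₂ : ℝ≥0) : Set (Measure ℝ) :=
  {μ | ∃ u : ℝ → ℝ, ContDiff ℝ 2 u ∧ (∀ x, |deriv u x| ≤ c₁) ∧ (∀ x, |deriv (deriv u) x| ≤ c₂) ∧
    μ = (gaussianReal 0 1).map u}

/-- Total variation distance: the supremum of `|μ(B) - ν(B)|` over all Borel sets `B`. -/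
def dTV (μ ν : Measure ℝ) : ℝ≥0∞ :=
  ⨆ (B : Set ℝ) (_ : MeasurableSet B), ENNReal.ofReal |μ.real B - ν.real B|

/-- The operator norm of a square matrix with respect to the Euclidean norm. -/
def opNorm {𝕜 κ : Type*} [RCLike 𝕜] [Fintype κ] [DecidableEq κ] (B : Matrix κ κ 𝕜) : ℝ :=
  ‖Matrix.toEuclideanCLM (n := κ) (𝕜 := 𝕜) B‖

/-- The power series coefficient `b_m` of an entire function `f(z) = ∑ b_m z ^ m`. -/
def coeff (f : ℂ → ℂ) (m : ℕ) : ℂ := iteratedDeriv m f 0 / (m.factorial : ℂ)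

/-- `f(B) = ∑ b_m B ^ m` for a square matrix `B` and an entire function `f`. -/
def matrixFun {n : ℕ} (f : ℂ → ℂ) (B : Matrix (Fin n) (Fin n) ℂ) : Matrix (Fin n) (Fin n) ℂ :=
  ∑' m : ℕ, coeff f m • B ^ m

/-- `f₁(t) = ∑_{m ≥ 1} m |b_m| t ^ (m - 1)`; the summand for `m = 0` vanishes. -/
def f₁ (f : ℂ → ℂ) (t : ℝ) : ℝ := ∑' m : ℕ, (m : ℝ) * ‖coeff f m‖ * t ^ (m - 1)

/-- `f₂(t) = ∑_{m ≥ 2} m (m - 1) |b_m| t ^ (m - 2)`; the summands for `m = 0, 1` vanish. -/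
def f₂ (f : ℂ → ℂ) (t : ℝ) : ℝ :=
  ∑' m : ℕ, (m : ℝ) * ((m : ℝ) - 1) * ‖coeff f m‖ * t ^ (m - 2)

/-- `𝓡`, the unit sphere of `ℂ^ι`. -/
def sphereR (ι : Type*) [Fintype ι] : Set (ι → ℂ) := {α | ∑ u, ‖α u‖ ^ 2 = 1}

/-- `𝓢`, the Hilbert-Schmidt unit sphere of the complex `n × n` matrices. -/
def sphereS (n : ℕ) : Set (Matrix (Fin n) (Fin n) ℂ) := {β | ∑ i, ∑ j, ‖β i j‖ ^ 2 = 1}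

variable {ι : Type*} [Fintype ι] [DecidableEq ι] {n : ℕ}

/-- The partial derivative `∂g/∂x_u`. -/
def pd (u : ι) (g : (ι → ℝ) → ℂ) (x : ι → ℝ) : ℂ := fderiv ℝ g x (Pi.single u 1)

/-- The entrywise partial derivative `∂A/∂x_u`. -/
def pdMatrix (u : ι) (A : (ι → ℝ) → Matrix (Fin n) (Fin n) ℂ) (x : ι → ℝ) :
    Matrix (Fin n) (Fin n) ℂ :=
  Matrix.of fun i j => pd u (fun y => A y i j) x

/-- `γ₀(x) = sup |Tr (B ∂A/∂x_u)|` over `u` and over the matrices `B` with `‖B‖ = 1`. -/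
def γ₀ (A : (ι → ℝ) → Matrix (Fin n) (Fin n) ℂ) (x : ι → ℝ) : ℝ≥0∞ :=
  ⨆ (u : ι) (B : Matrix (Fin n) (Fin n) ℂ) (_ : opNorm B = 1), ‖(B * pdMatrix u A x).trace‖ₑ

/-- `γ₁(x) = sup |∑ α_u β_ij ∂a_ij/∂x_u|` over `α ∈ 𝓡` and `β ∈ 𝓢`. -/
def γ₁ (A : (ι → ℝ) → Matrix (Fin n) (Fin n) ℂ) (x : ι → ℝ) : ℝ≥0∞ :=
  ⨆ (α ∈ sphereR ι) (β ∈ sphereS n),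
    ‖∑ u, ∑ i, ∑ j, α u * β i j * pd u (fun y => A y i j) x‖ₑ

/-- `γ₂(x) = sup |∑ α_u α'_v β_ij ∂²a_ij/∂x_u∂x_v|` over `α, α' ∈ 𝓡` and `β ∈ 𝓢`. -/
def γ₂ (A : (ι → ℝ) → Matrix (Fin n) (Fin n) ℂ) (x : ι → ℝ) : ℝ≥0∞ :=
  ⨆ (α ∈ sphereR ι) (α' ∈ sphereR ι) (β ∈ sphereS n),
    ‖∑ u, ∑ v, ∑ i, ∑ j, α u * α' v * β i j * pd u (pd v fun y => A y i j) x‖ₑ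

/-- `η₀(x) = γ₀(x) f₁(‖A(x)‖)`. -/
def η₀ (f : ℂ → ℂ) (A : (ι → ℝ) → Matrix (Fin n) (Fin n) ℂ) (x : ι → ℝ) : ℝ≥0∞ :=
  γ₀ A x * ENNReal.ofReal (f₁ f (opNorm (A x)))

/-- `η₁(x) = γ₁(x) f₁(‖A(x)‖) √(rank A(x))`. -/
def η₁ (f : ℂ → ℂ) (A : (ι → ℝ) → Matrix (Fin n) (Fin n) ℂ) (x : ι → ℝ) : ℝ≥0∞ :=
  γ₁ A x * ENNReal.ofReal (f₁ f (opNorm (A x))) * ENNReal.ofReal √((A x).rank : ℝ)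

/-- `η₂(x) = γ₂(x) f₁(‖A(x)‖) √(rank A(x)) + γ₁(x)² f₂(‖A(x)‖)`. -/
def η₂ (f : ℂ → ℂ) (A : (ι → ℝ) → Matrix (Fin n) (Fin n) ℂ) (x : ι → ℝ) : ℝ≥0∞ :=
  γ₂ A x * ENNReal.ofReal (f₁ f (opNorm (A x))) * ENNReal.ofReal √((A x).rank : ℝ) +
    γ₁ A x ^ 2 * ENNReal.ofReal (f₂ f (opNorm (A x)))

variable {Ω : Type*} [MeasurableSpace Ω]

/-- `κ₀ = (𝔼 η₀(X)² η₁(X)²)^(1/2)`. -/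
def κ₀ (f : ℂ → ℂ) (A : (ι → ℝ) → Matrix (Fin n) (Fin n) ℂ) (P : Measure Ω)
    (X : ι → Ω → ℝ) : ℝ≥0∞ :=
  (∫⁻ ω, η₀ f A (fun u => X u ω) ^ 2 * η₁ f A (fun u => X u ω) ^ 2 ∂P) ^ (1 / 2 : ℝ)

/-- `κ₁ = (𝔼 η₁(X)⁴)^(1/4)`. -/
def κ₁ (f : ℂ → ℂ) (A : (ι → ℝ) → Matrix (Fin n) (Fin n) ℂ) (P : Measure Ω)
    (X : ι → Ω → ℝ) : ℝ≥0∞ :=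
  (∫⁻ ω, η₁ f A (fun u => X u ω) ^ 4 ∂P) ^ (1 / 4 : ℝ)

/-- `κ₂ = (𝔼 η₂(X)⁴)^(1/4)`. -/
def κ₂ (f : ℂ → ℂ) (A : (ι → ℝ) → Matrix (Fin n) (Fin n) ℂ) (P : Measure Ω)
    (X : ι → Ω → ℝ) : ℝ≥0∞ :=
  (∫⁻ ω, η₂ f A (fun u => X u ω) ^ 4 ∂P) ^ (1 / 4 : ℝ)

/-- The linear statistic `W = Re Tr f(A(X))`. -/
def linStat (f : ℂ → ℂ) (A : (ι → ℝ) → Matrix (Fin n) (Fin n) ℂ) (X : ι → Ω → ℝ) (ω : Ω) : ℝ :=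
  (matrixFun f (A fun u => X u ω)).trace.re

end

end MatrixCLT

/-! The variables are written as `X = Φ(Y)` with `Y` standard gaussian: `Φ` acts coordinatewise by
the functions `u` in (a) and is the matrix `√Σ` in (b). Everything then reduces to a second order
Poincaré inequality for the function `h = Re Tr f(A ∘ Φ)` of `Y`, together with pointwise bounds on
its gradient and Hessian.

The second order Poincaré inequality (`dTV_map_stdG_le`) comes from Stein's method. By
`dTV_gaussianReal_le` it suffices to compare `Cov(φ(h), h)` with `E φ'(h) · Var h` for `|φ'| ≤ 1`.
Put `Y_t = cos t • Y + sin t • Y'` with `Y'` an independent copy. The interpolation formula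
`covariance_stdG` expresses both covariances through `q_t = ⟨∇h(Y), ∇h(Y_t)⟩`, and the difference
becomes the integral over `[0, π/2]` of `sin t · Cov(φ'(h(Y)), q_t)`. For fixed `Y'` the Poincaré
inequality bounds the fluctuation of `q_t` in `Y` by its gradient, which is `Hess h(Y) ∇h(Y_t) + cos
t · Hess h(Y_t) ∇h(Y)`. If both products have `L²` norm at most `K`, the covariance is at most `(1 +
cos t) K`, and integration gives `3/2 · K`.

For the pointwise bounds, `∂h` is the real part of `Tr(f'(A) ∂A)`, and `|Tr(C M)| ≤ √(rank M) ‖C‖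
‖M‖_HS`. Hence the rank of the derivatives of `A` has to be controlled by the rank of `A` itself.
This holds almost everywhere: almost every point of the closed set `{rank A ∘ Φ ≤ r}` is an
accumulation point of that set along each of countably many dense directions, so there `A ∘ Φ` is
tangent to the matrices of rank at most `r` to second order (`ae_compression`). First derivatives
then have rank at most `2r` and second derivatives at most `4r`, which costs the factors `√2` and
`2`. The total constant is `3/2 · 2√2 = 3√2 ≤ 2√5`.

In (a) the curvature of `Φ` adds a term with `u''`. It is bounded by Cauchy-Schwarz from `∑ (∂_i)⁴ ≤
(max ∂_i)² ∑ (∂_i)²`, where the `∂_i` are the partial derivatives of `Re Tr f(A)`; this is where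
`η₀` and `κ₀` enter. -/

namespace MatrixCLT
noncomputable section

open Filter Topology

set_option linter.unusedSectionVars false

/-! ### Standard gaussian measure: rotation invariance and integration by parts. -/

section

/-- The standard gaussian measure on `ι → ℝ`. -/
abbrev stdG (ι : Type*) [Fintype ι] : Measure (ι → ℝ) := Measure.pi fun _ : ι => gaussianReal 0 1

/-- Real-valued partial derivative. -/
def par {ι : Type*} [DecidableEq ι] [Fintype ι] (i : ι) (h : (ι → ℝ) → ℝ) (y : ι → ℝ) : ℝ :=
  fderiv ℝ h y (Pi.single i 1)

theorem isGaussian_stdG (ι : Type*) [Fintype ι] : IsGaussian (stdG ι) := by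
  have h : stdG ι = (stdGaussian (EuclideanSpace ℝ ι)).map (EuclideanSpace.equiv ι ℝ) := by
    rw [← map_pi_eq_stdGaussian, Measure.map_map (by fun_prop) (by fun_prop)]
    exact (Measure.map_id).symm
  rw [h]
  infer_instance

/-- Any centred gaussian measure has this invariance, so the only point to check is that the mean
vanishes, which is done one coordinate at a time. -/
theorem map_rotation_stdG {ι : Type*} [Fintype ι] (t : ℝ) :
    ((stdG ι).prod (stdG ι)).map (fun p => (Real.cos t • p.1 + Real.sin t • p.2,
      -Real.sin t • p.1 + Real.cos t • p.2)) = (stdG ι).prod (stdG ι) := by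
  have := isGaussian_stdG ι
  refine IsGaussian.map_rotation_eq_self (μ := stdG ι) ?_ t
  have hint : Integrable (fun x : ι → ℝ => x) (stdG ι) := IsGaussian.integrable_id
  ext i
  have h1 := (ContinuousLinearMap.proj (R := ℝ) (φ := fun _ : ι => ℝ) i).integral_comp_comm hint
  simp only [ContinuousLinearMap.proj_apply] at h1
  simp only [id]
  rw [← h1]
  have h2 := (measurePreserving_eval (fun _ : ι => gaussianReal 0 1) i)
  have h3 : ∫ x, x ∂(Measure.map (Function.eval i) (stdG ι)) = ∫ x : ι → ℝ, x i ∂stdG ι :=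
    integral_map (measurable_pi_apply i).aemeasurable aestronglyMeasurable_id
  rw [← h3]
  rw [h2.map_eq]
  simp

/-- Resampling one coordinate preserves a product law. This lets Fubini isolate the coordinate `i`
without splitting `ι → ℝ` as a product of two spaces. -/
theorem map_update_stdG {ι : Type*} [Fintype ι] [DecidableEq ι] (i : ι) :
    ((stdG ι).prod (gaussianReal 0 1)).map (fun p => Function.update p.1 i p.2) = stdG ι := by
  refine (Measure.pi_eq fun s hs => ?_).symm
  have hm : Measurable fun p : (ι → ℝ) × ℝ => Function.update p.1 i p.2 := by
    refine measurable_pi_lambda _ fun j => ?_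
    by_cases h : j = i
    · subst h; simpa using measurable_snd
    · simpa [Function.update_of_ne h] using! (measurable_pi_apply j).comp measurable_fst
  rw [Measure.map_apply hm (MeasurableSet.univ_pi hs)]
  have : (fun p : (ι → ℝ) × ℝ => Function.update p.1 i p.2) ⁻¹' Set.univ.pi s =
      (Set.univ.pi (Function.update s i Set.univ)) ×ˢ s i := by
    ext p
    simp only [Set.mem_preimage, Set.mem_pi, Set.mem_univ, true_implies, Set.mem_prod]
    constructor
    · intro h
      refine ⟨fun j => ?_, by simpa using h i⟩
      by_cases hj : j = i
      · subst hj; simp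
      · simpa [hj] using h j
    · rintro ⟨h1, h2⟩ j
      by_cases hj : j = i
      · subst hj; simpa using h2
      · simpa [hj] using h1 j
  rw [this, Measure.prod_prod, Measure.pi_pi]
  rw [← Finset.mul_prod_erase _ _ (Finset.mem_univ i),
    ← Finset.mul_prod_erase _ (fun j => gaussianReal 0 1 (s j)) (Finset.mem_univ i)]
  simp only [Function.update_self, measure_univ, one_mul]
  rw [mul_comm]
  congr 1
  refine Finset.prod_congr rfl fun j hj => ?_
  rw [Function.update_of_ne (Finset.ne_of_mem_erase hj)]

/-- Gaussian integration by parts on the line. -/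
theorem integral_mul_self_gaussianReal {f f' : ℝ → ℝ} (hf : ∀ x, HasDerivAt f (f' x) x)
    (hf' : Continuous f') {M M' : ℝ} (hM : ∀ x, |f x| ≤ M) (hM' : ∀ x, |f' x| ≤ M') :
    ∫ x, f x * x ∂(gaussianReal 0 1) = ∫ x, f' x ∂(gaussianReal 0 1) := by
  have hfc : Continuous f := continuous_iff_continuousAt.2 fun x => (hf x).continuousAt
  set ρ : ℝ → ℝ := gaussianPDFReal 0 1 with hρ
  have hρ' : ∀ x, HasDerivAt ρ (-(x * ρ x)) x := by
    intro x
    have h1 : HasDerivAt (fun x : ℝ => -(x - 0) ^ 2 / (2 * ((1 : ℝ≥0) : ℝ))) (-x) x := by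
      have := (((hasDerivAt_id x).sub_const 0).pow 2).neg.div_const (2 * ((1 : ℝ≥0) : ℝ))
      refine this.congr_deriv ?_
      simp; ring
    have := h1.exp.const_mul (√(2 * Real.pi * ((1 : ℝ≥0) : ℝ)))⁻¹
    refine this.congr_deriv ?_
    rw [hρ, gaussianPDFReal]; ring
  have hρi : Integrable ρ := integrable_gaussianPDFReal 0 1
  have hxρ : Integrable fun x => x * ρ x := by
    have := (integrable_mul_exp_neg_mul_sq (b := 1 / 2) (by norm_num)).const_mul
      (√(2 * Real.pi * ((1 : ℝ≥0) : ℝ)))⁻¹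
    refine this.congr (Eventually.of_forall fun x => ?_)
    simp only [hρ, gaussianPDFReal, NNReal.coe_one]
    rw [show -(x - 0) ^ 2 / (2 * 1) = -(1 / 2) * x ^ 2 by ring]
    ring
  have h1 : Integrable (f * fun x => -(x * ρ x)) :=
    hxρ.neg.bdd_mul hfc.aestronglyMeasurable (Eventually.of_forall hM)
  have h2 : Integrable (f' * ρ) :=
    hρi.bdd_mul hf'.aestronglyMeasurable (Eventually.of_forall hM')
  have h3 : Integrable (f * ρ) :=
    hρi.bdd_mul hfc.aestronglyMeasurable (Eventually.of_forall hM)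
  have key := integral_mul_deriv_eq_deriv_mul_of_integrable (fun x _ => hf x) (fun x _ => hρ' x)
    h1 h2 h3
  rw [integral_gaussianReal_eq_integral_smul one_ne_zero,
    integral_gaussianReal_eq_integral_smul one_ne_zero]
  calc ∫ x, gaussianPDFReal 0 1 x • (f x * x) = -∫ x, f x * (-(x * ρ x)) := by
        rw [← integral_neg]; congr 1; ext x; simp [hρ]; ring
    _ = ∫ x, f' x * ρ x := by rw [key, neg_neg]
    _ = _ := by congr 1; ext x; simp [hρ, mul_comm]

variable {ι : Type*} [Fintype ι] [DecidableEq ι]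

/-- Bounded functions of class `C¹` with bounded derivative. -/
structure BddC1 (a : (ι → ℝ) → ℝ) : Prop where
  contDiff : ContDiff ℝ 1 a
  bdd : ∃ M, ∀ y, |a y| ≤ M
  bdd_fderiv : ∃ M, ∀ y, ‖fderiv ℝ a y‖ ≤ M

theorem abs_par_le (i : ι) (h : (ι → ℝ) → ℝ) (y : ι → ℝ) : |par i h y| ≤ ‖fderiv ℝ h y‖ := by
  have := (fderiv ℝ h y).le_opNorm (Pi.single i 1)
  rwa [Pi.norm_single, norm_one, mul_one] at this

theorem fderiv_eq_sum_par (h : (ι → ℝ) → ℝ) (y v : ι → ℝ) :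
    fderiv ℝ h y v = ∑ i, v i * par i h y := by
  conv_lhs => rw [pi_eq_sum_univ' v]
  simp [map_sum, par]

theorem continuous_par {h : (ι → ℝ) → ℝ} (hh : ContDiff ℝ 1 h) (i : ι) : Continuous (par i h) :=
  (hh.continuous_fderiv one_ne_zero).clm_apply continuous_const

theorem integrable_coord (i : ι) : Integrable (fun y : ι → ℝ => y i) (stdG ι) := by
  have h2 := (measurePreserving_eval (fun _ : ι => gaussianReal 0 1) i)
  exact h2.integrable_comp_of_integrable (memLp_one_iff_integrable.1 (memLp_id_gaussianReal 1))

/-- Gaussian integration by parts. -/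
theorem integral_mul_coord_stdG {a : (ι → ℝ) → ℝ} (ha : BddC1 a) (i : ι) :
    ∫ y, a y * y i ∂stdG ι = ∫ y, par i a y ∂stdG ι := by
  obtain ⟨hc, ⟨M, hM⟩, ⟨M', hM'⟩⟩ := ha
  have hm : Measurable fun p : (ι → ℝ) × ℝ => Function.update p.1 i p.2 := by
    refine measurable_pi_lambda _ fun j => ?_
    by_cases h : j = i
    · subst h; simpa using measurable_snd
    · simpa [Function.update_of_ne h] using! (measurable_pi_apply j).comp measurable_fst
  have hpar := continuous_par hc i
  have i1 : Integrable (fun y => a y * y i) (stdG ι) :=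
    (integrable_coord i).bdd_mul hc.continuous.aestronglyMeasurable (Eventually.of_forall hM)
  have i2 : Integrable (par i a) (stdG ι) :=
    Integrable.of_bound hpar.aestronglyMeasurable M' (Eventually.of_forall fun y =>
      (abs_par_le i a y).trans (hM' y))
  rw [← map_update_stdG i] at i1 i2
  conv_lhs => rw [← map_update_stdG i]
  conv_rhs => rw [← map_update_stdG i]
  rw [integral_map hm.aemeasurable i1.1, integral_map hm.aemeasurable i2.1,
    integral_prod (fun p : (ι → ℝ) × ℝ => a (Function.update p.1 i p.2) *
      Function.update p.1 i p.2 i) (i1.comp_measurable hm),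
    integral_prod (fun p : (ι → ℝ) × ℝ => par i a (Function.update p.1 i p.2))
      (i2.comp_measurable hm)]
  congr 1
  ext y
  simp only [Function.update_self]
  -- With the other coordinates frozen at `y`, this is the one-dimensional formula along the
  -- coordinate `i`.
  refine integral_mul_self_gaussianReal (f := fun s => a (Function.update y i s))
    (f' := fun s => par i a (Function.update y i s)) (M := M) (M' := M') ?_ ?_ (fun _ => hM _)
    fun s => (abs_par_le i a _).trans (hM' _)
  · intro s
    exact ((hc.differentiable one_ne_zero _).hasFDerivAt).comp_hasDerivAt s
      (hasDerivAt_update y i s)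
  · exact hpar.comp (continuous_const.update i continuous_id)

/-- The interpolation `cos t • y + sin t • y'`. -/
def mix (t : ℝ) (p : (ι → ℝ) × (ι → ℝ)) : ι → ℝ := Real.cos t • p.1 + Real.sin t • p.2

theorem continuous_mix (t : ℝ) : Continuous (mix t : (ι → ℝ) × (ι → ℝ) → ι → ℝ) := by
  unfold mix; fun_prop

theorem integral_rotation_stdG (t : ℝ) {F : (ι → ℝ) × (ι → ℝ) → ℝ} (hF : Continuous F) :
    ∫ p, F (mix t p, -Real.sin t • p.1 + Real.cos t • p.2) ∂(stdG ι).prod (stdG ι) =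
      ∫ p, F p ∂(stdG ι).prod (stdG ι) := by
  conv_rhs => rw [← map_rotation_stdG t]
  rw [integral_map (by fun_prop) hF.aestronglyMeasurable]
  rfl

theorem map_mix_stdG (t : ℝ) : ((stdG ι).prod (stdG ι)).map (mix t) = stdG ι := by
  have h := congrArg (Measure.map Prod.fst) (map_rotation_stdG (ι := ι) t)
  rw [Measure.map_map (by fun_prop) (by fun_prop)] at h
  simpa [Function.comp_def] using! h

end

/-! ### Covariance interpolation formula. -/

section

variable {ι : Type*} [Fintype ι] [DecidableEq ι]

/-- Covariance interpolation formula for the standard gaussian measure, derivative form. -/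
theorem integral_mul_fderiv_mix {a b : (ι → ℝ) → ℝ} (ha : BddC1 a) (hb : BddC1 b) (t : ℝ) :
    ∫ p, a p.1 * fderiv ℝ b (mix t p) (-Real.sin t • p.1 + Real.cos t • p.2)
      ∂(stdG ι).prod (stdG ι) =
    -Real.sin t * ∫ p, ∑ i, par i a p.1 * par i b (mix t p) ∂(stdG ι).prod (stdG ι) := by
  obtain ⟨hac, ⟨Ma, hMa⟩, ⟨Ma', hMa'⟩⟩ := id ha
  obtain ⟨hbc, ⟨Mb, hMb⟩, ⟨Mb', hMb'⟩⟩ := id hb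
  have hac' := hac.continuous
  have hbf := hbc.continuous_fderiv one_ne_zero
  have hpa := fun i => continuous_par hac i
  have hpb := fun i => continuous_par hbc i
  -- Rotating the pair makes `mix t p` and its `t`-derivative the two independent coordinates `q.1`,
  -- `q.2`; the inverse rotation recovers `p.1` from them. The factor `q.2` now enters linearly and
  -- can be removed by integration by parts in `q.2`, which produces the factor `-sin t`.
  have back : ∀ p : (ι → ℝ) × (ι → ℝ), Real.cos t • mix t p -
      Real.sin t • (-Real.sin t • p.1 + Real.cos t • p.2) = p.1 := by
    intro p
    ext i
    simp only [mix, Pi.sub_apply, Pi.smul_apply, Pi.add_apply, smul_eq_mul]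
    linear_combination (p.1 i) * Real.sin_sq_add_cos_sq t
  have e1 := integral_rotation_stdG t (F := fun q : (ι → ℝ) × (ι → ℝ) =>
    a (Real.cos t • q.1 - Real.sin t • q.2) * fderiv ℝ b q.1 q.2) (by fun_prop)
  have e2 := integral_rotation_stdG t (F := fun q : (ι → ℝ) × (ι → ℝ) =>
    ∑ i, par i a (Real.cos t • q.1 - Real.sin t • q.2) * par i b q.1) (by fun_prop)
  simp only [back] at e1 e2
  rw [e1, e2]
  have hint : ∀ i, Integrable (fun q : (ι → ℝ) × (ι → ℝ) =>
      par i b q.1 * (a (Real.cos t • q.1 - Real.sin t • q.2) * q.2 i))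
      ((stdG ι).prod (stdG ι)) := by
    intro i
    have h1 : Integrable (fun q : (ι → ℝ) × (ι → ℝ) => q.2 i) ((stdG ι).prod (stdG ι)) :=
      (integrable_coord i).comp_snd _
    refine Integrable.bdd_mul (c := Mb') (h1.bdd_mul (c := Ma) ?_ ?_) ?_ ?_
    · exact (by fun_prop : Continuous fun q : (ι → ℝ) × (ι → ℝ) =>
        a (Real.cos t • q.1 - Real.sin t • q.2)).aestronglyMeasurable
    · exact Eventually.of_forall fun q => hMa _
    · exact ((hpb i).comp continuous_fst).aestronglyMeasurable
    · exact Eventually.of_forall fun q => (abs_par_le i b _).trans (hMb' _)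
  have hint2 : ∀ i, Integrable (fun q : (ι → ℝ) × (ι → ℝ) =>
      par i b q.1 * (-Real.sin t * par i a (Real.cos t • q.1 - Real.sin t • q.2)))
      ((stdG ι).prod (stdG ι)) := by
    intro i
    refine Integrable.of_bound (C := Mb' * (1 * Ma')) ?_ (Eventually.of_forall fun q => ?_)
    · exact (by fun_prop : Continuous fun q : (ι → ℝ) × (ι → ℝ) =>
        par i b q.1 *
          (-Real.sin t * par i a (Real.cos t • q.1 - Real.sin t • q.2))).aestronglyMeasurable
    · rw [norm_mul, norm_mul]
      have h0 : 0 ≤ Mb' := (norm_nonneg _).trans (hMb' 0)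
      refine mul_le_mul ((abs_par_le i b _).trans (hMb' _)) ?_ (by positivity) h0
      refine mul_le_mul ?_ ((abs_par_le i a _).trans (hMa' _)) (by positivity) zero_le_one
      rw [norm_neg]
      exact Real.abs_sin_le_one t
  have e3 : ∀ q : (ι → ℝ) × (ι → ℝ), a (Real.cos t • q.1 - Real.sin t • q.2) *
      fderiv ℝ b q.1 q.2 =
      ∑ i, par i b q.1 * (a (Real.cos t • q.1 - Real.sin t • q.2) * q.2 i) := by
    intro q
    rw [fderiv_eq_sum_par, Finset.mul_sum]
    exact Finset.sum_congr rfl fun i _ => by ring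
  have e4 : ∀ q : (ι → ℝ) × (ι → ℝ), -Real.sin t *
      ∑ i, par i a (Real.cos t • q.1 - Real.sin t • q.2) * par i b q.1 =
      ∑ i, par i b q.1 * (-Real.sin t * par i a (Real.cos t • q.1 - Real.sin t • q.2)) := by
    intro q
    rw [Finset.mul_sum]
    exact Finset.sum_congr rfl fun i _ => by ring
  simp_rw [← integral_const_mul, e3, e4]
  rw [integral_finsetSum _ fun i _ => hint i, integral_finsetSum _ fun i _ => hint2 i]
  refine Finset.sum_congr rfl fun i _ => ?_
  rw [integral_prod _ (hint i), integral_prod _ (hint2 i)]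
  congr 1
  ext x
  simp only
  rw [integral_const_mul, integral_const_mul]
  congr 1
  have hd : ∀ y, HasFDerivAt (fun y : ι → ℝ => a (Real.cos t • x - Real.sin t • y))
      ((fderiv ℝ a (Real.cos t • x - Real.sin t • y)).comp
        (-(Real.sin t • ContinuousLinearMap.id ℝ (ι → ℝ)))) y := by
    intro y
    refine ((hac.differentiable one_ne_zero _).hasFDerivAt).comp y ?_
    exact ((hasFDerivAt_id y).const_smul (Real.sin t)).const_sub _
  rw [integral_mul_coord_stdG (a := fun y => a (Real.cos t • x - Real.sin t • y)) ?_ i]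
  · congr 1
    ext y
    rw [par, (hd y).fderiv]
    simp [par]
  · refine ⟨hac.comp (by fun_prop), ⟨Ma, fun y => hMa _⟩, ⟨Ma' * ‖-(Real.sin t •
      ContinuousLinearMap.id ℝ (ι → ℝ))‖, fun y => ?_⟩⟩
    rw [(hd y).fderiv]
    exact (ContinuousLinearMap.opNorm_comp_le _ _).trans
      (mul_le_mul_of_nonneg_right (hMa' _) (norm_nonneg _))

/-- Covariance interpolation formula for the standard gaussian measure. -/
theorem covariance_stdG {a b : (ι → ℝ) → ℝ} (ha : BddC1 a) (hb : BddC1 b) :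
    ∫ y, a y * b y ∂stdG ι - (∫ y, a y ∂stdG ι) * ∫ y, b y ∂stdG ι =
    ∫ t in (0 : ℝ)..(Real.pi / 2), Real.sin t *
      ∫ p, ∑ i, par i a p.1 * par i b (mix t p) ∂(stdG ι).prod (stdG ι) := by
  obtain ⟨hac, ⟨Ma, hMa⟩, ⟨Ma', hMa'⟩⟩ := id ha
  obtain ⟨hbc, ⟨Mb, hMb⟩, ⟨Mb', hMb'⟩⟩ := id hb
  have hac' := hac.continuous
  have hbc' := hbc.continuous
  have hbf := hbc.continuous_fderiv one_ne_zero
  have := isGaussian_stdG ι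
  have hMa0 : 0 ≤ Ma := (abs_nonneg _).trans (hMa 0)
  have hMb0 : 0 ≤ Mb' := (norm_nonneg _).trans (hMb' 0)
  set μ := (stdG ι).prod (stdG ι) with hμ
  -- `F` runs from `E[ab]` at `t = 0` to `E[a] E[b]` at `t = π/2`, so the covariance is `-∫ F'`.
  set F : ℝ → ℝ := fun t => ∫ p, a p.1 * b (mix t p) ∂μ with hF
  set D : ℝ → (ι → ℝ) × (ι → ℝ) → ℝ := fun t p =>
    a p.1 * fderiv ℝ b (mix t p) (-Real.sin t • p.1 + Real.cos t • p.2) with hD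
  have hmixc : Continuous fun q : ℝ × ((ι → ℝ) × (ι → ℝ)) => mix q.1 q.2 := by
    unfold mix; fun_prop
  have hDc : Continuous fun q : ℝ × ((ι → ℝ) × (ι → ℝ)) => D q.1 q.2 := by
    simp only [hD]
    exact (hac'.comp (by fun_prop)).mul ((hbf.comp hmixc).clm_apply (by fun_prop))
  have hnorm : Integrable (fun p : (ι → ℝ) × (ι → ℝ) => Ma * (Mb' * (‖p.1‖ + ‖p.2‖))) μ := by
    have h1 : Integrable (fun y : ι → ℝ => ‖y‖) (stdG ι) := IsGaussian.integrable_id.norm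
    exact (((h1.comp_fst _).add (h1.comp_snd _)).const_mul _).const_mul _
  have hDb : ∀ t p, ‖D t p‖ ≤ Ma * (Mb' * (‖p.1‖ + ‖p.2‖)) := by
    intro t p
    simp only [hD]
    rw [norm_mul]
    refine mul_le_mul (hMa _) ?_ (norm_nonneg _) hMa0
    refine ((fderiv ℝ b (mix t p)).le_opNorm _).trans
      (mul_le_mul (hMb' _) ?_ (norm_nonneg _) hMb0)
    refine (norm_add_le _ _).trans (add_le_add ?_ ?_)
    · rw [norm_smul, norm_neg]
      exact mul_le_of_le_one_left (norm_nonneg _) (Real.abs_sin_le_one t)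
    · rw [norm_smul]
      exact mul_le_of_le_one_left (norm_nonneg _) (Real.abs_cos_le_one t)
  have hder : ∀ t, HasDerivAt F (∫ p, D t p ∂μ) t := by
    intro t
    refine (hasDerivAt_integral_of_dominated_loc_of_deriv_le (F' := fun t p => D t p)
      (Metric.ball_mem_nhds t one_pos) ?_ ?_ ?_ ?_ hnorm ?_).2
    · exact Eventually.of_forall fun s => ((hac'.comp continuous_fst).mul
        (hbc'.comp (continuous_mix s))).aestronglyMeasurable
    · refine Integrable.of_bound ((hac'.comp continuous_fst).mul
        (hbc'.comp (continuous_mix t))).aestronglyMeasurable (Ma * Mb)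
        (Eventually.of_forall fun p => ?_)
      rw [norm_mul]
      exact mul_le_mul (hMa _) (hMb _) (norm_nonneg _) hMa0
    · exact (hDc.comp (continuous_const.prodMk continuous_id)).aestronglyMeasurable
    · exact Eventually.of_forall fun p s _ => hDb s p
    · refine Eventually.of_forall fun p s _ => ?_
      refine HasDerivAt.const_mul (a p.1) ?_
      refine ((hbc.differentiable one_ne_zero _).hasFDerivAt).comp_hasDerivAt s ?_
      exact ((Real.hasDerivAt_cos s).smul_const p.1).add ((Real.hasDerivAt_sin s).smul_const p.2)
  have hcont : Continuous fun t => ∫ p, D t p ∂μ := by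
    refine continuous_of_dominated (fun t => ?_) (fun t => Eventually.of_forall (hDb t)) hnorm
      (Eventually.of_forall fun p => hDc.comp (continuous_id.prodMk continuous_const))
    exact (hDc.comp (continuous_const.prodMk continuous_id)).aestronglyMeasurable
  have hftc := intervalIntegral.integral_eq_sub_of_hasDerivAt (a := 0) (b := Real.pi / 2)
    (fun t _ => hder t) (hcont.intervalIntegrable _ _)
  have h0 : F 0 = ∫ y, a y * b y ∂stdG ι := by
    simp only [hF, mix, Real.cos_zero, Real.sin_zero, one_smul, zero_smul, add_zero]
    rw [hμ, integral_fun_fst (fun y => a y * b y)]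
    simp
  have h1 : F (Real.pi / 2) = (∫ y, a y ∂stdG ι) * ∫ y, b y ∂stdG ι := by
    simp only [hF, mix, Real.cos_pi_div_two, Real.sin_pi_div_two, one_smul, zero_smul, zero_add]
    exact integral_prod_mul a b
  rw [← h0, ← h1, ← neg_sub, ← hftc, ← intervalIntegral.integral_neg]
  refine intervalIntegral.integral_congr fun t _ => ?_
  simp only [hD]
  rw [integral_mul_fderiv_mix ha hb t]
  ring

end

/-! ### Gaussian Poincaré inequality, cutoff-friendly calculus and a covariance bound. -/

section

variable {ι : Type*} [Fintype ι] [DecidableEq ι]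

theorem integral_comp_mix_stdG (t : ℝ) {g : (ι → ℝ) → ℝ} (hg : Continuous g) :
    ∫ p, g (mix t p) ∂(stdG ι).prod (stdG ι) = ∫ y, g y ∂stdG ι := by
  rw [← integral_map (continuous_mix t).aemeasurable hg.aestronglyMeasurable, map_mix_stdG]

theorem integral_comp_fst_stdG (g : (ι → ℝ) → ℝ) :
    ∫ p, g p.1 ∂(stdG ι).prod (stdG ι) = ∫ y, g y ∂stdG ι := by
  rw [integral_fun_fst]; simp

theorem integrable_of_bdd {α : Type*} [TopologicalSpace α] [MeasurableSpace α] [BorelSpace α]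
    {μ : Measure α} [IsFiniteMeasure μ] {g : α → ℝ} [SecondCountableTopology α]
    (hg : Continuous g) (hb : ∃ M, ∀ y, |g y| ≤ M) : Integrable g μ := by
  obtain ⟨M, hM⟩ := hb
  exact Integrable.of_bound hg.aestronglyMeasurable M (Eventually.of_forall hM)

theorem BddC1.bdd_par {a : (ι → ℝ) → ℝ} (ha : BddC1 a) (i : ι) : ∃ M, ∀ y, |par i a y| ≤ M := by
  obtain ⟨M, hM⟩ := ha.bdd_fderiv
  exact ⟨M, fun y => (abs_par_le i a y).trans (hM y)⟩

theorem bdd_mul {α : Type*} {f g : α → ℝ} (hf : ∃ M, ∀ y, |f y| ≤ M) (hg : ∃ M, ∀ y, |g y| ≤ M) :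
    ∃ M, ∀ y, |f y * g y| ≤ M := by
  obtain ⟨M, hM⟩ := hf
  obtain ⟨N, hN⟩ := hg
  refine ⟨M * N, fun y => ?_⟩
  rw [abs_mul]
  exact mul_le_mul (hM y) (hN y) (abs_nonneg _) ((abs_nonneg _).trans (hM y))

theorem bdd_sum {α κ : Type*} (s : Finset κ) {f : κ → α → ℝ} (hf : ∀ i, ∃ M, ∀ y, |f i y| ≤ M) :
    ∃ M, ∀ y, |∑ i ∈ s, f i y| ≤ M := by
  choose M hM using hf
  exact ⟨∑ i ∈ s, M i, fun y => (Finset.abs_sum_le_sum_abs _ _).trans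
    (Finset.sum_le_sum fun i _ => hM i y)⟩

theorem bdd_sq {α : Type*} {f : α → ℝ} (hf : ∃ M, ∀ y, |f y| ≤ M) :
    ∃ M, ∀ y, |f y ^ 2| ≤ M := by
  simpa only [sq] using bdd_mul hf hf

theorem bdd_comp {α β : Type*} {f : α → ℝ} (hf : ∃ M, ∀ y, |f y| ≤ M) (g : β → α) :
    ∃ M, ∀ y, |f (g y)| ≤ M := by
  obtain ⟨M, hM⟩ := hf
  exact ⟨M, fun y => hM _⟩

theorem integral_sin_zero_pi_div_two : ∫ t in (0 : ℝ)..(Real.pi / 2), Real.sin t = 1 := by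
  simp

/-- The gaussian Poincaré inequality. -/
theorem poincare_stdG {a : (ι → ℝ) → ℝ} (ha : BddC1 a) :
    ∫ y, a y ^ 2 ∂stdG ι - (∫ y, a y ∂stdG ι) ^ 2 ≤ ∫ y, ∑ i, par i a y ^ 2 ∂stdG ι := by
  have hpc := fun i => continuous_par ha.contDiff i
  have hpb := fun i => ha.bdd_par i
  set V := ∫ y, ∑ i, par i a y ^ 2 ∂stdG ι with hV
  have hle : ∀ t, ∫ p, ∑ i, par i a p.1 * par i a (mix t p) ∂(stdG ι).prod (stdG ι) ≤ V := by
    intro t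
    have hmc := continuous_mix (ι := ι) t
    have e1 := integral_comp_mix_stdG t (g := fun y => ∑ i, par i a y ^ 2) (by fun_prop)
    have e2 := integral_comp_fst_stdG (fun y => ∑ i, par i a y ^ 2)
    have i1 : Integrable (fun p : (ι → ℝ) × (ι → ℝ) => ∑ i, par i a (mix t p) ^ 2)
        ((stdG ι).prod (stdG ι)) := integrable_of_bdd (by fun_prop)
          (bdd_comp (f := fun y => ∑ i, par i a y ^ 2) (bdd_sum _ fun i => bdd_sq (hpb i)) (mix t))
    have i2 : Integrable (fun p : (ι → ℝ) × (ι → ℝ) => ∑ i, par i a p.1 ^ 2)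
        ((stdG ι).prod (stdG ι)) := integrable_of_bdd (by fun_prop)
          (bdd_comp (f := fun y => ∑ i, par i a y ^ 2) (bdd_sum _ fun i => bdd_sq (hpb i)) Prod.fst)
    calc _ ≤ ∫ p, (1 / 2 : ℝ) * ((∑ i, par i a (mix t p) ^ 2) + ∑ i, par i a p.1 ^ 2)
          ∂(stdG ι).prod (stdG ι) := by
          refine integral_mono ?_ ((i1.add i2).const_mul _) fun p => ?_
          · exact integrable_of_bdd (by fun_prop) (bdd_sum _ fun i =>
              bdd_mul (bdd_comp (hpb i) Prod.fst) (bdd_comp (hpb i) (mix t)))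
          · simp only
            rw [← Finset.sum_add_distrib, Finset.mul_sum]
            refine Finset.sum_le_sum fun i _ => ?_
            -- Since `p.1` and `mix t p` have the same law, `xy ≤ (x² + y²)/2` replaces
            -- Cauchy-Schwarz.
            nlinarith [sq_nonneg (par i a p.1 - par i a (mix t p))]
      _ = V := by
          rw [integral_const_mul, integral_add i1 i2, e1, e2, hV]; ring
  have hcov := covariance_stdG ha ha
  have hV0 : 0 ≤ V := integral_nonneg fun y => Finset.sum_nonneg fun i _ => sq_nonneg _
  simp_rw [← sq] at hcov
  rw [hcov]
  by_cases hi : IntervalIntegrable (fun t => Real.sin t *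
      ∫ p, ∑ i, par i a p.1 * par i a (mix t p) ∂(stdG ι).prod (stdG ι)) volume 0 (Real.pi / 2)
  · calc _ ≤ ∫ t in (0 : ℝ)..(Real.pi / 2), Real.sin t * V := by
          refine intervalIntegral.integral_mono_on (by positivity) hi
            ((Real.continuous_sin.mul continuous_const).intervalIntegrable _ _) fun t ht => ?_
          exact mul_le_mul_of_nonneg_left (hle t) (Real.sin_nonneg_of_nonneg_of_le_pi ht.1
            (ht.2.trans (by linarith [Real.pi_pos])))
      _ = V := by rw [intervalIntegral.integral_mul_const, integral_sin_zero_pi_div_two, one_mul]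
  -- A non-integrable integrand has integral `0` by convention, and `0 ≤ V`; so integrability in `t`
  -- need not be proved.
  · rw [intervalIntegral.integral_undef hi]; exact hV0

theorem BddC1.of_hasCompactSupport {a : (ι → ℝ) → ℝ} (ha : ContDiff ℝ 1 a)
    (hs : HasCompactSupport a) : BddC1 a :=
  ⟨ha, hs.exists_bound_of_continuous ha.continuous,
    (hs.fderiv (𝕜 := ℝ)).exists_bound_of_continuous (ha.continuous_fderiv one_ne_zero)⟩

/-- The squared norm of the Hessian at `y` applied to the gradient at `z`. -/
def hessGrad (h : (ι → ℝ) → ℝ) (y z : ι → ℝ) : ℝ :=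
  ∑ i, (∑ j, par i (par j h) y * par j h z) ^ 2

theorem contDiff_par {h : (ι → ℝ) → ℝ} (hh : ContDiff ℝ 2 h) (i : ι) : ContDiff ℝ 1 (par i h) :=
  (hh.fderiv_right (m := 1) (by norm_num)).clm_apply contDiff_const

theorem hasCompactSupport_par {h : (ι → ℝ) → ℝ} (hh : HasCompactSupport h) (i : ι) :
    HasCompactSupport (par i h) := by
  refine (hh.fderiv (𝕜 := ℝ)).mono' fun y hy => subset_closure ?_
  simp only [Function.mem_support, par] at hy ⊢
  contrapose! hy
  simp [hy]

theorem par_add {a b : (ι → ℝ) → ℝ} {y : ι → ℝ} (ha : DifferentiableAt ℝ a y)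
    (hb : DifferentiableAt ℝ b y) (i : ι) :
    par i (fun y => a y + b y) y = par i a y + par i b y := by
  simp [par, fderiv_fun_add ha hb]

theorem par_mul {a b : (ι → ℝ) → ℝ} {y : ι → ℝ} (ha : DifferentiableAt ℝ a y)
    (hb : DifferentiableAt ℝ b y) (i : ι) :
    par i (fun y => a y * b y) y = a y * par i b y + b y * par i a y := by
  simp [par, fderiv_fun_mul ha hb]

theorem par_sum {κ : Type*} (s : Finset κ) {a : κ → (ι → ℝ) → ℝ} {y : ι → ℝ}
    (ha : ∀ k, DifferentiableAt ℝ (a k) y) (i : ι) :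
    par i (fun y => ∑ k ∈ s, a k y) y = ∑ k ∈ s, par i (a k) y := by
  simp [par, fderiv_fun_sum fun k _ => ha k]

theorem par_comp_affine {a : (ι → ℝ) → ℝ} (c : ℝ) (v : ι → ℝ) {y : ι → ℝ}
    (ha : Differentiable ℝ a) (i : ι) :
    par i (fun y => a (c • y + v)) y = c * par i a (c • y + v) := by
  have hd : HasFDerivAt (fun y : ι → ℝ => a (c • y + v))
      ((fderiv ℝ a (c • y + v)).comp (c • ContinuousLinearMap.id ℝ (ι → ℝ))) y := by
    refine (ha _).hasFDerivAt.comp y ?_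
    exact ((hasFDerivAt_id y).const_smul c).add_const _
  rw [par, hd.fderiv]
  simp [par]

/-- A bound for the covariance of a function with values in `[-1, 1]` with another one. -/
theorem abs_cov_le {α : Type*} [MeasurableSpace α] {μ : Measure α} [IsProbabilityMeasure μ]
    {c q : α → ℝ} (hc : AEStronglyMeasurable c μ) (hc1 : ∀ y, |c y| ≤ 1) (hq : Integrable q μ)
    (hq2 : Integrable (fun y => q y ^ 2) μ) {l : ℝ} (hl : 0 < l) :
    |∫ y, c y * q y ∂μ - (∫ y, c y ∂μ) * ∫ y, q y ∂μ| ≤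
      ((∫ y, q y ^ 2 ∂μ - (∫ y, q y ∂μ) ^ 2) / l + l) / 2 := by
  set m := ∫ y, q y ∂μ with hm
  have hci : Integrable c μ := Integrable.of_bound hc 1 (Eventually.of_forall hc1)
  have hcq : Integrable (fun y => c y * q y) μ := hq.bdd_mul hc (Eventually.of_forall hc1)
  have e1 : ∫ y, c y * q y ∂μ - (∫ y, c y ∂μ) * m = ∫ y, c y * (q y - m) ∂μ := by
    rw [← integral_mul_const, ← integral_sub hcq (hci.mul_const _)]
    congr 1; ext y; ring
  have i3 : Integrable (fun y => ((q y - m) ^ 2 / l + l) / 2) μ := by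
    have : Integrable (fun y => (q y ^ 2 - 2 * m * q y + m ^ 2)) μ :=
      (hq2.sub (hq.const_mul _)).add (integrable_const _)
    refine Integrable.div_const (Integrable.add (Integrable.div_const ?_ l)
      (integrable_const _)) 2
    refine this.congr (Eventually.of_forall fun y => ?_)
    simp only; ring
  have e2 : ∫ y, ((q y - m) ^ 2 / l + l) / 2 ∂μ =
      ((∫ y, q y ^ 2 ∂μ - m ^ 2) / l + l) / 2 := by
    have : (fun y => ((q y - m) ^ 2 / l + l) / 2) =
        fun y => ((q y ^ 2 - (2 * m * q y - m ^ 2)) / l + l) / 2 := by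
      ext y; ring
    rw [this, integral_div, integral_add, integral_div, integral_sub hq2, integral_sub,
      integral_const_mul, ← hm]
    · simp; ring
    · exact hq.const_mul _
    · exact integrable_const _
    · exact (hq.const_mul _).sub (integrable_const _)
    · exact (hq2.sub ((hq.const_mul _).sub (integrable_const _))).div_const _
    · exact integrable_const _
  -- The free parameter `l` stands for the standard deviation of `q`. Keeping it, by `2xl ≤ x² +
  -- l²`, leaves a bound that is linear in the variance and can still be averaged over a further
  -- variable.
  rw [e1, ← e2]
  refine (abs_integral_le_integral_abs).trans (integral_mono_of_nonneg
    (Eventually.of_forall fun y => abs_nonneg _) i3 (Eventually.of_forall fun y => ?_))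
  simp only
  rw [abs_mul, le_div_iff₀ two_pos, ← sub_nonneg]
  have h1 : |c y| * |q y - m| ≤ |q y - m| := mul_le_of_le_one_left (abs_nonneg _) (hc1 y)
  have h2 : (q y - m) ^ 2 / l + l - 2 * |q y - m| = (|q y - m| - l) ^ 2 / l := by
    rw [← sq_abs]; field_simp; ring
  have h3 : 0 ≤ (|q y - m| - l) ^ 2 / l := by positivity
  linarith

end

/-! ### Stein discrepancy of compactly supported functions. -/

section

variable {ι : Type*} [Fintype ι] [DecidableEq ι]

/-- The inner product of the gradients at `p.1` and `mix t p`. -/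
def gradMix (h : (ι → ℝ) → ℝ) (t : ℝ) (p : (ι → ℝ) × (ι → ℝ)) : ℝ :=
  ∑ j, par j h p.1 * par j h (mix t p)

/-- As `c` depends on the first variable only, the covariance is the average over the second
variable `z` of the covariances for fixed `z`. For each `z` the Poincaré inequality in the first
variable applies to `gradMix`, and its gradient consists of the two products of a Hessian with a
gradient that `h1` and `h2` control. -/
theorem abs_cov_gradMix_le {h : (ι → ℝ) → ℝ} (hh : ContDiff ℝ 2 h) (hs : HasCompactSupport h)
    {c : (ι → ℝ) → ℝ} (hc : Continuous c) (hc1 : ∀ y, |c y| ≤ 1) {K : ℝ} (hK : 0 < K) {t : ℝ}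
    (ht : 0 ≤ Real.cos t)
    (h1 : ∫ p, hessGrad h p.1 (mix t p) ∂(stdG ι).prod (stdG ι) ≤ K ^ 2)
    (h2 : ∫ p, hessGrad h (mix t p) p.1 ∂(stdG ι).prod (stdG ι) ≤ K ^ 2) :
    |∫ p, c p.1 * gradMix h t p ∂(stdG ι).prod (stdG ι) -
      (∫ y, c y ∂stdG ι) * ∫ p, gradMix h t p ∂(stdG ι).prod (stdG ι)| ≤
      (1 + Real.cos t) * K := by
  set L := (1 + Real.cos t) * K with hL
  have hL0 : 0 < L := by positivity
  have hmc := continuous_mix (ι := ι) t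
  have hg1 := fun j => contDiff_par hh j
  have hgc := fun j => (hg1 j).continuous
  have hgs := fun j => hasCompactSupport_par hs j
  have hgb := fun j => BddC1.of_hasCompactSupport (hg1 j) (hgs j)
  have hHc := fun i j => continuous_par (hg1 j) i
  have hHb := fun i j => (hgb j).bdd_par i
  have qc : Continuous (gradMix h t) := by unfold gradMix; fun_prop
  have qb : ∃ M, ∀ p, |gradMix h t p| ≤ M :=
    bdd_sum _ fun j => bdd_mul (bdd_comp (hgb j).bdd Prod.fst) (bdd_comp (hgb j).bdd (mix t))
  have qi : Integrable (gradMix h t) ((stdG ι).prod (stdG ι)) := integrable_of_bdd qc qb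
  have cqi : Integrable (fun p => c p.1 * gradMix h t p) ((stdG ι).prod (stdG ι)) :=
    integrable_of_bdd (by fun_prop) (bdd_mul ⟨1, fun p => hc1 _⟩ qb)
  -- the section of `gradMix` at a fixed second coordinate
  have qsec : ∀ z, BddC1 fun y => gradMix h t (y, z) := by
    intro z
    refine BddC1.of_hasCompactSupport ?_ ?_
    · unfold gradMix mix
      refine ContDiff.sum fun j _ => (hg1 j).mul ((hg1 j).comp ?_)
      fun_prop
    · unfold gradMix
      refine HasCompactSupport.of_support_subset_isCompact
        (isCompact_iUnion fun j => (hgs j)) fun y hy => ?_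
      rw [Function.mem_support] at hy
      obtain ⟨j, -, hj⟩ := Finset.exists_ne_zero_of_sum_ne_zero hy
      exact Set.mem_iUnion.2 ⟨j, subset_tsupport _ (left_ne_zero_of_mul hj)⟩
  have qpar : ∀ z y i, par i (fun y => gradMix h t (y, z)) y =
      ∑ j, par i (par j h) y * par j h (mix t (y, z)) +
      Real.cos t * ∑ j, par i (par j h) (mix t (y, z)) * par j h y := by
    intro z y i
    have hd1 := fun j => (hg1 j).differentiable one_ne_zero
    have hd2 : ∀ j, DifferentiableAt ℝ
        (fun y => par j h (Real.cos t • y + Real.sin t • z)) y := by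
      intro j
      exact ((hd1 j) _).comp y (by fun_prop)
    simp only [gradMix, mix]
    rw [par_sum (a := fun j y => par j h y * par j h (Real.cos t • y + Real.sin t • z)) _
      (fun j => (hd1 j y).fun_mul (hd2 j)), Finset.mul_sum, ← Finset.sum_add_distrib]
    refine Finset.sum_congr rfl fun j _ => ?_
    rw [par_mul (hd1 j y) (hd2 j), par_comp_affine _ _ (hd1 j)]
    ring
  -- the two bounds combined
  set V : (ι → ℝ) × (ι → ℝ) → ℝ := fun p =>
    ∑ i, par i (fun y => gradMix h t (y, p.2)) p.1 ^ 2 with hV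
  have hVle : ∀ p, V p ≤ (1 + Real.cos t) *
      (hessGrad h p.1 (mix t p) + Real.cos t * hessGrad h (mix t p) p.1) := by
    intro p
    simp only [hV, hessGrad]
    rw [Finset.mul_sum (a := Real.cos t), ← Finset.sum_add_distrib, Finset.mul_sum]
    refine Finset.sum_le_sum fun i _ => ?_
    rw [qpar]
    set A := ∑ j, par i (par j h) p.1 * par j h (mix t (p.1, p.2))
    set B := ∑ j, par i (par j h) (mix t (p.1, p.2)) * par j h p.1
    -- Convexity with weights `1` and `cos t`: this form of Cauchy-Schwarz makes the final bound
    -- exactly `((1 + cos t) K)²`.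
    have : (1 + Real.cos t) * (A ^ 2 + Real.cos t * B ^ 2) - (A + Real.cos t * B) ^ 2 =
        Real.cos t * (A - B) ^ 2 := by ring
    have h3 : 0 ≤ Real.cos t * (A - B) ^ 2 := by positivity
    exact sub_nonneg.1 (this ▸ h3)
  have hGc : Continuous fun p : (ι → ℝ) × (ι → ℝ) => hessGrad h p.1 (mix t p) := by
    unfold hessGrad; fun_prop
  have hGc' : Continuous fun p : (ι → ℝ) × (ι → ℝ) => hessGrad h (mix t p) p.1 := by
    unfold hessGrad; fun_prop
  have i1 : Integrable (fun p : (ι → ℝ) × (ι → ℝ) => hessGrad h p.1 (mix t p))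
      ((stdG ι).prod (stdG ι)) := integrable_of_bdd hGc (bdd_sum _ fun i => bdd_sq
        (bdd_sum _ fun j => bdd_mul (bdd_comp (hHb i j) Prod.fst) (bdd_comp (hgb j).bdd (mix t))))
  have i2 : Integrable (fun p : (ι → ℝ) × (ι → ℝ) => hessGrad h (mix t p) p.1)
      ((stdG ι).prod (stdG ι)) := integrable_of_bdd hGc' (bdd_sum _ fun i => bdd_sq
        (bdd_sum _ fun j => bdd_mul (bdd_comp (hHb i j) (mix t)) (bdd_comp (hgb j).bdd Prod.fst)))
  have i3 := (i1.add (i2.const_mul (Real.cos t))).const_mul (1 + Real.cos t)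
  have Vc : Continuous V := by
    simp only [hV, qpar]; fun_prop
  have Vi : Integrable V ((stdG ι).prod (stdG ι)) := by
    refine i3.mono' Vc.aestronglyMeasurable (Eventually.of_forall fun p => ?_)
    rw [Real.norm_of_nonneg (Finset.sum_nonneg fun i _ => sq_nonneg _)]
    exact hVle p
  have hVint : ∫ p, V p ∂(stdG ι).prod (stdG ι) ≤ L ^ 2 := by
    refine (integral_mono Vi i3 hVle).trans ?_
    simp only [Pi.add_apply]
    rw [integral_const_mul, integral_add i1 (i2.const_mul _), integral_const_mul, hL]
    have : (1 + Real.cos t) * (K ^ 2 + Real.cos t * K ^ 2) = ((1 + Real.cos t) * K) ^ 2 := by ring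
    rw [← this]
    gcongr
  -- disintegrate along the second coordinate
  have e1 : ∫ p, c p.1 * gradMix h t p ∂(stdG ι).prod (stdG ι) -
      (∫ y, c y ∂stdG ι) * ∫ p, gradMix h t p ∂(stdG ι).prod (stdG ι) =
      ∫ z, (∫ y, c y * gradMix h t (y, z) ∂stdG ι -
        (∫ y, c y ∂stdG ι) * ∫ y, gradMix h t (y, z) ∂stdG ι) ∂stdG ι := by
    rw [integral_sub, integral_const_mul, integral_prod_symm _ cqi, integral_prod_symm _ qi]
    · exact cqi.integral_prod_right
    · exact qi.integral_prod_right.const_mul _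
  rw [e1]
  refine (abs_integral_le_integral_abs).trans ?_
  have hVsec : Integrable (fun z => ∫ y, V (y, z) ∂stdG ι) (stdG ι) := Vi.integral_prod_right
  have i4 : Integrable (fun z => ((∫ y, V (y, z) ∂stdG ι) / L + L) / 2) (stdG ι) :=
    ((hVsec.div_const _).add (integrable_const _)).div_const _
  -- The parameter of `abs_cov_le` is the same `L` for all `z`, so that the average over `z` only
  -- involves the integral of `V`, and `(L² / L + L) / 2 = L`.
  calc _ ≤ ∫ z, ((∫ y, V (y, z) ∂stdG ι) / L + L) / 2 ∂stdG ι := by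
        refine integral_mono_of_nonneg (Eventually.of_forall fun y => abs_nonneg _) i4
          (Eventually.of_forall fun z => ?_)
        have hz := qsec z
        refine (abs_cov_le hc.aestronglyMeasurable hc1
          (integrable_of_bdd hz.contDiff.continuous hz.bdd)
          (integrable_of_bdd (hz.contDiff.continuous.pow 2) (bdd_sq hz.bdd)) hL0).trans ?_
        have := poincare_stdG hz
        simp only [hV]
        gcongr
    _ = ((∫ p, V p ∂(stdG ι).prod (stdG ι)) / L + L) / 2 := by
        rw [integral_div, integral_add (hVsec.div_const _) (integrable_const _), integral_div,
          integral_prod_symm _ Vi]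
        simp
    _ ≤ (L ^ 2 / L + L) / 2 := by gcongr
    _ = L := by field_simp; ring

/-- The origin of the constant `3 / 2` in the Stein bound. -/
theorem integral_sin_mul_one_add_cos :
    ∫ t in (0 : ℝ)..(Real.pi / 2), Real.sin t * (1 + Real.cos t) = 3 / 2 := by
  have : ∀ t ∈ Set.uIcc (0 : ℝ) (Real.pi / 2),
      HasDerivAt (fun t => -Real.cos t + Real.sin t ^ 2 / 2)
        (Real.sin t * (1 + Real.cos t)) t := by
    intro t _
    have := (Real.hasDerivAt_cos t).neg.add (((Real.hasDerivAt_sin t).pow 2).div_const 2)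
    refine this.congr_deriv ?_
    simp; ring
  rw [intervalIntegral.integral_eq_sub_of_hasDerivAt this
    ((by fun_prop : Continuous fun t => Real.sin t * (1 + Real.cos t)).intervalIntegrable _ _)]
  simp
  norm_num

theorem abs_le_of_abs_deriv_le_one {φ : ℝ → ℝ} (hφ : ContDiff ℝ 1 φ)
    (hφ1 : ∀ x, |deriv φ x| ≤ 1) (x : ℝ) : |φ x| ≤ |φ 0| + |x| := by
  have := Convex.norm_image_sub_le_of_norm_deriv_le (f := φ) (C := 1) (s := Set.univ) (x := 0)
    (y := x) (fun x _ => hφ.differentiable one_ne_zero x) (fun x _ => hφ1 x) convex_univ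
    trivial trivial
  rw [one_mul, sub_zero, Real.norm_eq_abs, Real.norm_eq_abs] at this
  have h2 := abs_add_le (φ 0) (φ x - φ 0)
  rw [add_sub_cancel] at h2
  linarith

theorem bddC1_comp {h : (ι → ℝ) → ℝ} (hh : BddC1 h) {φ : ℝ → ℝ} (hφ : ContDiff ℝ 1 φ)
    (hφ1 : ∀ x, |deriv φ x| ≤ 1) : BddC1 fun y => φ (h y) := by
  obtain ⟨hc, ⟨M, hM⟩, ⟨M', hM'⟩⟩ := hh
  refine ⟨hφ.comp hc, ⟨|φ 0| + M, fun y => (abs_le_of_abs_deriv_le_one hφ hφ1 _).trans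
    (add_le_add le_rfl (hM y))⟩, ⟨M', fun y => ?_⟩⟩
  have hd : HasFDerivAt (fun y => φ (h y)) (deriv φ (h y) • fderiv ℝ h y) y :=
    (hφ.differentiable one_ne_zero _).hasDerivAt.comp_hasFDerivAt y
      (hc.differentiable one_ne_zero y).hasFDerivAt
  rw [hd.fderiv, norm_smul]
  exact (mul_le_of_le_one_left (norm_nonneg _) (hφ1 _)).trans (hM' y)

theorem par_comp {h : (ι → ℝ) → ℝ} {φ : ℝ → ℝ} {y : ι → ℝ} (hφ : DifferentiableAt ℝ φ (h y))
    (hh : DifferentiableAt ℝ h y) (i : ι) :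
    par i (fun y => φ (h y)) y = deriv φ (h y) * par i h y := by
  have hd : HasFDerivAt (fun y => φ (h y)) (deriv φ (h y) • fderiv ℝ h y) y :=
    hφ.hasDerivAt.comp_hasFDerivAt y hh.hasFDerivAt
  rw [par, hd.fderiv]; rfl

theorem continuous_integral_mul_gradMix {h : (ι → ℝ) → ℝ} (hh : ContDiff ℝ 2 h)
    (hs : HasCompactSupport h) {c : (ι → ℝ) → ℝ} (hc : Continuous c) (hc1 : ∀ y, |c y| ≤ 1) :
    Continuous fun t => ∫ p, c p.1 * gradMix h t p ∂(stdG ι).prod (stdG ι) := by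
  have hgc := fun j => (contDiff_par hh j).continuous
  have hgb := fun j => BddC1.of_hasCompactSupport (contDiff_par hh j) (hasCompactSupport_par hs j)
  have mixc : Continuous fun q : ℝ × ((ι → ℝ) × (ι → ℝ)) => mix q.1 q.2 := by
    unfold mix; fun_prop
  have qb : ∃ M, ∀ q : ℝ × ((ι → ℝ) × (ι → ℝ)), |gradMix h q.1 q.2| ≤ M := by
    unfold gradMix
    refine bdd_sum _ fun j => bdd_mul ?_ ?_
    · exact bdd_comp (hgb j).bdd fun q : ℝ × ((ι → ℝ) × (ι → ℝ)) => q.2.1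
    · exact bdd_comp (hgb j).bdd fun q : ℝ × ((ι → ℝ) × (ι → ℝ)) => mix q.1 q.2
  have qc : Continuous fun q : ℝ × ((ι → ℝ) × (ι → ℝ)) => gradMix h q.1 q.2 := by
    unfold gradMix
    exact continuous_finsetSum _ fun j _ => ((hgc j).comp (by fun_prop)).mul ((hgc j).comp mixc)
  obtain ⟨M, hM⟩ := qb
  refine continuous_of_dominated (bound := fun _ => M)
    (fun t => ?_) (fun t => Eventually.of_forall fun p => ?_) (integrable_const _)
    (Eventually.of_forall fun p =>
      continuous_const.mul (qc.comp (continuous_id.prodMk continuous_const)))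
  · exact ((hc.comp continuous_fst).mul
      (qc.comp (continuous_const.prodMk continuous_id))).aestronglyMeasurable
  · rw [norm_mul]
    exact (mul_le_of_le_one_left (norm_nonneg _) (hc1 _)).trans (hM (t, p))

/-- The Stein discrepancy bound for compactly supported functions. -/
theorem stein_bound_of_hasCompactSupport {h : (ι → ℝ) → ℝ} (hh : ContDiff ℝ 2 h)
    (hs : HasCompactSupport h) {φ : ℝ → ℝ} (hφ : ContDiff ℝ 1 φ) (hφ1 : ∀ x, |deriv φ x| ≤ 1)
    {K : ℝ} (hK : 0 < K)
    (h1 : ∀ t, ∫ p, hessGrad h p.1 (mix t p) ∂(stdG ι).prod (stdG ι) ≤ K ^ 2)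
    (h2 : ∀ t, ∫ p, hessGrad h (mix t p) p.1 ∂(stdG ι).prod (stdG ι) ≤ K ^ 2) :
    |∫ y, φ (h y) * h y ∂stdG ι - (∫ y, φ (h y) ∂stdG ι) * ∫ y, h y ∂stdG ι -
      (∫ y, deriv φ (h y) ∂stdG ι) * (∫ y, h y ^ 2 ∂stdG ι - (∫ y, h y ∂stdG ι) ^ 2)| ≤
      3 / 2 * K := by
  have hh1 : ContDiff ℝ 1 h := hh.of_le (by norm_num)
  have hb := BddC1.of_hasCompactSupport hh1 hs
  -- The covariance of `φ ∘ h` with `h` and the variance of `h` are interpolated with the same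
  -- `gradMix`; their weighted difference is therefore an integral over `t` of covariances of `φ' ∘
  -- h` with `gradMix`.
  have c1 := covariance_stdG (bddC1_comp hb hφ hφ1) hb
  have c2 := covariance_stdG hb hb
  have hdc : Continuous (deriv φ) := hφ.continuous_deriv le_rfl
  have hhc := hh.continuous
  have hc := hdc.comp hhc
  have k2 := continuous_integral_mul_gradMix hh hs hc fun y => hφ1 _
  have k1 := continuous_integral_mul_gradMix hh hs (c := fun _ => 1) continuous_const (by simp)
  simp only [one_mul] at k1
  simp only [Function.comp_apply] at k2
  have k3 := Real.continuous_sin.fun_mul k2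
  have k4 := (continuous_const (y := ∫ y, deriv φ (h y) ∂stdG ι)).fun_mul
    (Real.continuous_sin.fun_mul k1)
  have e1 : ∀ t p, ∑ i, par i (fun y => φ (h y)) p.1 * par i h (mix t p) =
      deriv φ (h p.1) * gradMix h t p := by
    intro t p
    rw [gradMix, Finset.mul_sum]
    refine Finset.sum_congr rfl fun i _ => ?_
    rw [par_comp (hφ.differentiable one_ne_zero _) (hh1.differentiable one_ne_zero _), mul_assoc]
  simp only [e1] at c1
  simp_rw [← sq] at c2
  change _ = ∫ t in (0 : ℝ)..(Real.pi / 2), Real.sin t * ∫ p, gradMix h t p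
    ∂(stdG ι).prod (stdG ι) at c2
  rw [c1, c2, ← intervalIntegral.integral_const_mul, ← intervalIntegral.integral_sub (k3.intervalIntegrable _ _)
      (k4.intervalIntegrable _ _)]
  have hpi : (0 : ℝ) ≤ Real.pi / 2 := by positivity
  refine (intervalIntegral.abs_integral_le_integral_abs hpi).trans ?_
  calc _ ≤ ∫ t in (0 : ℝ)..(Real.pi / 2), Real.sin t * (1 + Real.cos t) * K := by
        refine intervalIntegral.integral_mono_on hpi
          (Continuous.intervalIntegrable ?_ _ _) (Continuous.intervalIntegrable ?_ _ _)
          fun t ht => ?_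
        · exact (k3.sub k4).abs
        · fun_prop
        have hsin : 0 ≤ Real.sin t := Real.sin_nonneg_of_nonneg_of_le_pi ht.1
          (ht.2.trans (by linarith [Real.pi_pos]))
        have hcos : 0 ≤ Real.cos t := Real.cos_nonneg_of_neg_pi_div_two_le_of_le
          (by linarith [ht.1]) ht.2
        have := abs_cov_gradMix_le hh hs hc (fun y => hφ1 _) hK hcos (h1 t) (h2 t)
        simp only [Function.comp_apply] at this ⊢
        rw [show Real.sin t * ∫ p, deriv φ (h p.1) * gradMix h t p ∂(stdG ι).prod (stdG ι) -
          (∫ y, deriv φ (h y) ∂stdG ι) * (Real.sin t * ∫ p, gradMix h t p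
            ∂(stdG ι).prod (stdG ι)) = Real.sin t * (∫ p, deriv φ (h p.1) * gradMix h t p
            ∂(stdG ι).prod (stdG ι) - (∫ y, deriv φ (h y) ∂stdG ι) * ∫ p, gradMix h t p
            ∂(stdG ι).prod (stdG ι)) by ring, abs_mul, abs_of_nonneg hsin, mul_assoc]
        exact mul_le_mul_of_nonneg_left this hsin
    _ = 3 / 2 * K := by
        rw [intervalIntegral.integral_mul_const, integral_sin_mul_one_add_cos]

end

/-! ### Removing the compact support by cutoff functions. -/

section

variable {ι : Type*} [Fintype ι] [DecidableEq ι]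

/-- The sum of the absolute values of a function and of its derivatives of order at most two. -/
def jetSum (h : (ι → ℝ) → ℝ) (y : ι → ℝ) : ℝ :=
  |h y| + ∑ j, |par j h y| + ∑ i, ∑ j, |par i (par j h) y|

theorem jetSum_nonneg (h : (ι → ℝ) → ℝ) (y : ι → ℝ) : 0 ≤ jetSum h y := by
  unfold jetSum; positivity

theorem abs_le_jetSum (h : (ι → ℝ) → ℝ) (y : ι → ℝ) : |h y| ≤ jetSum h y := by
  unfold jetSum
  have h1 : 0 ≤ ∑ j, |par j h y| := by positivity
  have h2 : 0 ≤ ∑ i, ∑ j, |par i (par j h) y| := by positivity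
  linarith

theorem abs_par_le_jetSum (h : (ι → ℝ) → ℝ) (y : ι → ℝ) (j : ι) : |par j h y| ≤ jetSum h y := by
  unfold jetSum
  have h1 := Finset.single_le_sum (f := fun j => |par j h y|) (fun _ _ => abs_nonneg _)
    (Finset.mem_univ j)
  have h2 : 0 ≤ ∑ i, ∑ j, |par i (par j h) y| := by positivity
  have := abs_nonneg (h y)
  linarith

theorem abs_par_par_le_jetSum (h : (ι → ℝ) → ℝ) (y : ι → ℝ) (i j : ι) :
    |par i (par j h) y| ≤ jetSum h y := by
  unfold jetSum
  have h1 := Finset.single_le_sum (f := fun j => |par i (par j h) y|) (fun _ _ => abs_nonneg _)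
    (Finset.mem_univ j)
  have h2 := Finset.single_le_sum (f := fun i => ∑ j, |par i (par j h) y|)
    (fun _ _ => by positivity) (Finset.mem_univ i)
  have h3 : 0 ≤ ∑ j, |par j h y| := by positivity
  have := abs_nonneg (h y)
  linarith

/-- The derivatives of a product with a cutoff function. -/
theorem par_par_mul {a b : (ι → ℝ) → ℝ} (ha : ContDiff ℝ 2 a) (hb : ContDiff ℝ 2 b) (i j : ι)
    (y : ι → ℝ) : par i (par j fun y => a y * b y) y = a y * par i (par j b) y +
      par j b y * par i a y + (b y * par i (par j a) y + par j a y * par i b y) := by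
  have da := ha.differentiable two_ne_zero
  have db := hb.differentiable two_ne_zero
  have e : (par j fun y => a y * b y) = fun y => a y * par j b y + b y * par j a y := by
    ext z; exact par_mul (da z) (db z) j
  have da' := (contDiff_par ha j).differentiable one_ne_zero
  have db' := (contDiff_par hb j).differentiable one_ne_zero
  rw [e, par_add ((da y).fun_mul (db' y)) ((db y).fun_mul (da' y)), par_mul (da y) (db' y),
    par_mul (db y) (da' y)]

/-- Young's inequality `(w + e)² ≤ (1 + c) w² + (1 + 1/c) e²` with `|e| ≤ c r`; the last term is at
most `(c² + c) r² ≤ 2c r²`. -/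
theorem sq_le_of_abs_sub_le {v w c r : ℝ} (hc : 0 < c) (hc1 : c ≤ 1) (h : |v - w| ≤ c * r) :
    v ^ 2 ≤ (1 + c) * w ^ 2 + 2 * c * r ^ 2 := by
  have h1 : (v - w) ^ 2 ≤ (c * r) ^ 2 := by
    rw [← sq_abs (v - w)]; gcongr
  have h2 : 0 ≤ (c * w - (v - w)) ^ 2 := sq_nonneg _
  have h3 : c * v ^ 2 ≤ c * ((1 + c) * w ^ 2 + 2 * c * r ^ 2) := by
    nlinarith [mul_nonneg (sub_nonneg.2 hc1) (sq_nonneg (c * r))]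
  exact le_of_mul_le_mul_left h3 hc

/-- Telescoping of a product. Here `x` and `g` are a second and a first derivative of a cut-off
function, `x'` and `g'` those of the function itself, and `s`, `s'` the values of the cutoff. The
constant is `3B(1 + B) + B`. -/
theorem abs_sub_mul_le_of_bounds {x x' g g' s s' B c P Q : ℝ} (hc : 0 ≤ c) (hc1 : c ≤ 1)
    (hB : 0 ≤ B) (hx : |x - s * x'| ≤ c * (3 * B) * P) (hg : |g - s' * g'| ≤ c * B * Q)
    (hs : |s| ≤ 1) (hs' : |s'| ≤ 1) (hx' : |x'| ≤ P) (hg' : |g'| ≤ Q) :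
    |x * g - s * s' * (x' * g')| ≤ c * (B * (3 * B + 4) * (P * Q)) := by
  have hP : 0 ≤ P := (abs_nonneg _).trans hx'
  have hQ : 0 ≤ Q := (abs_nonneg _).trans hg'
  have h1 : |g| ≤ (1 + B) * Q := by
    have e : g = (g - s' * g') + s' * g' := by ring
    rw [e]
    refine (abs_add_le _ _).trans ?_
    have h3 : |s' * g'| ≤ 1 * Q := by rw [abs_mul]; gcongr
    have h4 : c * B * Q ≤ 1 * B * Q := by gcongr
    nlinarith
  have h2 : |s * x'| ≤ P := by
    rw [abs_mul]; nlinarith [abs_nonneg s, abs_nonneg x']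
  have e : x * g - s * s' * (x' * g') = (x - s * x') * g + s * x' * (g - s' * g') := by ring
  rw [e]
  refine (abs_add_le _ _).trans ?_
  rw [abs_mul, abs_mul (s * x')]
  have h5 : |x - s * x'| * |g| ≤ (c * (3 * B) * P) * ((1 + B) * Q) := by gcongr
  have h6 : |s * x'| * |g - s' * g'| ≤ P * (c * B * Q) := by gcongr
  nlinarith

theorem exists_cutoff (ι : Type*) [Fintype ι] [DecidableEq ι] : ∃ χ : (ι → ℝ) → ℝ, ContDiff ℝ 2 χ ∧
    HasCompactSupport χ ∧ χ 0 = 1 ∧ (∀ y, |χ y| ≤ 1) ∧ ∃ B, 0 ≤ B ∧ (∀ i y, |par i χ y| ≤ B) ∧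
    ∀ i j y, |par i (par j χ) y| ≤ B := by
  let f : ContDiffBump (0 : ι → ℝ) := ⟨1, 2, by norm_num, by norm_num⟩
  have hf : ContDiff ℝ 2 f := f.contDiff
  have h1 : ∀ i, ∃ M, ∀ y, |par i f y| ≤ M := fun i =>
    (BddC1.of_hasCompactSupport (hf.of_le (by norm_num)) f.hasCompactSupport).bdd_par i
  have h2 : ∀ i j, ∃ M, ∀ y, |par i (par j f) y| ≤ M := fun i j =>
    (BddC1.of_hasCompactSupport (contDiff_par hf j)
      (hasCompactSupport_par f.hasCompactSupport j)).bdd_par i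
  choose M hM using h1
  choose N hN using h2
  refine ⟨f, hf, f.hasCompactSupport, f.one_of_mem_closedBall (by simp [f]), fun y => ?_,
    ∑ i, |M i| + ∑ i, ∑ j, |N i j|, by positivity, fun i y => ?_, fun i j y => ?_⟩
  · rw [abs_of_nonneg f.nonneg]; exact f.le_one
  · have h1 := Finset.single_le_sum (f := fun j => |M j|) (fun _ _ => abs_nonneg _)
      (Finset.mem_univ i)
    have h2 : 0 ≤ ∑ i, ∑ j, |N i j| := by positivity
    have := (hM i y).trans (le_abs_self _)
    linarith
  · have h1 := Finset.single_le_sum (f := fun j => |N i j|) (fun _ _ => abs_nonneg _)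
      (Finset.mem_univ j)
    have h2 := Finset.single_le_sum (f := fun i => ∑ j, |N i j|)
      (fun _ _ => by positivity) (Finset.mem_univ i)
    have h3 : 0 ≤ ∑ i, |M i| := by positivity
    have := (hN i j y).trans (le_abs_self _)
    linarith

/-- Each error term carries a derivative of `χ(c • ·)`, hence a factor `c`. The errors are bilinear
in the jets at `y` and `z`, so their squares are controlled by fourth powers: this is why `L⁴`
integrability is enough to let `c → 0`. -/
theorem hessGrad_cutoff_le {h χ : (ι → ℝ) → ℝ} (hh : ContDiff ℝ 2 h) (hχ : ContDiff ℝ 2 χ)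
    (hχ1 : ∀ y, |χ y| ≤ 1) {B : ℝ} (hB : 0 ≤ B) (hB1 : ∀ i y, |par i χ y| ≤ B)
    (hB2 : ∀ i j y, |par i (par j χ) y| ≤ B) {c : ℝ} (hc : 0 < c) (hc1 : c ≤ 1) (y z : ι → ℝ) :
    hessGrad (fun y => χ (c • y) * h y) y z ≤ (1 + c) * hessGrad h y z +
      c * (Fintype.card ι * (Fintype.card ι * (B * (3 * B + 4))) ^ 2) *
        (jetSum h y ^ 4 + jetSum h z ^ 4) := by
  have hχc : ContDiff ℝ 2 fun y => χ (c • y) := hχ.comp (by fun_prop)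
  have p1 : ∀ i, par i (fun y => χ (c • y)) = fun y => c * par i χ (c • y) := by
    intro i; ext y
    simpa using par_comp_affine c 0 (y := y) (hχ.differentiable two_ne_zero) i
  have p2 : ∀ i j y, par i (par j fun y => χ (c • y)) y = c * (c * par i (par j χ) (c • y)) := by
    intro i j y
    rw [p1]
    have h1 := par_comp_affine c 0 (y := y) ((contDiff_par hχ j).differentiable one_ne_zero) i
    simp only [add_zero] at h1
    have h2 : DifferentiableAt ℝ (fun y => par j χ (c • y)) y :=
      ((contDiff_par hχ j).differentiable one_ne_zero _).comp y (by fun_prop)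
    have h3 := par_mul (differentiableAt_const (𝕜 := ℝ) c) h2 i
    rw [h3, h1]
    simp [par]
  have hG : ∀ j y, |par j (fun y => χ (c • y) * h y) y - χ (c • y) * par j h y| ≤
      c * B * jetSum h y := by
    intro j y
    rw [par_mul (hχc.differentiable two_ne_zero y) (hh.differentiable two_ne_zero y), p1,
      add_sub_cancel_left, abs_mul, abs_mul, abs_of_pos hc, mul_comm]
    exact mul_le_mul (mul_le_mul_of_nonneg_left (hB1 _ _) hc.le) (abs_le_jetSum h y)
      (abs_nonneg _) (by positivity)
  -- Of the four Leibniz terms three survive, which gives the `3`; the one with both derivatives on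
  -- the cutoff carries `c² ≤ c`.
  have hH : ∀ i j y, |par i (par j fun y => χ (c • y) * h y) y -
      χ (c • y) * par i (par j h) y| ≤ c * (3 * B) * jetSum h y := by
    intro i j y
    rw [par_par_mul hχc hh, p2, p1, p1]
    have e1 : |par j h y * (c * par i χ (c • y))| ≤ c * B * jetSum h y := by
      rw [abs_mul, abs_mul, abs_of_pos hc, mul_comm]
      exact mul_le_mul (mul_le_mul_of_nonneg_left (hB1 _ _) hc.le) (abs_par_le_jetSum h y j)
        (abs_nonneg _) (by positivity)
    have e2 : |c * par j χ (c • y) * par i h y| ≤ c * B * jetSum h y := by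
      rw [abs_mul, abs_mul, abs_of_pos hc]
      exact mul_le_mul (mul_le_mul_of_nonneg_left (hB1 _ _) hc.le) (abs_par_le_jetSum h y i)
        (abs_nonneg _) (by positivity)
    have e3 : |h y * (c * (c * par i (par j χ) (c • y)))| ≤ c * B * jetSum h y := by
      rw [abs_mul, abs_mul, abs_mul, abs_of_pos hc, mul_comm]
      refine mul_le_mul (mul_le_mul_of_nonneg_left ?_ hc.le) (abs_le_jetSum h y)
        (abs_nonneg _) (by positivity)
      have := hB2 i j (c • y)
      nlinarith [abs_nonneg (par i (par j χ) (c • y))]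
    have e4 : ∀ a b d e : ℝ, |a + b + (d + e) - a| ≤ |b| + |d| + |e| := by
      intro a b d e
      rw [show a + b + (d + e) - a = b + d + e by ring]
      exact (abs_add_le _ _).trans (add_le_add (abs_add_le _ _) le_rfl)
    refine (e4 _ _ _ _).trans ?_
    linarith
  set N : ℝ := ((Fintype.card ι : ℕ) : ℝ) with hN
  set C₀ := B * (3 * B + 4) with hC₀
  have hV : ∀ i, |∑ j, par i (par j fun y => χ (c • y) * h y) y *
      par j (fun y => χ (c • y) * h y) z - χ (c • y) * χ (c • z) *
      ∑ j, par i (par j h) y * par j h z| ≤ c * (N * C₀ * (jetSum h y * jetSum h z)) := by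
    intro i
    rw [Finset.mul_sum, ← Finset.sum_sub_distrib]
    refine (Finset.abs_sum_le_sum_abs _ _).trans ?_
    refine (Finset.sum_le_card_nsmul _ _ (c * (C₀ * (jetSum h y * jetSum h z)))
      fun j _ => ?_).trans ?_
    · exact abs_sub_mul_le_of_bounds hc.le hc1 hB (hH i j y) (hG j z) (hχ1 _) (hχ1 _)
        (abs_par_par_le_jetSum h y i j) (abs_par_le_jetSum h z j)
    · rw [nsmul_eq_mul, Finset.card_univ]
      apply le_of_eq; ring
  have hs : (χ (c • y) * χ (c • z)) ^ 2 ≤ 1 := by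
    rw [sq_le_one_iff_abs_le_one, abs_mul]
    exact mul_le_one₀ (hχ1 _) (abs_nonneg _) (hχ1 _)
  calc hessGrad (fun y => χ (c • y) * h y) y z
      ≤ ∑ i, ((1 + c) * (∑ j, par i (par j h) y * par j h z) ^ 2 +
          2 * c * (N * C₀ * (jetSum h y * jetSum h z)) ^ 2) := by
        unfold hessGrad
        refine Finset.sum_le_sum fun i _ => (sq_le_of_abs_sub_le hc hc1 (hV i)).trans ?_
        refine add_le_add (mul_le_mul_of_nonneg_left ?_ (by positivity)) le_rfl
        rw [mul_pow]
        exact mul_le_of_le_one_left (sq_nonneg _) hs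
    _ = (1 + c) * hessGrad h y z + c * (N * (N * C₀) ^ 2) *
          (2 * (jetSum h y ^ 2 * jetSum h z ^ 2)) := by
        rw [Finset.sum_add_distrib, ← Finset.mul_sum, hessGrad, Finset.sum_const, nsmul_eq_mul,
          Finset.card_univ, ← hN]
        ring
    _ ≤ _ := by
        gcongr
        nlinarith [sq_nonneg (jetSum h y ^ 2 - jetSum h z ^ 2)]

/-- The Stein discrepancy bound for functions with derivatives in `L⁴`. -/
theorem stein_bound {h : (ι → ℝ) → ℝ} (hh : ContDiff ℝ 2 h) (m0 : MemLp h 4 (stdG ι))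
    (m1 : ∀ i, MemLp (par i h) 4 (stdG ι)) (m2 : ∀ i j, MemLp (par i (par j h)) 4 (stdG ι))
    {φ : ℝ → ℝ} (hφ : ContDiff ℝ 1 φ) (hφ1 : ∀ x, |deriv φ x| ≤ 1) {K : ℝ} (hK : 0 < K)
    (h1 : ∀ t, ∫⁻ p, ENNReal.ofReal (hessGrad h p.1 (mix t p)) ∂(stdG ι).prod (stdG ι) ≤
      ENNReal.ofReal (K ^ 2))
    (h2 : ∀ t, ∫⁻ p, ENNReal.ofReal (hessGrad h (mix t p) p.1) ∂(stdG ι).prod (stdG ι) ≤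
      ENNReal.ofReal (K ^ 2)) :
    |∫ y, φ (h y) * h y ∂stdG ι - (∫ y, φ (h y) ∂stdG ι) * ∫ y, h y ∂stdG ι -
      (∫ y, deriv φ (h y) ∂stdG ι) * (∫ y, h y ^ 2 ∂stdG ι - (∫ y, h y ∂stdG ι) ^ 2)| ≤
      3 / 2 * K := by
  obtain ⟨χ, hχ, hχs, hχ0, hχ1, B, hB, hB1, hB2⟩ := exists_cutoff ι
  set J : ℝ := ∫ y, jetSum h y ^ 4 ∂stdG ι with hJ
  set C : ℝ := Fintype.card ι * (Fintype.card ι * (B * (3 * B + 4))) ^ 2 with hC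
  have hC0 : 0 ≤ C := by positivity
  have hgc := fun j => (contDiff_par hh j).continuous
  have hHc := fun i j => continuous_par (contDiff_par hh j) i
  have hhc := hh.continuous
  have jc : Continuous (jetSum h) := by unfold jetSum; fun_prop
  have jm : MemLp (jetSum h) 4 (stdG ι) := by
    unfold jetSum
    refine (m0.abs.add (memLp_finsetSum _ fun j _ => (m1 j).abs)).add
      (memLp_finsetSum _ fun i _ => memLp_finsetSum _ fun j _ => (m2 i j).abs)
  have ji : Integrable (fun y => jetSum h y ^ 4) (stdG ι) := by
    have := jm.integrable_norm_pow (p := 4) (by norm_num)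
    refine this.congr (Eventually.of_forall fun y => ?_)
    simp only [Real.norm_of_nonneg (jetSum_nonneg h y)]
  have hJ0 : 0 ≤ J := integral_nonneg fun y => by positivity
  have ji1 : Integrable (fun p : (ι → ℝ) × (ι → ℝ) => jetSum h p.1 ^ 4)
      ((stdG ι).prod (stdG ι)) := ji.comp_fst _
  have ji2 : ∀ t, Integrable (fun p : (ι → ℝ) × (ι → ℝ) => jetSum h (mix t p) ^ 4)
      ((stdG ι).prod (stdG ι)) := by
    intro t
    have := ji
    rw [← map_mix_stdG t] at this
    exact this.comp_measurable (continuous_mix t).measurable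
  have je1 : ∫ p, jetSum h p.1 ^ 4 ∂(stdG ι).prod (stdG ι) = J :=
    integral_comp_fst_stdG fun y => jetSum h y ^ 4
  have je2 : ∀ t, ∫ p, jetSum h (mix t p) ^ 4 ∂(stdG ι).prod (stdG ι) = J := fun t =>
    integral_comp_mix_stdG t (g := fun y => jetSum h y ^ 4) (by fun_prop)
  have hg0 : ∀ (f : (ι → ℝ) → ℝ) y z, 0 ≤ hessGrad f y z := fun f y z => by
    unfold hessGrad; positivity
  have conv : ∀ {u v : (ι → ℝ) × (ι → ℝ) → (ι → ℝ)}, Continuous u → Continuous v →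
      ∫⁻ p, ENNReal.ofReal (hessGrad h (u p) (v p)) ∂(stdG ι).prod (stdG ι) ≤
        ENNReal.ofReal (K ^ 2) →
      Integrable (fun p => hessGrad h (u p) (v p)) ((stdG ι).prod (stdG ι)) ∧
      ∫ p, hessGrad h (u p) (v p) ∂(stdG ι).prod (stdG ι) ≤ K ^ 2 := by
    intro u v hu hv hle
    have hcont : Continuous fun p => hessGrad h (u p) (v p) := by unfold hessGrad; fun_prop
    have hi : Integrable (fun p => hessGrad h (u p) (v p)) ((stdG ι).prod (stdG ι)) :=
      ⟨hcont.aestronglyMeasurable, by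
        rw [hasFiniteIntegral_iff_ofReal (Eventually.of_forall fun p => hg0 _ _ _)]
        exact hle.trans_lt ENNReal.ofReal_lt_top⟩
    refine ⟨hi, ?_⟩
    rwa [← ofReal_integral_eq_lintegral_ofReal hi (Eventually.of_forall fun p => hg0 _ _ _),
      ENNReal.ofReal_le_ofReal_iff (by positivity)] at hle
  set c : ℕ → ℝ := fun k => 1 / ((k : ℝ) + 1) with hcdef
  have hc0 : ∀ k, 0 < c k := fun k => by simp only [hcdef]; positivity
  have hc1 : ∀ k, c k ≤ 1 := fun k => by
    simp only [hcdef]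
    rw [div_le_one (by positivity)]
    linarith [(Nat.cast_nonneg k : (0 : ℝ) ≤ k)]
  have hct : Tendsto c atTop (𝓝 0) := tendsto_one_div_add_atTop_nhds_zero_nat
  set g : ℕ → (ι → ℝ) → ℝ := fun k y => χ (c k • y) * h y with hgdef
  -- The squared bound for the cut-off function; it tends to `K²` because the jet integrals `J` are
  -- finite.
  set L : ℕ → ℝ := fun k => (1 + c k) * K ^ 2 + c k * C * (J + J) with hL
  have hL0 : ∀ k, 0 < L k := fun k => by
    have := hc0 k
    simp only [hL]; positivity
  have hgC : ∀ k, ContDiff ℝ 2 (g k) := fun k =>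
    (hχ.comp (by fun_prop : ContDiff ℝ 2 fun y : ι → ℝ => c k • y)).mul hh
  have hgS : ∀ k, HasCompactSupport (g k) := by
    intro k
    refine HasCompactSupport.mul_right ?_
    exact hχs.comp_smul (hc0 k).ne'
  have bound : ∀ k {u v : (ι → ℝ) × (ι → ℝ) → (ι → ℝ)}, Continuous u → Continuous v →
      ∫⁻ p, ENNReal.ofReal (hessGrad h (u p) (v p)) ∂(stdG ι).prod (stdG ι) ≤
        ENNReal.ofReal (K ^ 2) →
      Integrable (fun p => jetSum h (u p) ^ 4) ((stdG ι).prod (stdG ι)) →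
      Integrable (fun p => jetSum h (v p) ^ 4) ((stdG ι).prod (stdG ι)) →
      ∫ p, jetSum h (u p) ^ 4 ∂(stdG ι).prod (stdG ι) = J →
      ∫ p, jetSum h (v p) ^ 4 ∂(stdG ι).prod (stdG ι) = J →
      ∫ p, hessGrad (g k) (u p) (v p) ∂(stdG ι).prod (stdG ι) ≤ √(L k) ^ 2 := by
    intro k u v hu hv hle iu iv eu ev
    obtain ⟨i0, hK2⟩ := conv hu hv hle
    rw [Real.sq_sqrt (hL0 k).le]
    have hck := hc0 k
    have iuv : Integrable (fun p => jetSum h (u p) ^ 4 + jetSum h (v p) ^ 4)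
      ((stdG ι).prod (stdG ι)) := iu.add iv
    calc _ ≤ ∫ p, ((1 + c k) * hessGrad h (u p) (v p) + c k * C *
          (jetSum h (u p) ^ 4 + jetSum h (v p) ^ 4)) ∂(stdG ι).prod (stdG ι) := by
          refine integral_mono_of_nonneg (Eventually.of_forall fun p => hg0 _ _ _)
            ((i0.const_mul _).add (iuv.const_mul _)) (Eventually.of_forall fun p => ?_)
          exact hessGrad_cutoff_le hh hχ hχ1 hB hB1 hB2 hck (hc1 k) _ _
      _ = (1 + c k) * ∫ p, hessGrad h (u p) (v p) ∂(stdG ι).prod (stdG ι) +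
          c k * C * (J + J) := by
          rw [integral_add (i0.const_mul _) (iuv.const_mul _), integral_const_mul,
            integral_const_mul, integral_add iu iv, eu, ev]
      _ ≤ L k := by simp only [hL]; gcongr
  have main : ∀ k, |∫ y, φ (g k y) * g k y ∂stdG ι - (∫ y, φ (g k y) ∂stdG ι) *
      ∫ y, g k y ∂stdG ι - (∫ y, deriv φ (g k y) ∂stdG ι) *
      (∫ y, g k y ^ 2 ∂stdG ι - (∫ y, g k y ∂stdG ι) ^ 2)| ≤ 3 / 2 * √(L k) := fun k =>
    stein_bound_of_hasCompactSupport (hgC k) (hgS k) hφ hφ1 (Real.sqrt_pos.2 (hL0 k))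
      (fun t => bound k continuous_fst (continuous_mix t) (h1 t) ji1 (ji2 t) je1 (je2 t))
      (fun t => bound k (continuous_mix t) continuous_fst (h2 t) (ji2 t) ji1 (je2 t) je1)
  have hLt : Tendsto (fun k => 3 / 2 * √(L k)) atTop (𝓝 (3 / 2 * K)) := by
    have : Tendsto L atTop (𝓝 ((1 + 0) * K ^ 2 + 0 * C * (J + J))) :=
      ((tendsto_const_nhds.add hct).mul_const _).add ((hct.mul_const _).mul_const _)
    have h3 := (this.sqrt).const_mul (3 / 2)
    rwa [add_zero, one_mul, zero_mul, zero_mul, add_zero, Real.sqrt_sq hK.le] at h3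
  have gpt : ∀ y, Tendsto (fun k => g k y) atTop (𝓝 (h y)) := by
    intro y
    have e1 : Tendsto (fun k => c k • y) atTop (𝓝 0) := by
      simpa using hct.smul_const y
    have e2 := (hχ.continuous.tendsto 0).comp e1
    rw [hχ0] at e2
    simpa using e2.mul_const (h y)
  have gle : ∀ k y, |g k y| ≤ |h y| := fun k y => by
    simp only [hgdef, abs_mul]
    exact mul_le_of_le_one_left (abs_nonneg _) (hχ1 _)
  have hi1 : Integrable h (stdG ι) := m0.integrable (by norm_num)
  have hi2 : Integrable (fun y => h y ^ 2) (stdG ι) :=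
    (m0.mono_exponent (p := 2) (by norm_num)).integrable_sq
  have hφc := hφ.continuous
  have hdc : Continuous (deriv φ) := hφ.continuous_deriv le_rfl
  have gcont := fun k => (hgC k).continuous
  have t1 : Tendsto (fun k => ∫ y, φ (g k y) * g k y ∂stdG ι) atTop
      (𝓝 (∫ y, φ (h y) * h y ∂stdG ι)) := by
    refine tendsto_integral_of_dominated_convergence (fun y => |φ 0| * |h y| + h y ^ 2)
      (fun k => ((hφc.comp (gcont k)).mul (gcont k)).aestronglyMeasurable)
      ((hi1.abs.const_mul _).add hi2) (fun k => Eventually.of_forall fun y => ?_)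
      (Eventually.of_forall fun y => ((hφc.tendsto _).comp (gpt y)).mul (gpt y))
    rw [norm_mul]
    have e1 := abs_le_of_abs_deriv_le_one hφ hφ1 (g k y)
    have e2 := gle k y
    calc ‖φ (g k y)‖ * ‖g k y‖ ≤ (|φ 0| + |h y|) * |h y| := by
          refine mul_le_mul (e1.trans (by linarith)) e2 (abs_nonneg _) (by positivity)
      _ = _ := by rw [add_mul, ← sq, sq_abs]
  have t2 : Tendsto (fun k => ∫ y, φ (g k y) ∂stdG ι) atTop (𝓝 (∫ y, φ (h y) ∂stdG ι)) := by
    refine tendsto_integral_of_dominated_convergence (fun y => |φ 0| + |h y|)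
      (fun k => (hφc.comp (gcont k)).aestronglyMeasurable)
      ((integrable_const _).add hi1.abs) (fun k => Eventually.of_forall fun y => ?_)
      (Eventually.of_forall fun y => (hφc.tendsto _).comp (gpt y))
    exact (abs_le_of_abs_deriv_le_one hφ hφ1 (g k y)).trans (by linarith [gle k y])
  have t3 : Tendsto (fun k => ∫ y, g k y ∂stdG ι) atTop (𝓝 (∫ y, h y ∂stdG ι)) :=
    tendsto_integral_of_dominated_convergence (fun y => |h y|)
      (fun k => (gcont k).aestronglyMeasurable) hi1.abs
      (fun k => Eventually.of_forall fun y => gle k y) (Eventually.of_forall gpt)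
  have t4 : Tendsto (fun k => ∫ y, deriv φ (g k y) ∂stdG ι) atTop
      (𝓝 (∫ y, deriv φ (h y) ∂stdG ι)) :=
    tendsto_integral_of_dominated_convergence (fun y => 1)
      (fun k => (hdc.comp (gcont k)).aestronglyMeasurable) (integrable_const _)
      (fun k => Eventually.of_forall fun y => hφ1 _)
      (Eventually.of_forall fun y => (hdc.tendsto _).comp (gpt y))
  have t5 : Tendsto (fun k => ∫ y, g k y ^ 2 ∂stdG ι) atTop (𝓝 (∫ y, h y ^ 2 ∂stdG ι)) := by
    refine tendsto_integral_of_dominated_convergence (fun y => h y ^ 2)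
      (fun k => ((gcont k).pow 2).aestronglyMeasurable) hi2
      (fun k => Eventually.of_forall fun y => ?_) (Eventually.of_forall fun y => (gpt y).pow 2)
    rw [Real.norm_of_nonneg (sq_nonneg _)]
    exact sq_le_sq.2 (gle k y)
  exact le_of_tendsto_of_tendsto' ((t1.sub (t2.mul t3)).sub (t4.mul (t5.sub (t3.pow 2)))).abs hLt
    main

end

/-! ### Stein's method for the total variation distance. -/

section

open Filter Topology

/-- Total variation is controlled by continuous test functions with values in `[0, 1]`. -/
theorem dTV_le_of_continuous {μ ν : Measure ℝ} [IsProbabilityMeasure μ] [IsProbabilityMeasure ν]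
    {D : ℝ} (h : ∀ g : ℝ → ℝ, Continuous g → (∀ x, 0 ≤ g x) → (∀ x, g x ≤ 1) →
      |∫ x, g x ∂μ - ∫ x, g x ∂ν| ≤ D) : dTV μ ν ≤ ENNReal.ofReal D := by
  refine iSup₂_le fun B hB => ENNReal.ofReal_le_ofReal ?_
  refine le_of_forall_pos_le_add fun ε hε => ?_
  have hi : Integrable (B.indicator fun _ => (1 : ℝ)) (μ + ν) :=
    (integrable_const 1).indicator hB
  -- Approximation in `L¹(μ + ν)` controls the errors under both measures at once.
  obtain ⟨g, hg, -⟩ := hi.exists_boundedContinuous_integral_sub_le hε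
  -- Clamping to `[0, 1]` is 1-Lipschitz and fixes the indicator, so it does not worsen the
  -- approximation.
  set k : ℝ → ℝ := fun x => max 0 (min 1 (g x)) with hk
  have kc : Continuous k := by fun_prop
  have k0 : ∀ x, 0 ≤ k x := fun x => le_max_left _ _
  have k1 : ∀ x, k x ≤ 1 := fun x => max_le zero_le_one (min_le_left _ _)
  have kd : ∀ x, |B.indicator (fun _ => (1 : ℝ)) x - k x| ≤
      ‖B.indicator (fun _ => (1 : ℝ)) x - g x‖ := by
    intro x
    have h01 : max 0 (min 1 (B.indicator (fun _ => (1 : ℝ)) x)) =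
        B.indicator (fun _ => (1 : ℝ)) x := by
      by_cases hx : x ∈ B <;> simp [hx]
    have h2 : ∀ a b : ℝ, |max 0 (min 1 a) - max 0 (min 1 b)| ≤ |a - b| := by
      intro a b
      rw [max_comm 0, max_comm 0]
      exact (abs_max_sub_max_le_abs _ _ _).trans ((abs_min_sub_min_le_max 1 a 1 b).trans (by simp))
    have h3 := h2 (B.indicator (fun _ => (1 : ℝ)) x) (g x)
    rwa [h01] at h3
  have ki : ∀ (ρ : Measure ℝ) [IsProbabilityMeasure ρ], Integrable k ρ := fun ρ _ =>
    Integrable.of_bound kc.aestronglyMeasurable 1 (Eventually.of_forall fun x => by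
      rw [Real.norm_of_nonneg (k0 x)]; exact k1 x)
  have gi : ∀ (ρ : Measure ℝ) [IsProbabilityMeasure ρ],
      Integrable (fun x => ‖B.indicator (fun _ => (1 : ℝ)) x - g x‖) ρ := fun ρ _ =>
    (((integrable_const 1).indicator hB).sub (g.integrable ρ)).norm
  have bd : ∀ (ρ : Measure ℝ) [IsProbabilityMeasure ρ], |ρ.real B - ∫ x, k x ∂ρ| ≤
      ∫ x, ‖B.indicator (fun _ => (1 : ℝ)) x - g x‖ ∂ρ := by
    intro ρ _
    rw [← integral_indicator_one hB]
    change |∫ x, B.indicator (fun _ => (1 : ℝ)) x ∂ρ - _| ≤ _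
    rw [← integral_sub ((integrable_const 1).indicator hB) (ki ρ)]
    exact abs_integral_le_integral_abs.trans (integral_mono_of_nonneg
      (Eventually.of_forall fun x => abs_nonneg _) (gi ρ) (Eventually.of_forall kd))
  rw [integral_add_measure (gi μ) (gi ν)] at hg
  have e1 := bd μ
  have e2 := bd ν
  have e3 := h k kc k0 k1
  rw [show μ.real B - ν.real B = (μ.real B - ∫ x, k x ∂μ) + (∫ x, k x ∂μ - ∫ x, k x ∂ν) -
    (ν.real B - ∫ x, k x ∂ν) by ring]
  refine (abs_sub _ _).trans ?_
  have := abs_add_le (μ.real B - ∫ x, k x ∂μ) (∫ x, k x ∂μ - ∫ x, k x ∂ν)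
  linarith

/-- The expression lies between `g - 1` and `g`. Indeed `x E c J ≤ c` gives the upper bound, and `I
≤ J` gives `x E (c J - I) ≥ -(1 - c) x E J ≥ -(1 - c)` for the lower one. This is the derivative
bound `1` for Stein's equation, with `E` the inverse weight and `I`, `J` tail integrals. -/
theorem abs_stein_le_one {x E I J g c : ℝ} (hE : 0 ≤ E) (hx : 0 ≤ x) (hI : 0 ≤ I) (hIJ : I ≤ J)
    (hJ : x * J * E ≤ 1) (hg : 0 ≤ g) (hg1 : g ≤ 1) (hc : 0 ≤ c) (hc1 : c ≤ 1) :
    |x * E * (c * J - I) + g - c| ≤ 1 := by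
  have hxE : 0 ≤ x * E := mul_nonneg hx hE
  have h1 : 0 ≤ x * E * I := mul_nonneg hxE hI
  have h2 : x * E * I ≤ x * E * J := mul_le_mul_of_nonneg_left hIJ hxE
  rw [abs_le]
  constructor <;> nlinarith

/-- The weight `exp (-y² / 2)`. -/
def gw (y : ℝ) : ℝ := Real.exp (-(y ^ 2) / 2)

theorem continuous_gw : Continuous gw := by unfold gw; fun_prop

theorem gw_pos (y : ℝ) : 0 < gw y := Real.exp_pos _

theorem gw_neg (y : ℝ) : gw (-y) = gw y := by simp [gw]

theorem hasDerivAt_gw (y : ℝ) : HasDerivAt gw (-(y * gw y)) y := by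
  have h1 : HasDerivAt (fun y : ℝ => -(y ^ 2) / 2) (-y) y := by
    refine (((hasDerivAt_id y).fun_pow 2).fun_neg.div_const 2).congr_deriv ?_
    simp; ring
  refine h1.exp.congr_deriv ?_
  rw [gw]; ring

theorem integrable_gw : Integrable gw := by
  refine (integrable_exp_neg_mul_sq (b := 1 / 2) (by norm_num)).congr
    (Eventually.of_forall fun y => ?_)
  simp only [gw]; congr 1; ring

theorem integrable_mul_gw : Integrable fun y => y * gw y := by
  refine (integrable_mul_exp_neg_mul_sq (b := 1 / 2) (by norm_num)).congr
    (Eventually.of_forall fun y => ?_)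
  simp only [gw]; congr 2; ring

/-- On the tail `x ≤ y`, and `y * gw y` integrates exactly to `gw x`. -/
theorem mul_integral_Ioi_gw_le {x : ℝ} : x * ∫ y in Set.Ioi x, gw y ≤ gw x := by
  have h1 : ∫ y in Set.Ioi x, y * gw y = gw x := by
    have hlim : Tendsto (fun y => -gw y) atTop (𝓝 (-0)) := by
      refine Tendsto.neg (Real.tendsto_exp_atBot.comp ?_)
      have : Tendsto (fun y : ℝ => y ^ 2 / 2) atTop atTop :=
        (tendsto_pow_atTop two_ne_zero).atTop_div_const two_pos
      refine (tendsto_neg_atTop_atBot.comp this).congr fun y => ?_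
      simp only [Function.comp_apply]; ring
    rw [integral_Ioi_of_hasDerivAt_of_tendsto (f := fun y => -gw y)
      continuous_gw.neg.continuousWithinAt (fun y _ => ?_) integrable_mul_gw.integrableOn hlim]
    · ring
    · exact ((hasDerivAt_gw y).fun_neg).congr_deriv (by ring)
  rw [← h1, ← integral_const_mul]
  refine setIntegral_mono_on (integrable_gw.const_mul x).integrableOn
    integrable_mul_gw.integrableOn measurableSet_Ioi fun y hy => ?_
  exact mul_le_mul_of_nonneg_right (Set.mem_Ioi.1 hy).le (gw_pos y).le

theorem neg_mul_integral_Iic_gw_le {x : ℝ} : -x * ∫ y in Set.Iic x, gw y ≤ gw x := by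
  have h := mul_integral_Ioi_gw_le (x := -x)
  have e := integral_comp_neg_Iic x gw
  simp only [gw_neg] at e h
  rwa [e]

/-- Solution of the Stein equation for a continuous test function with values in `[0, 1]`. -/
theorem exists_stein_solution {g : ℝ → ℝ} (hg : Continuous g) (hg0 : ∀ x, 0 ≤ g x)
    (hg1 : ∀ x, g x ≤ 1) : ∃ φ : ℝ → ℝ, ContDiff ℝ 1 φ ∧ (∀ x, |deriv φ x| ≤ 1) ∧
      ∀ x, deriv φ x - x * φ x = g x - ∫ y, g y ∂gaussianReal 0 1 := by
  set c := ∫ y, g y ∂gaussianReal 0 1 with hc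
  have gi : Integrable g (gaussianReal 0 1) :=
    Integrable.of_bound hg.aestronglyMeasurable 1 (Eventually.of_forall fun x => by
      rw [Real.norm_of_nonneg (hg0 x)]; exact hg1 x)
  have hc0 : 0 ≤ c := integral_nonneg hg0
  have hc1 : c ≤ 1 := by
    calc c ≤ ∫ y, (1 : ℝ) ∂gaussianReal 0 1 := integral_mono gi (integrable_const _) hg1
      _ = 1 := by simp
  have gwi : Integrable fun y => g y * gw y :=
    integrable_gw.bdd_mul hg.aestronglyMeasurable (Eventually.of_forall fun x => by
      rw [Real.norm_of_nonneg (hg0 x)]; exact hg1 x)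
  set q : ℝ → ℝ := fun y => (g y - c) * gw y with hq
  have qc : Continuous q := (hg.sub continuous_const).mul continuous_gw
  have qe : q = fun y => g y * gw y - c * gw y := by ext y; simp only [hq]; ring
  have qi : Integrable q := by rw [qe]; exact gwi.sub (integrable_gw.const_mul c)
  -- Centring at `c` makes the two tail integrals of `q` opposite to each other. The solution can
  -- then be estimated through the right tail for `x ≥ 0` and through the left tail for `x ≤ 0`.
  have q0 : ∫ y, q y = 0 := by
    have hpdf : ∀ y, gaussianPDFReal 0 1 y = (√(2 * Real.pi))⁻¹ * gw y := by
      intro y; simp [gaussianPDFReal, gw]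
    have h1 : c = (√(2 * Real.pi))⁻¹ * ∫ y, g y * gw y := by
      rw [hc, integral_gaussianReal_eq_integral_smul one_ne_zero, ← integral_const_mul]
      congr 1; ext y; rw [hpdf, smul_eq_mul]; ring
    have h2 : 1 = (√(2 * Real.pi))⁻¹ * ∫ y, gw y := by
      rw [← integral_gaussianPDFReal_eq_one 0 (one_ne_zero (α := ℝ≥0)), ← integral_const_mul]
      congr 1; ext y; rw [hpdf]
    rw [qe, integral_sub gwi (integrable_gw.const_mul c), integral_const_mul]
    have h3 : (√(2 * Real.pi))⁻¹ ≠ 0 := by positivity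
    apply mul_left_cancel₀ h3
    rw [mul_sub, ← h1, mul_zero, mul_left_comm, ← h2, mul_one, sub_self]
  -- A constant plus an interval integral, so that the fundamental theorem of calculus applies
  -- directly.
  set S : ℝ → ℝ := fun x => (∫ y in Set.Iic 0, q y) + ∫ y in (0 : ℝ)..x, q y with hS
  have S1 : ∀ x, S x = ∫ y in Set.Iic x, q y := by
    intro x
    simp only [hS]
    rw [← intervalIntegral.integral_Iic_sub_Iic qi.integrableOn qi.integrableOn]
    ring
  have S2 : ∀ x, S x = -∫ y in Set.Ioi x, q y := by
    intro x
    have := intervalIntegral.integral_Iic_add_Ioi (b := x) (f := q) qi.integrableOn qi.integrableOn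
    rw [q0] at this
    rw [S1]; linarith
  have Sd : ∀ x, HasDerivAt S (q x) x := by
    intro x
    refine HasDerivAt.const_add _ ?_
    exact qc.integral_hasStrictDerivAt 0 x |>.hasDerivAt
  set φ : ℝ → ℝ := fun x => (gw x)⁻¹ * S x with hφ
  have φd : ∀ x, HasDerivAt φ (x * φ x + (g x - c)) x := by
    intro x
    have hne := (gw_pos x).ne'
    refine (((hasDerivAt_gw x).fun_inv hne).fun_mul (Sd x)).congr_deriv ?_
    simp only [hφ, hq]
    field_simp
  have φc : Continuous φ := continuous_iff_continuousAt.2 fun x => (φd x).continuousAt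
  have φe : deriv φ = fun x => x * φ x + (g x - c) := funext fun x => (φd x).deriv
  have part : ∀ s : Set ℝ, MeasurableSet s → 0 ≤ ∫ y in s, g y * gw y ∧
      ∫ y in s, g y * gw y ≤ ∫ y in s, gw y ∧
      ∫ y in s, q y = (∫ y in s, g y * gw y) - c * ∫ y in s, gw y := by
    intro s hs
    refine ⟨integral_nonneg fun y => mul_nonneg (hg0 y) (gw_pos y).le,
      integral_mono gwi.integrableOn integrable_gw.integrableOn fun y =>
        mul_le_of_le_one_left (gw_pos y).le (hg1 y), ?_⟩
    rw [qe, integral_sub gwi.integrableOn (integrable_gw.const_mul c).integrableOn,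
      integral_const_mul]
  refine ⟨φ, contDiff_one_iff_deriv.2 ⟨fun x => (φd x).differentiableAt, ?_⟩, fun x => ?_,
    fun x => by rw [φe]; ring⟩
  · rw [φe]; fun_prop
  · rw [φe]
    have hE := inv_pos.2 (gw_pos x)
    simp only [hφ]
    rcases le_total 0 x with hx | hx
    · obtain ⟨p1, p2, p3⟩ := part (Set.Ioi x) measurableSet_Ioi
      rw [S2, p3]
      have := abs_stein_le_one (x := x) hE.le hx p1 p2 (by
        rw [← div_eq_mul_inv, div_le_one (gw_pos x)]; exact mul_integral_Ioi_gw_le)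
        (hg0 x) (hg1 x) hc0 hc1
      convert! this using 2
      ring
    · obtain ⟨p1, p2, p3⟩ := part (Set.Iic x) measurableSet_Iic
      rw [S1, p3]
      have := abs_stein_le_one (x := -x) hE.le (neg_nonneg.2 hx) p1 p2 (by
        rw [← div_eq_mul_inv, div_le_one (gw_pos x)]; exact neg_mul_integral_Iic_gw_le)
        (hg0 x) (hg1 x) hc0 hc1
      convert! this using 2
      ring

/-- Stein's method for the total variation distance to a normal law. -/
theorem dTV_gaussianReal_le {μ : Measure ℝ} [IsProbabilityMeasure μ] {m D : ℝ} {v : ℝ≥0}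
    (hv : v ≠ 0)
    (h : ∀ φ : ℝ → ℝ, ContDiff ℝ 1 φ → (∀ x, |deriv φ x| ≤ 1) →
      |∫ x, φ x * (x - m) ∂μ - v * ∫ x, deriv φ x ∂μ| ≤ D) :
    dTV μ (gaussianReal m v) ≤ ENNReal.ofReal (D / v) := by
  have hv0 : (0 : ℝ) < v := by positivity
  refine dTV_le_of_continuous fun f fc f0 f1 => ?_
  set s := √(v : ℝ) with hs
  have hs0 : 0 < s := Real.sqrt_pos.2 hv0
  have hss : s * s = v := Real.mul_self_sqrt hv0.le
  obtain ⟨φ, φC, φ1, φe⟩ := exists_stein_solution (g := fun z => f (s * z + m)) (by fun_prop)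
    (fun x => f0 _) (fun x => f1 _)
  have hc : ∫ z, f (s * z + m) ∂gaussianReal 0 1 = ∫ x, f x ∂gaussianReal m v := by
    have e : gaussianReal m v = (gaussianReal 0 1).map fun z => s * z + m := by
      have h1 := gaussianReal_map_const_mul (μ := 0) (v := 1) s
      have h2 := gaussianReal_map_add_const (μ := s * 0) (v := NNReal.mk (s ^ 2) (sq_nonneg _) * 1) m
      rw [← h1, Measure.map_map (by fun_prop) (by fun_prop)] at h2
      rw [show ((fun z => s * z + m) : ℝ → ℝ) = (fun x => x + m) ∘ fun x => s * x from rfl, h2]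
      congr 1
      · simp
      · ext; simp [sq, hss]
    rw [e, integral_map (by fun_prop) fc.aestronglyMeasurable]
  rw [hc] at φe
  -- The prefactor `s` compensates the inner derivative, so `|ψ'| ≤ 1` persists, and the rescaled
  -- function solves `v ψ' - (x - m) ψ = v (f - E f)`.
  set ψ : ℝ → ℝ := fun x => s * φ ((x - m) / s) with hψ
  have ψd : ∀ x, HasDerivAt ψ (deriv φ ((x - m) / s)) x := by
    intro x
    have h1 : HasDerivAt (fun x => (x - m) / s) (1 / s) x :=
      ((hasDerivAt_id x).sub_const m).div_const s
    have h2 := ((φC.differentiable one_ne_zero _).hasDerivAt.comp x h1).const_mul s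
    refine h2.congr_deriv ?_
    field_simp
  have ψe : deriv ψ = fun x => deriv φ ((x - m) / s) := funext fun x => (ψd x).deriv
  have ψC : ContDiff ℝ 1 ψ := contDiff_const.mul (φC.comp (by fun_prop))
  have key := h ψ ψC fun x => by rw [ψe]; exact φ1 _
  have e1 : ∀ x, ψ x * (x - m) = v * (deriv ψ x - (f x - ∫ x, f x ∂gaussianReal m v)) := by
    intro x
    have := φe ((x - m) / s)
    rw [mul_div_cancel₀ _ hs0.ne', sub_add_cancel] at this
    rw [ψe, ← this, ← hss]
    simp only [hψ]
    field_simp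
    ring
  have ψi : Integrable (deriv ψ) μ :=
    Integrable.of_bound (ψC.continuous_deriv le_rfl).aestronglyMeasurable 1
      (Eventually.of_forall fun x => by rw [ψe]; exact φ1 _)
  have fi : Integrable f μ := Integrable.of_bound fc.aestronglyMeasurable 1
    (Eventually.of_forall fun x => by rw [Real.norm_of_nonneg (f0 x)]; exact f1 x)
  have fi2 : Integrable (fun x => f x - ∫ x, f x ∂gaussianReal m v) μ :=
    fi.sub (integrable_const _)
  simp_rw [e1] at key
  rw [integral_const_mul, integral_sub ψi fi2,
    integral_sub fi (integrable_const _), integral_const, probReal_univ, one_smul,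
    ← mul_sub, sub_sub_cancel_left, abs_mul, abs_neg, abs_of_pos hv0] at key
  rwa [le_div_iff₀ hv0, mul_comm]

end

/-! ### Second order Poincaré inequality in total variation. -/

section

/-- A variable of zero variance is almost surely constant, and the normal law of variance zero is
the same Dirac mass. This covers the convention `0 / 0 = 0`. -/
theorem dTV_eq_zero_of_variance_eq_zero {Ω : Type*} [MeasurableSpace Ω] {P : Measure Ω}
    [IsProbabilityMeasure P] {W : Ω → ℝ} (hW : MemLp W 2 P) (hv : variance W P = 0) :
    dTV (P.map W) (gaussianReal (∫ ω, W ω ∂P) (variance W P).toNNReal) = 0 := by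
  have h1 : W =ᵐ[P] fun _ => ∫ ω, W ω ∂P := by
    have h2 : evariance W P = 0 := by
      rw [← hW.ofReal_variance_eq, hv, ENNReal.ofReal_zero]
    exact (evariance_eq_zero_iff hW.aestronglyMeasurable.aemeasurable).1 h2
  rw [Measure.map_congr h1, Measure.map_const, measure_univ, one_smul, hv, Real.toNNReal_zero,
    gaussianReal_zero_var]
  simp [dTV]

variable {ι : Type*} [Fintype ι] [DecidableEq ι]

/-- The second order Poincaré inequality in total variation, for `C²` functions of a standard
gaussian vector. -/
theorem dTV_map_stdG_le {h : (ι → ℝ) → ℝ} (hh : ContDiff ℝ 2 h) (m0 : MemLp h 4 (stdG ι))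
    (m1 : ∀ i, MemLp (par i h) 4 (stdG ι)) (m2 : ∀ i j, MemLp (par i (par j h)) 4 (stdG ι))
    {K : ℝ≥0}
    (h1 : ∀ t, ∫⁻ p, ENNReal.ofReal (hessGrad h p.1 (mix t p)) ∂(stdG ι).prod (stdG ι) ≤ K ^ 2)
    (h2 : ∀ t, ∫⁻ p, ENNReal.ofReal (hessGrad h (mix t p) p.1) ∂(stdG ι).prod (stdG ι) ≤ K ^ 2) :
    dTV ((stdG ι).map h) (gaussianReal (∫ y, h y ∂stdG ι) (variance h (stdG ι)).toNNReal) ≤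
      ENNReal.ofReal (3 / 2) * K / ENNReal.ofReal (variance h (stdG ι)) := by
  have m02 : MemLp h 2 (stdG ι) := m0.mono_exponent (by norm_num)
  rcases (variance_nonneg h (stdG ι)).eq_or_lt with hv | hv
  · rw [dTV_eq_zero_of_variance_eq_zero m02 hv.symm]; exact zero_le
  set v := variance h (stdG ι) with hvdef
  have hve : v = ∫ y, h y ^ 2 ∂stdG ι - (∫ y, h y ∂stdG ι) ^ 2 := by
    rw [hvdef, variance_eq_sub m02]; rfl
  have hhm : Measurable h := hh.continuous.measurable
  have hi : Integrable h (stdG ι) := m0.integrable (by norm_num)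
  have hi2 : Integrable (fun y => h y ^ 2) (stdG ι) := m02.integrable_sq
  have : IsProbabilityMeasure ((stdG ι).map h) := Measure.isProbabilityMeasure_map hhm.aemeasurable
  have hvn : v.toNNReal ≠ 0 := (Real.toNNReal_pos.2 hv).ne'
  rw [show ENNReal.ofReal (3 / 2) * K / ENNReal.ofReal v = ENNReal.ofReal (3 / 2 * K / v) by
    rw [ENNReal.ofReal_div_of_pos hv, ENNReal.ofReal_mul (by norm_num), ENNReal.ofReal_coe_nnreal]]
  have hcv : (v.toNNReal : ℝ) = v := Real.coe_toNNReal _ hv.le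
  conv_rhs => rw [← hcv]
  refine dTV_gaussianReal_le hvn fun φ φC φ1 => ?_
  have φc := φC.continuous
  have φdc : Continuous (deriv φ) := φC.continuous_deriv le_rfl
  rw [integral_map hhm.aemeasurable (by fun_prop : Continuous fun x =>
    φ x * (x - ∫ y, h y ∂stdG ι)).aestronglyMeasurable,
    integral_map hhm.aemeasurable φdc.aestronglyMeasurable, hcv]
  have hφ1 : Integrable (fun y => φ (h y) * h y) (stdG ι) := by
    refine ((hi.abs.const_mul |φ 0|).add hi2).mono'
      ((φc.measurable.comp hhm).mul hhm).aestronglyMeasurable (Eventually.of_forall fun y => ?_)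
    rw [norm_mul]
    calc ‖φ (h y)‖ * ‖h y‖ ≤ (|φ 0| + |h y|) * |h y| :=
          mul_le_mul_of_nonneg_right (abs_le_of_abs_deriv_le_one φC φ1 _) (abs_nonneg _)
      _ = _ := by simp only [Pi.add_apply]; rw [add_mul, ← sq, sq_abs]
  have hφ2 : Integrable (fun y => φ (h y)) (stdG ι) :=
    ((integrable_const |φ 0|).add hi.abs).mono' (φc.measurable.comp hhm).aestronglyMeasurable
      (Eventually.of_forall fun y => abs_le_of_abs_deriv_le_one φC φ1 _)
  have e : ∫ y, φ (h y) * (h y - ∫ y, h y ∂stdG ι) ∂stdG ι =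
      ∫ y, φ (h y) * h y ∂stdG ι - (∫ y, φ (h y) ∂stdG ι) * ∫ y, h y ∂stdG ι := by
    simp_rw [mul_sub]
    rw [integral_sub hφ1 (hφ2.mul_const _), integral_mul_const]
  rw [e, hve, mul_comm (_ - _)]
  -- `K` may vanish while `stein_bound` needs a positive constant; enlarging it by `2/3 ε` costs
  -- exactly `ε`.
  refine le_of_forall_pos_le_add fun ε hε => ?_
  have hK : (0 : ℝ) < K + 2 / 3 * ε := by positivity
  have hKle : (K : ℝ≥0∞) ^ 2 ≤ ENNReal.ofReal ((K + 2 / 3 * ε) ^ 2) := by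
    rw [ENNReal.ofReal_pow hK.le]
    gcongr
    rw [← ENNReal.ofReal_coe_nnreal]
    exact ENNReal.ofReal_le_ofReal (by linarith)
  have := stein_bound hh m0 m1 m2 φC φ1 hK (fun t => (h1 t).trans hKle)
    fun t => (h2 t).trans hKle
  linarith

end

/-! ### Matrices of bounded rank: tangency and compression. -/

section

section Rank
variable {n : ℕ}

/-- `C` is a projection onto the range of `B` followed by a linear section of `B`. Then `1 - B C`
kills the range of `B`, and `1 - C B` takes its values in the kernel of `B`; these are the
compressions used below. -/
theorem exists_generalized_inverse (B : Matrix (Fin n) (Fin n) ℂ) :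
    ∃ C : Matrix (Fin n) (Fin n) ℂ, B * C * B = B := by
  obtain ⟨s, hs⟩ := B.mulVecLin.rangeRestrict.exists_rightInverse_of_surjective
    B.mulVecLin.range_rangeRestrict
  obtain ⟨p, hp⟩ := (LinearMap.range B.mulVecLin).subtype.exists_leftInverse_of_injective
    (Submodule.ker_subtype _)
  refine ⟨LinearMap.toMatrix' (s ∘ₗ p), ?_⟩
  apply Matrix.toLin'.injective
  rw [Matrix.toLin'_mul, Matrix.toLin'_mul, Matrix.toLin'_toMatrix']
  refine LinearMap.ext fun w => ?_
  simp only [LinearMap.comp_apply]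
  have h1 : p (Matrix.toLin' B w) = B.mulVecLin.rangeRestrict w := by
    have := LinearMap.congr_fun hp (B.mulVecLin.rangeRestrict w)
    simpa using! this
  have h2 := congrArg Subtype.val (LinearMap.congr_fun hs (B.mulVecLin.rangeRestrict w))
  rw [h1]
  simpa using! h2

theorem cast_matrix_rank (M : Matrix (Fin n) (Fin n) ℂ) :
    ((M.rank : ℕ) : Cardinal) = LinearMap.rank M.mulVecLin := by
  rw [Matrix.rank, Module.finrank_eq_rank, LinearMap.rank]

theorem matrix_rank_add_le (M N : Matrix (Fin n) (Fin n) ℂ) : (M + N).rank ≤ M.rank + N.rank := by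
  have h := LinearMap.rank_add_le M.mulVecLin N.mulVecLin
  rw [← Matrix.mulVecLin_add, ← cast_matrix_rank, ← cast_matrix_rank, ← cast_matrix_rank] at h
  exact_mod_cast h

/-- Lower semicontinuity of the rank; it passes rank bounds to limits and makes the rank measurable.
-/
theorem isClosed_rank_le (k : ℕ) : IsClosed {M : Matrix (Fin n) (Fin n) ℂ | M.rank ≤ k} := by
  let T : Matrix (Fin n) (Fin n) ℂ →ₗ[ℂ] ((Fin n → ℂ) →L[ℂ] (Fin n → ℂ)) :=
    LinearMap.toContinuousLinearMap.toLinearMap ∘ₗ Matrix.toLin'.toLinearMap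
  have hT : Continuous T := T.continuous_of_finiteDimensional
  have ho := (isOpen_setOfPred_nat_le_rank (𝕜 := ℂ) (E := Fin n → ℂ) (F := Fin n → ℂ)
    (k + 1)).preimage hT
  rw [← isOpen_compl_iff]
  convert! ho using 1
  ext M
  simp only [Set.mem_compl_iff, Set.mem_ofPred_eq, not_le, Set.mem_preimage]
  have : ((T M : (Fin n → ℂ) →L[ℂ] (Fin n → ℂ)) : (Fin n → ℂ) →ₗ[ℂ] (Fin n → ℂ)) =
    M.mulVecLin := rfl
  rw [this, ← cast_matrix_rank, Nat.cast_le, Nat.lt_iff_add_one_le]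

theorem rank_le_of_tendsto {α : Type*} {l : Filter α} {M : α → Matrix (Fin n) (Fin n) ℂ}
    {M₀ : Matrix (Fin n) (Fin n) ℂ} {k : ℕ}
    (h : Tendsto M l (𝓝 M₀)) (hk : ∃ᶠ t in l, (M t).rank ≤ k) : M₀.rank ≤ k :=
  (isClosed_rank_le k).mem_of_frequently_of_tendsto hk h

theorem matrix_rank_smul_le (c : ℂ) (M : Matrix (Fin n) (Fin n) ℂ) : (c • M).rank ≤ M.rank := by
  have : c • M = (c • (1 : Matrix (Fin n) (Fin n) ℂ)) * M := by simp
  rw [this]; exact Matrix.rank_mul_le_right _ _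

/-- A matrix is determined up to rank `2 rank B` by its compression to a complement of the range
and to the kernel of `B`. -/
theorem rank_le_of_compression {B C M : Matrix (Fin n) (Fin n) ℂ} :
    M.rank ≤ 2 * B.rank + ((1 - B * C) * M * (1 - C * B)).rank := by
  -- The first two terms contain `B` as a left or as a right factor, so each has rank at most
  -- `B.rank`.
  have e : M = B * (C * M) + (1 - B * C) * M * C * B + (1 - B * C) * M * (1 - C * B) := by
    noncomm_ring
  conv_lhs => rw [e]
  refine (matrix_rank_add_le _ _).trans (add_le_add ((matrix_rank_add_le _ _).trans ?_) le_rfl)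
  rw [two_mul]
  exact add_le_add (Matrix.rank_mul_le_left _ _) (Matrix.rank_mul_le_right _ _)

/-- First order tangency to the matrices of rank at most `rank (b 0)`. -/
theorem compression_deriv_eq_zero {b : ℝ → Matrix (Fin n) (Fin n) ℂ}
    {b' C : Matrix (Fin n) (Fin n) ℂ} (hC : b 0 * C * b 0 = b 0)
    (hb0 : Tendsto b (𝓝[≠] 0) (𝓝 (b 0)))
    (hb : Tendsto (fun t : ℝ => (t : ℂ)⁻¹ • (b t - b 0)) (𝓝[≠] 0) (𝓝 b'))
    (hr : ∃ᶠ t in 𝓝[≠] (0 : ℝ), (b t).rank ≤ (b 0).rank) :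
    (1 - b 0 * C) * b' * (1 - C * b 0) = 0 := by
  set B := b 0 with hB
  set F := 1 - C * B with hF
  have hBF : B * F = 0 := by rw [hF, mul_sub, mul_one, ← mul_assoc, hC, sub_self]
  -- Because `B F = 0`, the factor `t⁻¹` only meets `b t - B`, and the product converges although it
  -- blows up on `F` alone. Its rank is bounded by that of `b t`, so `B + b' F` has rank at most
  -- `rank B`.
  have hlim : Tendsto (fun t : ℝ => b t * (C * B + (t : ℂ)⁻¹ • F)) (𝓝[≠] 0)
      (𝓝 (B + b' * F)) := by
    have h1 : Tendsto (fun t : ℝ => b t * (C * B) + ((t : ℂ)⁻¹ • (b t - B)) * F) (𝓝[≠] 0)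
        (𝓝 (B * (C * B) + b' * F)) := (hb0.mul_const _).add (hb.mul_const _)
    rw [← mul_assoc, hC] at h1
    refine h1.congr fun t => ?_
    rw [mul_add, Matrix.mul_smul, Matrix.smul_mul, sub_mul, hBF, sub_zero]
  have hrank : (B + b' * F).rank ≤ B.rank :=
    rank_le_of_tendsto hlim (hr.mono fun t ht => (Matrix.rank_mul_le_left _ _).trans ht)
  have hFCB : F * (C * B) = 0 := by
    rw [hF, sub_mul, one_mul, mul_assoc C B, ← mul_assoc B C B, hC, sub_self]
  have hLB : (B + b' * F) * (C * B) = B := by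
    rw [add_mul, mul_assoc b', hFCB, mul_zero, add_zero, ← mul_assoc, hC]
  -- the range of the limit equals that of `B`
  have hle : LinearMap.range B.mulVecLin ≤ LinearMap.range (B + b' * F).mulVecLin := by
    rintro _ ⟨v, rfl⟩
    refine ⟨(C * B).mulVec v, ?_⟩
    simp only [Matrix.mulVecLin_apply]
    rw [Matrix.mulVec_mulVec, hLB]
  have heq := Submodule.eq_of_le_of_finrank_le hle hrank
  have hEL : (1 - B * C) * (B + b' * F) = 0 := by
    apply Matrix.toLin'.injective
    refine LinearMap.ext fun v => ?_
    have : (B + b' * F).mulVecLin v ∈ LinearMap.range B.mulVecLin := heq ▸ ⟨v, rfl⟩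
    obtain ⟨w, hw⟩ := this
    simp only [Matrix.mulVecLin_apply] at hw
    rw [Matrix.toLin'_apply, ← Matrix.mulVec_mulVec, ← hw, Matrix.mulVec_mulVec, sub_mul, one_mul,
      hC, sub_self]
    simp
  rw [mul_add, sub_mul, one_mul, hC, sub_self, zero_add, ← mul_assoc] at hEL
  exact hEL

/-- Second order tangency to the matrices of rank at most `rank (b 0)`. -/
theorem rank_compression_deriv_two_le {b : ℝ → Matrix (Fin n) (Fin n) ℂ}
    {b' b'' C : Matrix (Fin n) (Fin n) ℂ} (hC : b 0 * C * b 0 = b 0)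
    (hb' : (1 - b 0 * C) * b' * (1 - C * b 0) = 0)
    (hb : Tendsto (fun t : ℝ => ((t : ℂ) ^ 2)⁻¹ • (b t - b 0 - (t : ℂ) • b')) (𝓝[≠] 0)
      (𝓝 ((1 / 2 : ℂ) • b'')))
    (hr : ∃ᶠ t in 𝓝[≠] (0 : ℝ), (b t).rank ≤ (b 0).rank) :
    ((1 - b 0 * C) * b'' * (1 - C * b 0)).rank ≤ (b 0).rank := by
  set B := b 0 with hB
  have hEB : (1 - B * C) * B = 0 := by rw [sub_mul, one_mul, hC, sub_self]
  -- Compression removes both lower Taylor terms: `(1 - B C) B = 0`, and the first order term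
  -- vanishes by `hb'`. What converges to half the compressed second derivative is a multiple of the
  -- compressed `b t`, of rank at most `rank B`.
  have hlim : Tendsto (fun t : ℝ => ((t : ℂ) ^ 2)⁻¹ • ((1 - B * C) * b t * (1 - C * B)))
      (𝓝[≠] 0) (𝓝 ((1 - B * C) * ((1 / 2 : ℂ) • b'') * (1 - C * B))) := by
    refine ((hb.const_mul (1 - B * C)).mul_const (1 - C * B)).congr fun t => ?_
    rw [Matrix.mul_smul, Matrix.smul_mul, mul_sub (1 - B * C) (b t - B),
      mul_sub (1 - B * C) (b t), hEB, sub_zero, sub_mul _ _ (1 - C * B),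
      Matrix.mul_smul, Matrix.smul_mul, hb', smul_zero, sub_zero]
  have h1 := rank_le_of_tendsto hlim (hr.mono fun t ht => (matrix_rank_smul_le _ _).trans
    ((Matrix.rank_mul_le_left _ _).trans ((Matrix.rank_mul_le_right _ _).trans ht)))
  have e : (1 - B * C) * b'' * (1 - C * B) =
      (2 : ℂ) • ((1 - B * C) * ((1 / 2 : ℂ) • b'') * (1 - C * B)) := by
    rw [Matrix.mul_smul, Matrix.smul_mul, smul_smul]; norm_num
  rw [e]
  exact (matrix_rank_smul_le _ _).trans h1

/-! ### Hilbert-Schmidt norm and trace bounds. -/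

/-- The Hilbert-Schmidt norm. -/
def hsNorm (M : Matrix (Fin n) (Fin n) ℂ) : ℝ := √(∑ i, ∑ j, ‖M i j‖ ^ 2)

theorem hsNorm_nonneg (M : Matrix (Fin n) (Fin n) ℂ) : 0 ≤ hsNorm M := Real.sqrt_nonneg _

theorem hsNorm_sq (M : Matrix (Fin n) (Fin n) ℂ) : hsNorm M ^ 2 = ∑ i, ∑ j, ‖M i j‖ ^ 2 :=
  Real.sq_sqrt (by positivity)

theorem norm_sum_mul_le {κ : Type*} (s : Finset κ) (x y : κ → ℂ) :
    ‖∑ k ∈ s, x k * y k‖ ≤ √(∑ k ∈ s, ‖x k‖ ^ 2) * √(∑ k ∈ s, ‖y k‖ ^ 2) := by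
  refine (norm_sum_le _ _).trans ?_
  simp_rw [norm_mul]
  exact Real.sum_mul_le_sqrt_mul_sqrt s _ _

theorem norm_trace_mul_le_hsNorm (M N : Matrix (Fin n) (Fin n) ℂ) :
    ‖(M * N).trace‖ ≤ hsNorm M * hsNorm N := by
  have h := norm_sum_mul_le (Finset.univ ×ˢ Finset.univ) (fun p : Fin n × Fin n => M p.1 p.2)
    (fun p => N p.2 p.1)
  simp only [Finset.sum_product] at h
  rw [hsNorm, hsNorm, Finset.sum_comm (f := fun i j => ‖N i j‖ ^ 2)]
  exact h

theorem norm_toLp_sq (v : Fin n → ℂ) : ‖WithLp.toLp 2 v‖ ^ 2 = ∑ i, ‖v i‖ ^ 2 := by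
  rw [EuclideanSpace.norm_sq_eq]

theorem norm_mulVec_le (C : Matrix (Fin n) (Fin n) ℂ) (v : Fin n → ℂ) :
    ‖WithLp.toLp 2 (C.mulVec v)‖ ≤ opNorm C * ‖WithLp.toLp 2 v‖ := by
  have := (Matrix.toEuclideanCLM (n := Fin n) (𝕜 := ℂ) C).le_opNorm (WithLp.toLp 2 v)
  rwa [Matrix.toEuclideanCLM_toLp] at this

theorem opNorm_nonneg (C : Matrix (Fin n) (Fin n) ℂ) : 0 ≤ opNorm C := norm_nonneg _

theorem hsNorm_mul_le (C M : Matrix (Fin n) (Fin n) ℂ) :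
    hsNorm (C * M) ≤ opNorm C * hsNorm M := by
  rw [← pow_le_pow_iff_left₀ (hsNorm_nonneg _)
    (mul_nonneg (opNorm_nonneg C) (hsNorm_nonneg M)) two_ne_zero]
  rw [mul_pow, hsNorm_sq, hsNorm_sq, Finset.sum_comm, Finset.sum_comm (f := fun i j => ‖M i j‖ ^ 2),
    Finset.mul_sum]
  refine Finset.sum_le_sum fun j _ => ?_
  have := norm_mulVec_le C (fun i => M i j)
  have h2 := pow_le_pow_left₀ (norm_nonneg _) this 2
  rw [mul_pow, norm_toLp_sq, norm_toLp_sq] at h2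
  exact h2

/-- Expand the columns of `M` in the basis `b` and apply Cauchy-Schwarz: the squared coefficients
sum to `hsNorm M ^ 2`, and each of the vectors `C b_k` has norm at most `opNorm C`. Taking `U` to be
the range of `M` brings in the rank. -/
theorem norm_trace_mul_le_of_orthonormalBasis {κ : Type*} [Fintype κ]
    {U : Submodule ℂ (EuclideanSpace ℂ (Fin n))} (b : OrthonormalBasis κ ℂ U)
    (C M : Matrix (Fin n) (Fin n) ℂ) (hcol : ∀ j, WithLp.toLp 2 (fun i => M i j) ∈ U) :
    ‖(C * M).trace‖ ≤ √(Fintype.card κ : ℝ) * opNorm C * hsNorm M := by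
  obtain ⟨m, hm⟩ : ∃ m : Fin n → U, ∀ j, (m j : EuclideanSpace ℂ (Fin n)) =
    WithLp.toLp 2 fun i => M i j := ⟨fun j => ⟨_, hcol j⟩, fun j => rfl⟩
  obtain ⟨x, hx⟩ : ∃ x : Fin n × κ → ℂ, ∀ p, x p = inner ℂ (b p.2) (m p.1) := ⟨_, fun _ => rfl⟩
  obtain ⟨y, hy⟩ : ∃ y : Fin n × κ → ℂ, ∀ p, y p =
    C.mulVec (WithLp.ofLp (b p.2 : EuclideanSpace ℂ (Fin n))) p.1 := ⟨_, fun _ => rfl⟩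
  have e1 : (C * M).trace = ∑ p ∈ Finset.univ ×ˢ Finset.univ, x p * y p := by
    rw [Finset.sum_product, Matrix.trace]
    refine Finset.sum_congr rfl fun j _ => ?_
    have h1 : (fun i => M i j) = ∑ k, x (j, k) • WithLp.ofLp (b k : EuclideanSpace ℂ (Fin n)) := by
      have h2 := congrArg (fun u : U => WithLp.ofLp (u : EuclideanSpace ℂ (Fin n)))
        (b.sum_repr' (m j))
      simp only [Submodule.coe_sum, Submodule.coe_smul, WithLp.ofLp_sum, WithLp.ofLp_smul,
        hm] at h2
      simp only [hx]
      exact h2.symm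
    change C.mulVec (fun i => M i j) j = _
    rw [h1, Matrix.mulVec_sum]
    simp only [Matrix.mulVec_smul, Finset.sum_apply, Pi.smul_apply, smul_eq_mul, hy]
  have e2 : ∑ p ∈ Finset.univ ×ˢ Finset.univ, ‖x p‖ ^ 2 = hsNorm M ^ 2 := by
    rw [Finset.sum_product, hsNorm_sq, Finset.sum_comm (f := fun i j => ‖M i j‖ ^ 2)]
    refine Finset.sum_congr rfl fun j _ => ?_
    simp only [hx]
    rw [b.sum_sq_norm_inner_right (m j), ← Submodule.norm_coe, hm, norm_toLp_sq]
  have e3 : ∑ p ∈ Finset.univ ×ˢ Finset.univ, ‖y p‖ ^ 2 ≤ Fintype.card κ * opNorm C ^ 2 := by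
    rw [Finset.sum_product_right]
    refine (Finset.sum_le_card_nsmul _ _ (opNorm C ^ 2) fun k _ => ?_).trans ?_
    · simp only [hy]
      rw [← norm_toLp_sq]
      refine pow_le_pow_left₀ (norm_nonneg _) ?_ 2
      refine (norm_mulVec_le C _).trans ?_
      have : ‖(b k : EuclideanSpace ℂ (Fin n))‖ = 1 := b.norm_eq_one k
      rw [WithLp.toLp_ofLp, this, mul_one]
    · rw [Finset.card_univ, nsmul_eq_mul]
  rw [e1]
  refine (norm_sum_mul_le _ _ _).trans ?_
  rw [e2, Real.sqrt_sq (hsNorm_nonneg M), mul_comm]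
  refine mul_le_mul_of_nonneg_right ((Real.sqrt_le_sqrt e3).trans (le_of_eq ?_)) (hsNorm_nonneg M)
  rw [Real.sqrt_mul (Nat.cast_nonneg _), Real.sqrt_sq (opNorm_nonneg C)]

/-- A trace bound in terms of the rank. -/
theorem norm_trace_mul_le_rank (C M : Matrix (Fin n) (Fin n) ℂ) :
    ‖(C * M).trace‖ ≤ √(M.rank : ℝ) * opNorm C * hsNorm M := by
  have hU : Module.finrank ℂ (LinearMap.range (Matrix.toEuclideanLin M)) = M.rank := by
    rw [Matrix.rank_eq_finrank_range_toLin M (EuclideanSpace.basisFun (Fin n) ℂ).toBasis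
      (EuclideanSpace.basisFun (Fin n) ℂ).toBasis, Matrix.toEuclideanLin_eq_toLin_orthonormal]
  have h := norm_trace_mul_le_of_orthonormalBasis
    (stdOrthonormalBasis ℂ (LinearMap.range (Matrix.toEuclideanLin M))) C M fun j =>
      ⟨WithLp.toLp 2 (Pi.single j 1), by
        rw [Matrix.toLpLin_toLp, Matrix.toLin'_apply, Matrix.mulVec_single_one]
        rfl⟩
  rwa [Fintype.card_fin, hU] at h

end Rank

end

/-! ### Almost everywhere tangency along lines. -/

section

/-- The exceptional sets below are shown to be Lebesgue null by slicing along lines; this carries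
them over to the gaussian measure. -/
theorem stdG_absolutelyContinuous (ι : Type*) [Fintype ι] :
    stdG ι ≪ (volume : Measure (ι → ℝ)) := by
  have key : stdG ι = (volume : Measure (ι → ℝ)).withDensity
      fun x => ENNReal.ofReal (∏ i, gaussianPDFReal 0 1 (x i)) := by
    refine (Measure.pi_eq fun s hs => ?_)
    have hms : MeasurableSet (Set.univ.pi s) := MeasurableSet.univ_pi hs
    rw [withDensity_apply _ hms, ← lintegral_indicator hms]
    have e1 : (Set.univ.pi s).indicator (fun x : ι → ℝ =>
        ENNReal.ofReal (∏ i, gaussianPDFReal 0 1 (x i))) =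
        fun x => ENNReal.ofReal (∏ i, (s i).indicator (gaussianPDFReal 0 1) (x i)) := by
      ext x
      by_cases hx : x ∈ Set.univ.pi s
      · rw [Set.indicator_of_mem hx]
        congr 1
        exact Finset.prod_congr rfl fun i _ => (Set.indicator_of_mem (hx i trivial) _).symm
      · rw [Set.indicator_of_notMem hx]
        simp only [Set.mem_pi, Set.mem_univ, true_implies, not_forall] at hx
        obtain ⟨i, hi⟩ := hx
        rw [Finset.prod_eq_zero (Finset.mem_univ i) (Set.indicator_of_notMem hi _),
          ENNReal.ofReal_zero]
    have hi : ∀ i, Integrable ((s i).indicator (gaussianPDFReal 0 1)) := fun i =>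
      (integrable_gaussianPDFReal 0 1).indicator (hs i)
    have hnn : ∀ i x, 0 ≤ (s i).indicator (gaussianPDFReal 0 1) x := fun i x =>
      Set.indicator_nonneg (fun _ _ => gaussianPDFReal_nonneg _ _ _) _
    have hP : Integrable (fun x : ι → ℝ => ∏ i, (s i).indicator (gaussianPDFReal 0 1) (x i))
        volume := Integrable.fintype_prod_dep hi
    rw [e1, ← ofReal_integral_eq_lintegral_ofReal hP
      (Eventually.of_forall fun x => Finset.prod_nonneg fun i _ => hnn i _),
      integral_fintype_prod_volume_eq_prod,
      ENNReal.ofReal_prod_of_nonneg fun i _ => integral_nonneg (hnn i)]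
    refine Finset.prod_congr rfl fun i _ => ?_
    rw [integral_indicator (hs i), gaussianReal_apply_eq_integral 0 one_ne_zero]
  rw [key]
  exact withDensity_absolutelyContinuous _ _

/-- Used to turn almost everywhere vanishing of a continuous function into vanishing everywhere. -/
theorem isOpenPosMeasure_stdG (ι : Type*) [Fintype ι] : (stdG ι).IsOpenPosMeasure := by
  have : (gaussianReal 0 1).IsOpenPosMeasure :=
    (gaussianReal_absolutelyContinuous' 0 one_ne_zero).isOpenPosMeasure
  infer_instance

theorem countable_of_separated {s : Set ℝ} {ε : ℝ} (hε : 0 < ε)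
    (h : ∀ x ∈ s, ∀ y ∈ s, x ≠ y → ε ≤ |x - y|) : s.Countable := by
  refine Set.PairwiseDisjoint.countable_of_isOpen (s := fun x => Metric.ball x (ε / 2)) ?_
    (fun _ _ => Metric.isOpen_ball) fun x _ => ⟨x, Metric.mem_ball_self (by positivity)⟩
  intro x hx y hy hxy
  refine Metric.ball_disjoint_ball ?_
  rw [add_halves, Real.dist_eq]
  exact h x hx y hy hxy

variable {ι : Type*} [Fintype ι] {n : ℕ}

/-- Along a fixed direction, almost every point of a closed set is an accumulation point. -/
theorem ae_accumulation {S : Set (ι → ℝ)} (hS : IsClosed S) (α : ι → ℝ) :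
    ∀ᵐ y ∂(volume : Measure (ι → ℝ)), y ∈ S → ∃ᶠ t in 𝓝[≠] (0 : ℝ), y + t • α ∈ S := by
  -- Cutting the punctured interval into compact annuli makes the sets `T l k` closed, hence
  -- measurable.
  let K : ℕ → ℕ → Set ℝ := fun l k => {t | 1 / ((k : ℝ) + 1) ≤ |t| ∧ |t| ≤ 1 / ((l : ℝ) + 1)}
  have hKc : ∀ l k, IsCompact (K l k) := by
    intro l k
    refine (isCompact_Icc (a := -(1 / ((l : ℝ) + 1))) (b := 1 / ((l : ℝ) + 1))).of_isClosed_subset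
      ?_ fun t ht => abs_le.1 ht.2
    exact (isClosed_le continuous_const continuous_abs).inter
      (isClosed_le continuous_abs continuous_const)
  let T : ℕ → ℕ → Set (ι → ℝ) := fun l k => {y | ∃ t ∈ K l k, y + t • α ∈ S}
  have hT : ∀ l k, IsClosed (T l k) := by
    intro l k
    have h1 := hS.add_right_of_isCompact
      ((hKc l k).image (f := fun t : ℝ => -(t • α)) (by fun_prop))
    convert! h1 using 1
    ext y
    simp only [T, Set.mem_ofPred_eq, Set.mem_add, Set.mem_image]
    constructor
    · rintro ⟨t, ht, hy⟩
      exact ⟨_, hy, _, ⟨t, ht, rfl⟩, by abel⟩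
    · rintro ⟨x, hx, _, ⟨t, ht, rfl⟩, rfl⟩
      exact ⟨t, ht, by simpa using hx⟩
  have hae : ∀ l : ℕ, ∀ᵐ y ∂(volume : Measure (ι → ℝ)), y ∈ Sᶜ ∪ ⋃ k, T l k := by
    intro l
    -- Fubini along the lines of direction `α`: a null set of parameters on each line suffices.
    refine ae_mem_of_ae_add_linearMap_mem (𝕜 := ℝ) (LinearMap.toSpanSingleton ℝ (ι → ℝ) α)
      (volume : Measure ℝ) volume
      (hS.isOpen_compl.measurableSet.union (MeasurableSet.iUnion fun k => (hT l k).measurableSet))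
      fun y => ?_
    -- Two exceptional parameters on one line differ by at least `1 / (l + 1)`, since otherwise each
    -- point would be a nearby point of `S` for the other.
    refine ((countable_of_separated (ε := 1 / ((l : ℝ) + 1)) (by positivity) ?_).ae_notMem
      volume).mono (p := fun s => s ∉ {s : ℝ | ¬ (y + LinearMap.toSpanSingleton ℝ (ι → ℝ) α s ∈
        Sᶜ ∪ ⋃ k, T l k)}) fun s hs => not_not.1 hs
    intro s hs s' hs' hne
    by_contra! hlt
    simp only [Set.mem_ofPred_eq, Set.mem_union, not_or, Set.mem_compl_iff, not_not,
      LinearMap.toSpanSingleton_apply, Set.mem_iUnion, not_exists] at hs hs'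
    obtain ⟨k, hk⟩ := exists_nat_one_div_lt (abs_pos.2 (sub_ne_zero.2 hne))
    refine hs'.2 k ⟨s - s', ⟨hk.le, hlt.le⟩, ?_⟩
    convert hs.1 using 1
    rw [sub_smul]; abel
  filter_upwards [ae_all_iff.2 hae] with y hy hyS
  rw [frequently_iff]
  intro U hU
  rw [mem_nhdsWithin_iff_exists_mem_nhds_inter] at hU
  obtain ⟨V, hV, hVU⟩ := hU
  obtain ⟨ε, hε, hball⟩ := Metric.mem_nhds_iff.1 hV
  obtain ⟨l, hl⟩ := exists_nat_one_div_lt hε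
  rcases hy l with h | h
  · exact absurd hyS h
  · obtain ⟨k, t, ht, htS⟩ := Set.mem_iUnion.1 h
    refine ⟨t, hVU ⟨hball ?_, ?_⟩, htS⟩
    · rw [Metric.mem_ball, dist_zero_right]
      exact ht.2.trans_lt hl
    · intro h0
      have h1 : t = 0 := h0
      have h2 := ht.1
      rw [h1, abs_zero] at h2
      have : 0 < 1 / ((k : ℝ) + 1) := by positivity
      linarith

/-- The derivative of a matrix valued function. -/
def dMat (B : (ι → ℝ) → Matrix (Fin n) (Fin n) ℂ) (y α : ι → ℝ) : Matrix (Fin n) (Fin n) ℂ :=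
  Matrix.of fun i j => fderiv ℝ (fun z => B z i j) y α

/-- The second derivative of a matrix valued function. -/
def ddMat (B : (ι → ℝ) → Matrix (Fin n) (Fin n) ℂ) (y α β : ι → ℝ) :
    Matrix (Fin n) (Fin n) ℂ :=
  Matrix.of fun i j => fderiv ℝ (fderiv ℝ fun z => B z i j) y α β

theorem tendsto_taylor_one {f : (ι → ℝ) → ℂ} (hf : ContDiff ℝ 2 f) (y α : ι → ℝ) :
    Tendsto (fun t : ℝ => (t : ℂ)⁻¹ * (f (y + t • α) - f y)) (𝓝[≠] 0) (𝓝 (fderiv ℝ f y α)) := by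
  have h : HasDerivAt (fun t : ℝ => f (y + t • α)) (fderiv ℝ f y α) 0 := by
    have h1 : HasDerivAt (fun t : ℝ => y + t • α) α 0 := by
      simpa using ((hasDerivAt_id (0 : ℝ)).smul_const α).const_add y
    have h2 : HasFDerivAt f (fderiv ℝ f y) (y + (0 : ℝ) • α) := by
      simpa using (hf.differentiable two_ne_zero y).hasFDerivAt
    exact h2.comp_hasDerivAt (0 : ℝ) h1
  have := h.tendsto_slope_zero
  simpa [Complex.real_smul] using! this

theorem tendsto_taylor_two {f : (ι → ℝ) → ℂ} (hf : ContDiff ℝ 2 f) (y α : ι → ℝ) :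
    Tendsto (fun t : ℝ => ((t : ℂ) ^ 2)⁻¹ * (f (y + t • α) - f y - t * fderiv ℝ f y α)) (𝓝[≠] 0)
      (𝓝 (1 / 2 * fderiv ℝ (fderiv ℝ f) y α α)) := by
  have hline : ∀ t : ℝ, HasDerivAt (fun t : ℝ => y + t • α) α t := fun t => by
    simpa using ((hasDerivAt_id t).smul_const α).const_add y
  have hd : ∀ t : ℝ, HasDerivAt (fun t : ℝ => f (y + t • α)) (fderiv ℝ f (y + t • α) α) t :=
    fun t => (hf.differentiable two_ne_zero _).hasFDerivAt.comp_hasDerivAt t (hline t)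
  have hd1 : deriv (fun t : ℝ => f (y + t • α)) = fun t => fderiv ℝ f (y + t • α) α :=
    funext fun t => (hd t).deriv
  have hf' : ContDiff ℝ 1 (fderiv ℝ f) := hf.fderiv_right (by norm_num)
  have hd2 : HasDerivAt (fun t : ℝ => fderiv ℝ f (y + t • α) α)
      (fderiv ℝ (fderiv ℝ f) y α α) 0 := by
    have h2 : HasFDerivAt (fderiv ℝ f) (fderiv ℝ (fderiv ℝ f) y) (y + (0 : ℝ) • α) := by
      simpa using (hf'.differentiable one_ne_zero y).hasFDerivAt
    exact ((ContinuousLinearMap.apply ℝ ℂ α).hasFDerivAt.comp_hasDerivAt (0 : ℝ)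
      (h2.comp_hasDerivAt (0 : ℝ) (hline 0)))
  have hT := taylor_isLittleO_univ (f := fun t : ℝ => f (y + t • α)) (x₀ := 0) (n := 2)
    (hf.comp (by fun_prop))
  have e : ∀ t : ℝ, taylorWithinEval (fun t : ℝ => f (y + t • α)) 2 Set.univ 0 t =
      f y + t * fderiv ℝ f y α + t ^ 2 * (1 / 2 * fderiv ℝ (fderiv ℝ f) y α α) := by
    intro t
    simp only [taylorWithinEval_succ, taylor_within_zero_eval, iteratedDerivWithin_univ,
      iteratedDeriv_succ, iteratedDeriv_zero, hd1, hd2.deriv]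
    simp
    ring
  simp only [e] at hT
  have h2 := ((hT.mono (nhdsWithin_le_nhds (s := {0}ᶜ))).tendsto_inv_smul_nhds_zero).add_const
    (1 / 2 * fderiv ℝ (fderiv ℝ f) y α α)
  rw [zero_add] at h2
  refine h2.congr' ?_
  filter_upwards [self_mem_nhdsWithin] with t ht
  have ht' : (t : ℂ) ≠ 0 := by exact_mod_cast ht
  simp only [sub_zero, Complex.real_smul]
  push_cast
  field_simp
  ring

section Compression

variable {B : (ι → ℝ) → Matrix (Fin n) (Fin n) ℂ}

theorem continuous_of_entries (hB : ∀ i j, ContDiff ℝ 2 fun y => B y i j) : Continuous B :=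
  continuous_matrix fun i j => (hB i j).continuous

theorem compression_of_frequently (hB : ∀ i j, ContDiff ℝ 2 fun y => B y i j) {y α : ι → ℝ}
    (hr : ∃ᶠ t in 𝓝[≠] (0 : ℝ), (B (y + t • α)).rank ≤ (B y).rank)
    {C : Matrix (Fin n) (Fin n) ℂ} (hC : B y * C * B y = B y) :
    (1 - B y * C) * dMat B y α * (1 - C * B y) = 0 ∧
      ((1 - B y * C) * ddMat B y α α * (1 - C * B y)).rank ≤ (B y).rank := by
  have e0 : B (y + (0 : ℝ) • α) = B y := by simp
  have h1 : (1 - B y * C) * dMat B y α * (1 - C * B y) = 0 := by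
    have h := compression_deriv_eq_zero (b := fun t : ℝ => B (y + t • α)) (b' := dMat B y α)
      (C := C)
    simp only [e0] at h
    refine h hC ?_ ?_ hr
    · have hc : Continuous fun t : ℝ => B (y + t • α) :=
        (continuous_of_entries hB).comp (by fun_prop)
      have := hc.tendsto 0
      simp only [e0] at this
      exact this.mono_left nhdsWithin_le_nhds
    · refine tendsto_pi_nhds.2 fun i => tendsto_pi_nhds.2 fun j => ?_
      exact tendsto_taylor_one (hB i j) y α
  refine ⟨h1, ?_⟩
  have h := rank_compression_deriv_two_le (b := fun t : ℝ => B (y + t • α)) (b' := dMat B y α)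
    (b'' := ddMat B y α α) (C := C)
  simp only [e0] at h
  refine h hC h1 ?_ hr
  refine tendsto_pi_nhds.2 fun i => tendsto_pi_nhds.2 fun j => ?_
  exact tendsto_taylor_two (hB i j) y α

/-- At almost every point, a twice differentiable matrix valued function is tangent to second order
to the matrices of bounded rank. -/
theorem ae_compression (hB : ∀ i j, ContDiff ℝ 2 fun y => B y i j) :
    ∀ᵐ y ∂(stdG ι), ∀ C, B y * C * B y = B y →
      (∀ α, (1 - B y * C) * dMat B y α * (1 - C * B y) = 0) ∧
        ∀ α, ((1 - B y * C) * ddMat B y α α * (1 - C * B y)).rank ≤ (B y).rank := by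
  -- Accumulation holds almost everywhere for one rank bound and one direction at a time. A
  -- countable dense set of directions keeps the exceptional set null; the two conclusions are
  -- closed conditions in `α` and extend by density.
  have hacc : ∀ᵐ y ∂(volume : Measure (ι → ℝ)), ∀ (r k : ℕ), (B y).rank ≤ r →
      ∃ᶠ t in 𝓝[≠] (0 : ℝ), (B (y + t • TopologicalSpace.denseSeq (ι → ℝ) k)).rank ≤ r := by
    refine ae_all_iff.2 fun r => ae_all_iff.2 fun k => ?_
    exact ae_accumulation ((isClosed_rank_le r).preimage (continuous_of_entries hB)) _
  filter_upwards [(stdG_absolutelyContinuous ι).ae_le hacc] with y hy C hC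
  have hk := fun k => compression_of_frequently hB (hy (B y).rank k le_rfl) hC
  have hc1 : Continuous fun α => dMat B y α :=
    continuous_matrix fun i j => (fderiv ℝ (fun z => B z i j) y).continuous
  have hc2 : Continuous fun α => ddMat B y α α :=
    continuous_matrix fun i j => ((fderiv ℝ (fderiv ℝ fun z => B z i j) y).continuous).clm_apply
      continuous_id
  constructor
  · intro α
    refine (TopologicalSpace.denseRange_denseSeq (ι → ℝ)).induction_on α
      (isClosed_eq (by fun_prop) continuous_const) fun k => (hk k).1
  · intro α
    refine (TopologicalSpace.denseRange_denseSeq (ι → ℝ)).induction_on α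
      ((isClosed_rank_le (B y).rank).preimage (f := fun α => (1 - B y * C) * ddMat B y α α *
        (1 - C * B y)) (by fun_prop)) fun k => (hk k).2

end Compression

/-- At almost every zero of `u'` further zeros accumulate along the coordinate direction, so the
difference quotients of `u'` vanish infinitely often. This will allow division by `u'` in terms that
carry a factor `u''`. -/
theorem ae_deriv_deriv_eq_zero [DecidableEq ι] {u : ι → ℝ → ℝ} (hu : ∀ i, ContDiff ℝ 2 (u i)) :
    ∀ᵐ y ∂(stdG ι), ∀ i, deriv (u i) (y i) = 0 → deriv (deriv (u i)) (y i) = 0 := by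
  refine ae_all_iff.2 fun i => ?_
  have hd : ContDiff ℝ 1 (deriv (u i)) := ((contDiff_succ_iff_deriv (n := 1)).1 (hu i)).2.2
  have hS : IsClosed {y : ι → ℝ | deriv (u i) (y i) = 0} :=
    isClosed_eq (hd.continuous.comp (continuous_apply i)) continuous_const
  filter_upwards [(stdG_absolutelyContinuous ι).ae_le (ae_accumulation hS (Pi.single i 1))]
    with y hy h0
  have hD : HasDerivAt (deriv (u i)) (deriv (deriv (u i)) (y i)) (y i) :=
    (hd.differentiable one_ne_zero _).hasDerivAt
  have ht := hD.tendsto_slope_zero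
  refine tendsto_nhds_unique_of_frequently_eq ht tendsto_const_nhds ((hy h0).mono fun t ht => ?_)
  have e : deriv (u i) (y i + t) = 0 := by simpa using ht
  rw [e, h0]; simp

end

/-! ### Entire power series in a Banach algebra. -/

section

section Coefficients

/-- The coefficient sequences of entire functions. -/
def EntireCoeff (c : ℕ → ℂ) : Prop := ∀ r : ℝ, 0 ≤ r → Summable fun m => ‖c m‖ * r ^ m

/-- The coefficients of the derivative of a power series. -/
def derivCoeff (c : ℕ → ℂ) (m : ℕ) : ℂ := (m + 1) * c (m + 1)

theorem entireCoeff_coeff {f : ℂ → ℂ} (hf : Differentiable ℂ f) : EntireCoeff (coeff f) := by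
  intro r hr
  have h := (Complex.hasSum_taylorSeries_of_entire hf 0 (r : ℂ)).summable.norm
  refine h.congr fun m => ?_
  simp only [coeff, sub_zero, norm_smul, norm_inv, norm_pow, norm_div, Complex.norm_real,
    Real.norm_eq_abs, abs_of_nonneg hr]
  ring

theorem mul_pow_pred_le {r : ℝ} (hr : 0 ≤ r) (m : ℕ) :
    (m : ℝ) * r ^ (m - 1) ≤ (2 * (r + 1)) ^ m := by
  rw [mul_pow]
  have h1 : (m : ℝ) ≤ 2 ^ m := by exact_mod_cast (Nat.lt_two_pow_self (n := m)).le
  have h2 : r ^ (m - 1) ≤ (r + 1) ^ m :=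
    (pow_le_pow_left₀ hr (by linarith) _).trans (pow_le_pow_right₀ (by linarith) (Nat.sub_le _ _))
  gcongr

theorem EntireCoeff.summable_mul_pow_pred {c : ℕ → ℂ} (hc : EntireCoeff c) {r : ℝ} (hr : 0 ≤ r) :
    Summable fun m : ℕ => ‖c m‖ * (m * r ^ (m - 1)) :=
  Summable.of_nonneg_of_le (fun m => by positivity)
    (fun m => mul_le_mul_of_nonneg_left (mul_pow_pred_le hr m) (norm_nonneg _))
    (hc (2 * (r + 1)) (by positivity))

theorem norm_derivCoeff (c : ℕ → ℂ) (m : ℕ) : ‖derivCoeff c m‖ = (m + 1) * ‖c (m + 1)‖ := by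
  rw [derivCoeff, norm_mul]
  congr 1
  exact_mod_cast Complex.norm_natCast (m + 1)

theorem EntireCoeff.derivCoeff {c : ℕ → ℂ} (hc : EntireCoeff c) : EntireCoeff (derivCoeff c) := by
  intro r hr
  refine ((summable_nat_add_iff 1).2 (hc.summable_mul_pow_pred hr)).congr fun m => ?_
  rw [norm_derivCoeff, Nat.add_sub_cancel]
  push_cast
  ring

theorem hasSum_f₁ {f : ℂ → ℂ} (hf : Differentiable ℂ f) {t : ℝ} (ht : 0 ≤ t) :
    HasSum (fun m => ‖derivCoeff (coeff f) m‖ * t ^ m) (f₁ f t) := by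
  have h : Summable fun m : ℕ => (m : ℝ) * ‖coeff f m‖ * t ^ (m - 1) :=
    ((entireCoeff_coeff hf).summable_mul_pow_pred ht).congr fun m => by ring
  have h2 := (hasSum_nat_add_iff' 1).2 h.hasSum
  simp only [Finset.range_one, Finset.sum_singleton, Nat.cast_zero, zero_mul, sub_zero] at h2
  refine h2.congr_fun fun m => ?_
  rw [norm_derivCoeff]
  simp

theorem hasSum_f₂ {f : ℂ → ℂ} (hf : Differentiable ℂ f) {t : ℝ} (ht : 0 ≤ t) :
    HasSum (fun m : ℕ => ‖derivCoeff (coeff f) m‖ * (m * t ^ (m - 1))) (f₂ f t) := by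
  have h := (entireCoeff_coeff hf).derivCoeff.summable_mul_pow_pred ht
  have e : (fun m : ℕ => ‖derivCoeff (coeff f) m‖ * (m * t ^ (m - 1))) = fun m : ℕ =>
      ((m + 1 : ℕ) : ℝ) * (((m + 1 : ℕ) : ℝ) - 1) * ‖coeff f (m + 1)‖ * t ^ (m + 1 - 2) := by
    ext m
    rw [norm_derivCoeff, show m + 1 - 2 = m - 1 by omega]
    push_cast; ring
  rw [e] at h ⊢
  have h2 : Summable fun m : ℕ => (m : ℝ) * ((m : ℝ) - 1) * ‖coeff f m‖ * t ^ (m - 2) :=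
    (summable_nat_add_iff 1).1 h
  have h3 := (hasSum_nat_add_iff' 1).2 h2.hasSum
  simpa using! h3

theorem f₁_nonneg {f : ℂ → ℂ} {t : ℝ} (ht : 0 ≤ t) : 0 ≤ f₁ f t :=
  tsum_nonneg fun m => by positivity

theorem f₂_nonneg {f : ℂ → ℂ} {t : ℝ} (ht : 0 ≤ t) : 0 ≤ f₂ f t := by
  refine tsum_nonneg fun m => ?_
  rcases m with _ | m
  · simp
  · push_cast
    have : (0 : ℝ) ≤ (m : ℝ) + 1 - 1 := by simp
    positivity

end Coefficients

section Algebra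

variable {𝔸 : Type*} [NormedRing 𝔸] [NormedAlgebra ℂ 𝔸]

/-- Assuming only `‖1‖ ≤ 1`, rather than equality, includes the trivial algebra of `0 × 0` matrices.
-/
theorem norm_pow_le_of_norm_one_le (h1 : ‖(1 : 𝔸)‖ ≤ 1) (B : 𝔸) (m : ℕ) : ‖B ^ m‖ ≤ ‖B‖ ^ m := by
  rcases m with _ | m
  · simpa using h1
  · exact norm_pow_le' B m.succ_pos

/-- The derivative of `B ↦ B ^ m`. -/
def powDeriv (B : 𝔸) (m : ℕ) : 𝔸 →L[ℂ] 𝔸 :=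
  ∑ i ∈ Finset.range m, ContinuousLinearMap.mulLeftRight ℂ 𝔸 (B ^ (m - 1 - i)) (B ^ i)

theorem powDeriv_apply (B N : 𝔸) (m : ℕ) :
    powDeriv B m N = ∑ i ∈ Finset.range m, B ^ (m - 1 - i) * N * B ^ i := by
  simp [powDeriv, ContinuousLinearMap.mulLeftRight_apply]

theorem hasFDerivAt_pow_powDeriv (B : 𝔸) (m : ℕ) :
    HasFDerivAt (fun x : 𝔸 => x ^ m) (powDeriv B m) B := by
  refine (hasFDerivAt_pow' (𝕜 := ℂ) m).congr_fderiv ?_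
  ext N
  rw [powDeriv_apply]
  simp [mul_assoc]

theorem norm_powDeriv_le (h1 : ‖(1 : 𝔸)‖ ≤ 1) (B : 𝔸) (m : ℕ) :
    ‖powDeriv B m‖ ≤ m * ‖B‖ ^ (m - 1) := by
  refine ContinuousLinearMap.opNorm_le_bound _ (by positivity) fun N => ?_
  rw [powDeriv_apply]
  refine (norm_sum_le_of_le (n := fun _ => ‖B‖ ^ (m - 1) * ‖N‖) _ fun i hi => ?_).trans
    (le_of_eq ?_)
  · have hi' : i < m := Finset.mem_range.1 hi
    calc ‖B ^ (m - 1 - i) * N * B ^ i‖ ≤ ‖B ^ (m - 1 - i)‖ * ‖N‖ * ‖B ^ i‖ :=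
          (norm_mul_le _ _).trans (mul_le_mul_of_nonneg_right (norm_mul_le _ _) (norm_nonneg _))
      _ ≤ ‖B‖ ^ (m - 1 - i) * ‖N‖ * ‖B‖ ^ i := by
          gcongr <;> exact norm_pow_le_of_norm_one_le h1 _ _
      _ = ‖B‖ ^ (m - 1) * ‖N‖ := by
          rw [mul_right_comm, ← pow_add]; congr 2; omega
  · rw [Finset.sum_const, Finset.card_range, nsmul_eq_mul, mul_assoc]

variable [CompleteSpace 𝔸] {c : ℕ → ℂ}

theorem EntireCoeff.summable_smul_pow (hc : EntireCoeff c) (h1 : ‖(1 : 𝔸)‖ ≤ 1) (B : 𝔸) :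
    Summable fun m => c m • B ^ m := by
  refine Summable.of_norm_bounded (hc ‖B‖ (norm_nonneg _)) fun m => ?_
  rw [norm_smul]
  exact mul_le_mul_of_nonneg_left (norm_pow_le_of_norm_one_le h1 B m) (norm_nonneg _)

/-- Termwise differentiation on the ball of radius `‖B‖ + 1`, where the derivatives are dominated by
a summable sequence independent of the point. -/
theorem EntireCoeff.hasFDerivAt_tsum (hc : EntireCoeff c) (h1 : ‖(1 : 𝔸)‖ ≤ 1) (B : 𝔸)
    (τ : 𝔸 →L[ℂ] ℂ) :
    HasFDerivAt (fun x : 𝔸 => τ (∑' m, c m • x ^ m)) (∑' m, c m • τ ∘L powDeriv B m) B := by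
  have e : (fun x : 𝔸 => τ (∑' m, c m • x ^ m)) = fun x => ∑' m, c m • τ (x ^ m) := by
    ext x
    rw [τ.map_tsum (hc.summable_smul_pow h1 x)]
    simp only [map_smul]
  rw [e]
  refine hasFDerivAt_tsum_of_isPreconnected (u := fun m => ‖c m‖ * (m * (‖B‖ + 1) ^ (m - 1)) * ‖τ‖)
    ((hc.summable_mul_pow_pred (by positivity)).mul_right _) (s := Metric.ball 0 (‖B‖ + 1))
    Metric.isOpen_ball (convex_ball _ _).isPreconnected
    (f' := fun m x => c m • τ ∘L powDeriv x m)
    (fun m x _ => (τ.hasFDerivAt.comp x (hasFDerivAt_pow_powDeriv x m)).const_smul (c m))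
    (fun m x hx => ?_) (x₀ := 0) (Metric.mem_ball_self (by positivity)) ?_ (by simp)
  · rw [mem_ball_zero_iff] at hx
    rw [norm_smul, mul_assoc]
    refine mul_le_mul_of_nonneg_left ((ContinuousLinearMap.opNorm_comp_le _ _).trans ?_)
      (norm_nonneg _)
    rw [mul_comm]
    refine mul_le_mul_of_nonneg_right ((norm_powDeriv_le h1 x m).trans ?_) (norm_nonneg _)
    gcongr
  · exact (τ.summable (hc.summable_smul_pow h1 0)).congr fun m => by simp

theorem EntireCoeff.summable_smul_comp_powDeriv (hc : EntireCoeff c) (h1 : ‖(1 : 𝔸)‖ ≤ 1) (B : 𝔸)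
    (τ : 𝔸 →L[ℂ] ℂ) : Summable fun m => c m • τ ∘L powDeriv B m := by
  refine Summable.of_norm_bounded ((hc.summable_mul_pow_pred (norm_nonneg B)).mul_left ‖τ‖)
    fun m => ?_
  rw [norm_smul, mul_left_comm]
  refine mul_le_mul_of_nonneg_left ((ContinuousLinearMap.opNorm_comp_le _ _).trans ?_)
    (norm_nonneg _)
  exact mul_le_mul_of_nonneg_left (norm_powDeriv_le h1 B m) (norm_nonneg _)

theorem EntireCoeff.contDiff_tsum (hc : EntireCoeff c) :
    ContDiff ℂ 2 (fun x : 𝔸 => ∑' m, c m • x ^ m) := by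
  have hr : (FormalMultilinearSeries.ofScalars 𝔸 c).radius = ⊤ := by
    refine FormalMultilinearSeries.radius_eq_top_of_summable_norm _ fun r => ?_
    -- The norm bound for the terms of the series holds in positive degree only, because it would
    -- involve `‖1‖` in degree zero; the constant term is dropped.
    refine (summable_nat_add_iff 1).1 ?_
    refine Summable.of_nonneg_of_le (fun m => by positivity) (fun m => ?_)
      ((summable_nat_add_iff 1).2 (hc r r.2))
    exact mul_le_mul_of_nonneg_right
      (FormalMultilinearSeries.ofScalars_norm_le 𝔸 c _ m.succ_pos) (by positivity)
  have h := (FormalMultilinearSeries.ofScalars 𝔸 c).hasFPowerSeriesOnBall (by rw [hr]; simp)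
  rw [hr] at h
  have h2 := h.analyticOnNhd
  rw [Metric.eball_top] at h2
  have h3 : ContDiff ℂ 2 (FormalMultilinearSeries.ofScalars 𝔸 c).sum :=
    contDiff_iff_contDiffAt.2 fun x => (h2 x (Set.mem_univ x)).contDiffAt
  convert! h3 using 1
  exact (FormalMultilinearSeries.ofScalarsSum_eq_tsum c).symm

end Algebra

/-! ### Matrix functions and the derivative of their trace. -/

section MatrixFunction

open scoped Matrix.Norms.L2Operator

variable {n : ℕ}

theorem norm_eq_opNorm (B : Matrix (Fin n) (Fin n) ℂ) : ‖B‖ = opNorm B := rfl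

theorem norm_one_le : ‖(1 : Matrix (Fin n) (Fin n) ℂ)‖ ≤ 1 := by
  rw [Matrix.cstar_norm_def, map_one]
  exact ContinuousLinearMap.norm_id_le

/-- The trace as a continuous linear functional. -/
def traceCLM (n : ℕ) : Matrix (Fin n) (Fin n) ℂ →L[ℂ] ℂ :=
  LinearMap.toContinuousLinearMap (Matrix.traceLinearMap (Fin n) ℂ ℂ)

theorem traceCLM_apply (B : Matrix (Fin n) (Fin n) ℂ) : traceCLM n B = B.trace := rfl

variable {f : ℂ → ℂ}

/-- `f'(B)`. -/
def matrixDeriv (f : ℂ → ℂ) (B : Matrix (Fin n) (Fin n) ℂ) : Matrix (Fin n) (Fin n) ℂ :=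
  ∑' m : ℕ, derivCoeff (coeff f) m • B ^ m

theorem opNorm_matrixDeriv_le (hf : Differentiable ℂ f) (B : Matrix (Fin n) (Fin n) ℂ) :
    opNorm (matrixDeriv f B) ≤ f₁ f (opNorm B) := by
  rw [← norm_eq_opNorm]
  refine tsum_of_norm_bounded (hasSum_f₁ hf (opNorm_nonneg B)) fun m => ?_
  rw [norm_smul]
  exact mul_le_mul_of_nonneg_left (norm_pow_le_of_norm_one_le norm_one_le B m) (norm_nonneg _)

theorem contDiff_matrixFun (hf : Differentiable ℂ f) :
    ContDiff ℂ 2 (matrixFun (n := n) f) := (entireCoeff_coeff hf).contDiff_tsum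

/-- Under the trace all `m` summands of the derivative of `B ^ m` coincide by cyclicity and collapse
to `m B ^ (m - 1) N`. -/
theorem hasFDerivAt_trace_matrixFun (hf : Differentiable ℂ f) (B : Matrix (Fin n) (Fin n) ℂ) :
    HasFDerivAt (fun B => (matrixFun f B).trace)
      (traceCLM n ∘L ContinuousLinearMap.mul ℂ _ (matrixDeriv f B)) B := by
  have hc := entireCoeff_coeff hf
  refine (hc.hasFDerivAt_tsum norm_one_le B (traceCLM n)).congr_fderiv ?_
  have hs := hc.summable_smul_comp_powDeriv norm_one_le B (traceCLM n)
  have hs2 := hc.derivCoeff.summable_smul_pow norm_one_le B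
  ext N
  have e1 := ((ContinuousLinearMap.apply ℂ ℂ N).hasSum hs.hasSum)
  have e2 := ((traceCLM n ∘L (ContinuousLinearMap.mul ℂ _).flip N).hasSum hs2.hasSum)
  have key : ∀ m, (ContinuousLinearMap.apply ℂ ℂ N) (coeff f m • traceCLM n ∘L powDeriv B m) =
      coeff f m * (m * (B ^ (m - 1) * N).trace) := by
    intro m
    simp only [ContinuousLinearMap.apply_apply, smul_apply,
      ContinuousLinearMap.comp_apply, powDeriv_apply, traceCLM_apply, Matrix.trace_sum, smul_eq_mul]
    congr 1
    rw [Finset.sum_congr rfl (g := fun _ => (B ^ (m - 1) * N).trace), Finset.sum_const,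
      Finset.card_range, nsmul_eq_mul]
    intro i hi
    have hi' : i < m := Finset.mem_range.1 hi
    rw [Matrix.trace_mul_comm, ← mul_assoc, ← pow_add]
    congr 3; omega
  rw [funext key] at e1
  have e3 := (hasSum_nat_add_iff' 1).2 e1
  simp only [Finset.range_one, Finset.sum_singleton, Nat.cast_zero, zero_mul, mul_zero, sub_zero]
    at e3
  refine e3.unique (e2.congr_fun fun m => ?_)
  simp only [ContinuousLinearMap.comp_apply, ContinuousLinearMap.flip_apply,
    ContinuousLinearMap.mul_apply', traceCLM_apply, Matrix.smul_mul, Matrix.trace_smul,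
    derivCoeff, smul_eq_mul, Nat.add_sub_cancel]
  push_cast
  ring

theorem norm_trace_pow_mul_pow_mul_le (B M N : Matrix (Fin n) (Fin n) ℂ) (k l : ℕ) :
    ‖(B ^ k * N * B ^ l * M).trace‖ ≤ opNorm B ^ (k + l) * (hsNorm N * hsNorm M) := by
  have h : ∀ (j : ℕ) (L : Matrix (Fin n) (Fin n) ℂ),
      hsNorm (B ^ j * L) ≤ opNorm B ^ j * hsNorm L := fun j L =>
    (hsNorm_mul_le _ _).trans (mul_le_mul_of_nonneg_right
      (norm_pow_le_of_norm_one_le norm_one_le B j) (hsNorm_nonneg L))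
  rw [mul_assoc (B ^ k * N)]
  refine (norm_trace_mul_le_hsNorm _ _).trans ?_
  refine (mul_le_mul (h k N) (h l M) (hsNorm_nonneg _)
    (mul_nonneg (pow_nonneg (opNorm_nonneg B) _) (hsNorm_nonneg _))).trans (le_of_eq ?_)
  rw [pow_add]; ring

/-- The extra factor `M` prevents the cyclic collapse, but each of the `m` summands `B ^ k N B ^ l
M` is estimated in Hilbert-Schmidt norms. No rank is lost here, and summation gives `f₂`. -/
theorem exists_hasFDerivAt_matrixDeriv (hf : Differentiable ℂ f)
    (B M : Matrix (Fin n) (Fin n) ℂ) :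
    ∃ R : Matrix (Fin n) (Fin n) ℂ →L[ℂ] ℂ,
      HasFDerivAt (fun B => (matrixDeriv f B * M).trace) R B ∧
      ∀ N, ‖R N‖ ≤ f₂ f (opNorm B) * (hsNorm N * hsNorm M) := by
  have hc := (entireCoeff_coeff hf).derivCoeff
  have hs := hc.summable_smul_comp_powDeriv norm_one_le B
    (traceCLM n ∘L (ContinuousLinearMap.mul ℂ (Matrix (Fin n) (Fin n) ℂ)).flip M)
  refine ⟨_, hc.hasFDerivAt_tsum norm_one_le B
    (traceCLM n ∘L (ContinuousLinearMap.mul ℂ (Matrix (Fin n) (Fin n) ℂ)).flip M), fun N => ?_⟩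
  have e1 := ((ContinuousLinearMap.apply ℂ ℂ N).hasSum hs.hasSum)
  rw [← ContinuousLinearMap.apply_apply N, ← e1.tsum_eq]
  refine tsum_of_norm_bounded ((hasSum_f₂ hf (opNorm_nonneg B)).mul_right _) fun m => ?_
  simp only [ContinuousLinearMap.apply_apply, smul_apply,
      ContinuousLinearMap.comp_apply, powDeriv_apply, traceCLM_apply, Matrix.trace_sum,
      ContinuousLinearMap.flip_apply, ContinuousLinearMap.mul_apply', Finset.sum_mul, smul_eq_mul,
      norm_mul, mul_assoc]
  refine mul_le_mul_of_nonneg_left ?_ (norm_nonneg _)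
  refine (norm_sum_le_of_le (n := fun _ => opNorm B ^ (m - 1) * (hsNorm N * hsNorm M)) _
    fun i hi => ?_).trans (le_of_eq ?_)
  · have hi' : i < m := Finset.mem_range.1 hi
    have := norm_trace_pow_mul_pow_mul_le B M N (m - 1 - i) i
    rw [show m - 1 - i + i = m - 1 by omega] at this
    simpa only [mul_assoc] using this
  · rw [Finset.sum_const, Finset.card_range, nsmul_eq_mul]

end MatrixFunction

end

/-! ### Derivatives of `Re Tr f(A)`. -/

section

section TraceFunction

open scoped Matrix.Norms.L2Operator

variable {ι : Type*} [Fintype ι] [DecidableEq ι] {n : ℕ}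
  {A : (ι → ℝ) → Matrix (Fin n) (Fin n) ℂ} {f : ℂ → ℂ}

/-- The entries of a matrix as continuous linear functionals. -/
def entryCLM (i j : Fin n) : Matrix (Fin n) (Fin n) ℂ →L[ℝ] ℂ :=
  (LinearMap.toContinuousLinearMap (Matrix.entryLinearMap ℂ ℂ i j)).restrictScalars ℝ

theorem contDiff_of_entries {k : WithTop ℕ∞} {M : (ι → ℝ) → Matrix (Fin n) (Fin n) ℂ}
    (hM : ∀ i j, ContDiff ℝ k fun x => M x i j) : ContDiff ℝ k M := by
  have e : M = fun x => ∑ i, ∑ j, M x i j • Matrix.single i j (1 : ℂ) := by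
    ext1 x
    conv_lhs => rw [Matrix.matrix_eq_sum_single (M x)]
    simp [Matrix.smul_single]
  rw [e]
  exact ContDiff.sum fun i _ => ContDiff.sum fun j _ => (hM i j).smul contDiff_const

theorem fderiv_apply_entry {M : (ι → ℝ) → Matrix (Fin n) (Fin n) ℂ} {x : ι → ℝ}
    (hM : DifferentiableAt ℝ M x) (v : ι → ℝ) (i j : Fin n) :
    fderiv ℝ M x v i j = fderiv ℝ (fun z => M z i j) x v := by
  have h := ((entryCLM i j).hasFDerivAt.comp x hM.hasFDerivAt).fderiv
  have h2 := congrArg (fun L : (ι → ℝ) →L[ℝ] ℂ => L v) h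
  exact h2.symm

/-- The function `Re Tr f(A)`. -/
def trFun (f : ℂ → ℂ) (A : (ι → ℝ) → Matrix (Fin n) (Fin n) ℂ) (x : ι → ℝ) : ℝ :=
  (matrixFun f (A x)).trace.re

theorem fderiv_eq_dMat (hA : ∀ i j, ContDiff ℝ 2 fun x => A x i j) (x v : ι → ℝ) :
    fderiv ℝ A x v = dMat A x v := by
  ext i j
  exact fderiv_apply_entry ((contDiff_of_entries hA).differentiable two_ne_zero x) v i j

theorem contDiff_trFun (hf : Differentiable ℂ f) (hA : ∀ i j, ContDiff ℝ 2 fun x => A x i j) :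
    ContDiff ℝ 2 (trFun f A) := by
  have h1 : ContDiff ℝ 2 (matrixFun (n := n) f) := (contDiff_matrixFun hf).restrict_scalars ℝ
  exact (Complex.reCLM ∘L (traceCLM n).restrictScalars ℝ).contDiff.comp
    (h1.comp (contDiff_of_entries hA))

theorem fderiv_trFun (hf : Differentiable ℂ f) (hA : ∀ i j, ContDiff ℝ 2 fun x => A x i j)
    (x v : ι → ℝ) :
    fderiv ℝ (trFun f A) x v = (matrixDeriv f (A x) * dMat A x v).trace.re := by
  have h1 := ((hasFDerivAt_trace_matrixFun hf (A x)).restrictScalars ℝ).comp x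
    ((contDiff_of_entries hA).differentiable two_ne_zero x).hasFDerivAt
  have h2 := (Complex.reCLM.hasFDerivAt.comp x h1).fderiv
  have h3 := congrArg (fun L : (ι → ℝ) →L[ℝ] ℝ => L v) h2
  refine h3.trans ?_
  rw [← fderiv_eq_dMat hA]
  rfl

/-- Product rule for `Tr(f'(A) ∂A)`. The remainder `ρ` comes from differentiating `f'(A)` and is
controlled without the rank; only the main term needs a rank bound, on the second derivative of `A`.
-/
theorem fderiv_fderiv_trFun (hf : Differentiable ℂ f) (hA : ∀ i j, ContDiff ℝ 2 fun x => A x i j)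
    (x w v : ι → ℝ) :
    ∃ ρ : ℝ, fderiv ℝ (fderiv ℝ (trFun f A)) x w v =
        (matrixDeriv f (A x) * ddMat A x w v).trace.re + ρ ∧
      |ρ| ≤ f₂ f (opNorm (A x)) * (hsNorm (dMat A x w) * hsNorm (dMat A x v)) := by
  have hg1 : DifferentiableAt ℝ (fderiv ℝ (trFun f A)) x :=
    ((contDiff_trFun hf hA).fderiv_right (m := 1) (by norm_num)).differentiable one_ne_zero x
  have e1 : fderiv ℝ (fderiv ℝ (trFun f A)) x w v =
      fderiv ℝ (fun z => fderiv ℝ (trFun f A) z v) x w := by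
    have := (((ContinuousLinearMap.apply ℝ ℝ v).hasFDerivAt.comp x hg1.hasFDerivAt)).fderiv
    exact (congrArg (fun L : (ι → ℝ) →L[ℝ] ℝ => L w) this).symm
  have hA' := ((contDiff_of_entries hA).differentiable two_ne_zero x).hasFDerivAt
  have hC : DifferentiableAt ℝ (fun z => matrixDeriv f (A z)) x := by
    have h1 : ContDiff ℂ 2 (matrixDeriv (n := n) f) := (entireCoeff_coeff hf).derivCoeff.contDiff_tsum
    exact ((h1.restrict_scalars ℝ).comp (contDiff_of_entries hA)).differentiable two_ne_zero x
  have hMe : ∀ i j, ContDiff ℝ 1 fun z => dMat A z v i j := fun i j =>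
    ((hA i j).fderiv_right (m := 1) (by norm_num)).clm_apply contDiff_const
  have hM : DifferentiableAt ℝ (fun z => dMat A z v) x :=
    (contDiff_of_entries hMe).differentiable one_ne_zero x
  have hM' : fderiv ℝ (fun z => dMat A z v) x w = ddMat A x w v := by
    ext i j
    rw [fderiv_apply_entry hM]
    have hd : DifferentiableAt ℝ (fderiv ℝ fun z => A z i j) x :=
      ((hA i j).fderiv_right (m := 1) (by norm_num)).differentiable one_ne_zero x
    have := (((ContinuousLinearMap.apply ℝ ℂ v).hasFDerivAt.comp x hd.hasFDerivAt)).fderiv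
    exact congrArg (fun L : (ι → ℝ) →L[ℝ] ℂ => L w) this
  obtain ⟨R, hR, hRle⟩ := exists_hasFDerivAt_matrixDeriv hf (A x) (dMat A x v)
  have eR : R (dMat A x w) = (fderiv ℝ (fun z => matrixDeriv f (A z)) x w * dMat A x v).trace := by
    have h1 := (hR.restrictScalars ℝ).comp x hA'
    have h2 := (((traceCLM n).restrictScalars ℝ).hasFDerivAt.comp x
      (hC.hasFDerivAt.mul_const' (dMat A x v)))
    have h3 := congrArg (fun L : (ι → ℝ) →L[ℝ] ℂ => L w) (h1.unique h2)
    rw [← fderiv_eq_dMat hA]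
    exact h3
  refine ⟨(R (dMat A x w)).re, ?_, ?_⟩
  · rw [e1]
    have e2 : (fun z => fderiv ℝ (trFun f A) z v) = fun z =>
        (matrixDeriv f (A z) * dMat A z v).trace.re := funext fun z => fderiv_trFun hf hA z v
    rw [e2]
    have h1 := Complex.reCLM.hasFDerivAt.comp x (((traceCLM n).restrictScalars ℝ).hasFDerivAt.comp x
      (hC.hasFDerivAt.mul' hM.hasFDerivAt))
    have h2 := congrArg (fun L : (ι → ℝ) →L[ℝ] ℝ => L w) h1.fderiv
    refine h2.trans ?_
    rw [eR, ← hM', ← Complex.add_re, ← Matrix.trace_add]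
    rfl
  · exact (Complex.abs_re_le_norm _).trans (hRle _)

end TraceFunction

/-! ### The suprema `γ₀`, `γ₁`, `γ₂` as operator bounds. -/

section Sup

variable {ι : Type*} [Fintype ι] [DecidableEq ι] {n : ℕ}
  {A : (ι → ℝ) → Matrix (Fin n) (Fin n) ℂ}

/-- The Euclidean norm of a vector. -/
def l2 (v : ι → ℝ) : ℝ := √(∑ i, v i ^ 2)

theorem l2_nonneg (v : ι → ℝ) : 0 ≤ l2 v := Real.sqrt_nonneg _

theorem l2_sq (v : ι → ℝ) : l2 v ^ 2 = ∑ i, v i ^ 2 := Real.sq_sqrt (by positivity)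

theorem abs_le_l2 (v : ι → ℝ) (i : ι) : |v i| ≤ l2 v := by
  rw [← Real.sqrt_sq_eq_abs]
  exact Real.sqrt_le_sqrt (Finset.single_le_sum (f := fun i => v i ^ 2) (fun i _ => sq_nonneg _)
    (Finset.mem_univ i))

theorem eq_zero_of_l2_eq_zero {v : ι → ℝ} (h : l2 v = 0) : v = 0 := by
  ext i
  exact abs_nonpos_iff.1 (h ▸ abs_le_l2 v i)

theorem hsNorm_zero : hsNorm (0 : Matrix (Fin n) (Fin n) ℂ) = 0 := by simp [hsNorm]

theorem mem_sphereR {v : ι → ℝ} (h : l2 v ≠ 0) :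
    (fun u => ((v u / l2 v : ℝ) : ℂ)) ∈ sphereR ι := by
  simp only [sphereR, Set.mem_ofPred_eq, Complex.norm_real, Real.norm_eq_abs, sq_abs, div_pow]
  rw [← Finset.sum_div, ← l2_sq, div_self (pow_ne_zero 2 h)]

theorem exists_mem_sphereS {M : Matrix (Fin n) (Fin n) ℂ} (h : hsNorm M ≠ 0) :
    ∃ β ∈ sphereS n, ∑ i, ∑ j, β i j * M i j = hsNorm M := by
  refine ⟨Matrix.of fun i j => star (M i j) / (hsNorm M : ℂ), ?_, ?_⟩
  · simp only [sphereS, Set.mem_ofPred_eq, Matrix.of_apply, norm_div, norm_star, Complex.norm_real,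
      Real.norm_eq_abs, div_pow, sq_abs]
    simp_rw [← Finset.sum_div]
    rw [← hsNorm_sq, div_self (pow_ne_zero 2 h)]
  · simp only [Matrix.of_apply, div_mul_eq_mul_div]
    simp_rw [← Finset.sum_div]
    rw [div_eq_iff (by exact_mod_cast h), ← sq]
    rw_mod_cast [hsNorm_sq]
    push_cast
    refine Finset.sum_congr rfl fun i _ => Finset.sum_congr rfl fun j _ => ?_
    exact Complex.conj_mul' _

theorem sum_comm_four {κ : Type*} [Fintype κ] (F : ι → ι → κ → κ → ℂ) :
    ∑ u, ∑ v, ∑ i, ∑ j, F u v i j = ∑ i, ∑ j, ∑ u, ∑ v, F u v i j := by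
  calc ∑ u, ∑ v, ∑ i, ∑ j, F u v i j = ∑ u, ∑ i, ∑ v, ∑ j, F u v i j :=
        Finset.sum_congr rfl fun u _ => Finset.sum_comm
    _ = ∑ i, ∑ u, ∑ v, ∑ j, F u v i j := Finset.sum_comm
    _ = ∑ i, ∑ u, ∑ j, ∑ v, F u v i j := Finset.sum_congr rfl fun i _ =>
        Finset.sum_congr rfl fun u _ => Finset.sum_comm
    _ = ∑ i, ∑ j, ∑ u, ∑ v, F u v i j := Finset.sum_congr rfl fun i _ => Finset.sum_comm

theorem fderiv_apply_eq_sum {F : Type*} [NormedAddCommGroup F] [NormedSpace ℝ F]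
    (L : (ι → ℝ) →L[ℝ] F) (v : ι → ℝ) : L v = ∑ u, v u • L (Pi.single u 1) := by
  conv_lhs => rw [pi_eq_sum_univ' v]
  rw [map_sum]
  exact Finset.sum_congr rfl fun u _ => by rw [map_smul]

theorem norm_le_one_of_sum_sq {κ : Type*} [Fintype κ] {x : κ → ℂ} (h : ∑ k, ‖x k‖ ^ 2 = 1) (k : κ) :
    ‖x k‖ ≤ 1 := by
  have := Finset.single_le_sum (f := fun k => ‖x k‖ ^ 2) (fun _ _ => by positivity)
    (Finset.mem_univ k)
  rw [h] at this
  exact (sq_le_one_iff₀ (norm_nonneg _)).1 this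

theorem norm_le_one_of_mem_sphereS {β : Matrix (Fin n) (Fin n) ℂ} (h : β ∈ sphereS n)
    (i j : Fin n) : ‖β i j‖ ≤ 1 := by
  refine norm_le_one_of_sum_sq (x := fun p : Fin n × Fin n => β p.1 p.2) ?_ (i, j)
  rw [Fintype.sum_prod_type]
  exact h

/-- Coordinates of unit vectors are at most `1`. Finiteness at each point, here and for `γ₀` and
`γ₂`, allows the estimates to be done with real numbers. -/
theorem γ₁_ne_top (A : (ι → ℝ) → Matrix (Fin n) (Fin n) ℂ) (x : ι → ℝ) : γ₁ A x ≠ ⊤ := by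
  refine ne_top_of_le_ne_top
    (ENNReal.ofReal_ne_top (r := ∑ u, ∑ i, ∑ j, ‖pd u (fun y => A y i j) x‖)) ?_
  refine iSup₂_le fun α hα => iSup₂_le fun β hβ => ?_
  rw [← ofReal_norm]
  refine ENNReal.ofReal_le_ofReal ?_
  refine norm_sum_le_of_le _ fun u _ => norm_sum_le_of_le _ fun i _ =>
    norm_sum_le_of_le _ fun j _ => ?_
  rw [norm_mul, norm_mul]
  have h1 := norm_le_one_of_sum_sq hα u
  have h2 := norm_le_one_of_mem_sphereS hβ i j
  exact mul_le_of_le_one_left (norm_nonneg _) (mul_le_one₀ h1 (norm_nonneg _) h2)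

theorem γ₂_ne_top (A : (ι → ℝ) → Matrix (Fin n) (Fin n) ℂ) (x : ι → ℝ) : γ₂ A x ≠ ⊤ := by
  refine ne_top_of_le_ne_top
    (ENNReal.ofReal_ne_top (r := ∑ u, ∑ v, ∑ i, ∑ j, ‖pd u (pd v fun y => A y i j) x‖)) ?_
  refine iSup₂_le fun α hα => iSup₂_le fun α' hα' => iSup₂_le fun β hβ => ?_
  rw [← ofReal_norm]
  refine ENNReal.ofReal_le_ofReal ?_
  refine norm_sum_le_of_le _ fun u _ => norm_sum_le_of_le _ fun v _ =>
    norm_sum_le_of_le _ fun i _ => norm_sum_le_of_le _ fun j _ => ?_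
  rw [norm_mul, norm_mul, norm_mul]
  have h1 := norm_le_one_of_sum_sq hα u
  have h1' := norm_le_one_of_sum_sq hα' v
  have h2 := norm_le_one_of_mem_sphereS hβ i j
  exact mul_le_of_le_one_left (norm_nonneg _) (mul_le_one₀ (mul_le_one₀ h1 (norm_nonneg _) h1')
    (norm_nonneg _) h2)

theorem γ₀_ne_top (A : (ι → ℝ) → Matrix (Fin n) (Fin n) ℂ) (x : ι → ℝ) : γ₀ A x ≠ ⊤ := by
  refine ne_top_of_le_ne_top
    (ENNReal.ofReal_ne_top (r := ∑ u, √((pdMatrix u A x).rank : ℝ) * hsNorm (pdMatrix u A x))) ?_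
  refine iSup_le fun u => iSup₂_le fun B hB => ?_
  rw [← ofReal_norm]
  refine ENNReal.ofReal_le_ofReal ((norm_trace_mul_le_rank _ _).trans ?_)
  rw [hB, mul_one]
  exact Finset.single_le_sum
    (f := fun u => √((pdMatrix u A x).rank : ℝ) * hsNorm (pdMatrix u A x))
    (fun u _ => mul_nonneg (Real.sqrt_nonneg _) (hsNorm_nonneg _)) (Finset.mem_univ u)

/-- Duality: test the supremum with `α` the normalised `v` and `β` the normalised entrywise
conjugate of the derivative. -/
theorem hsNorm_dMat_le (x v : ι → ℝ) : hsNorm (dMat A x v) ≤ (γ₁ A x).toReal * l2 v := by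
  by_cases hv : l2 v = 0
  · rw [eq_zero_of_l2_eq_zero hv]
    have : dMat A x 0 = 0 := by ext i j; simp [dMat]
    rw [this, hsNorm_zero]
    exact mul_nonneg ENNReal.toReal_nonneg (l2_nonneg _)
  by_cases hM : hsNorm (dMat A x v) = 0
  · rw [hM]; exact mul_nonneg ENNReal.toReal_nonneg (l2_nonneg _)
  have hv0 : 0 < l2 v := (l2_nonneg v).lt_of_ne' hv
  rw [← div_le_iff₀ hv0, ← ENNReal.ofReal_le_iff_le_toReal (γ₁_ne_top A x)]
  obtain ⟨β, hβ, hsum⟩ := exists_mem_sphereS hM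
  refine le_trans (le_of_eq ?_)
    (le_iSup₂_of_le _ (mem_sphereR hv) (le_iSup₂_of_le β hβ le_rfl))
  rw [← ofReal_norm]
  congr 1
  have e : ∑ u, ∑ i, ∑ j, ((v u / l2 v : ℝ) : ℂ) *
      β i j * pd u (fun y => A y i j) x = ((hsNorm (dMat A x v) / l2 v : ℝ) : ℂ) := by
    push_cast
    rw [← hsum, Finset.sum_div, Finset.sum_comm]
    refine Finset.sum_congr rfl fun i _ => ?_
    rw [Finset.sum_div, Finset.sum_comm]
    refine Finset.sum_congr rfl fun j _ => ?_
    have : dMat A x v i j = ∑ u, v u • pd u (fun y => A y i j) x := fderiv_apply_eq_sum _ v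
    rw [this, Finset.mul_sum, Finset.sum_div]
    refine Finset.sum_congr rfl fun u _ => ?_
    rw [Complex.real_smul]; ring
  rw [e, Complex.norm_real, Real.norm_of_nonneg (div_nonneg (hsNorm_nonneg _) hv0.le)]

theorem pd_pd_eq (hA : ∀ i j, ContDiff ℝ 2 fun x => A x i j) (x : ι → ℝ) (u v : ι) (i j : Fin n) :
    pd u (pd v fun y => A y i j) x =
      fderiv ℝ (fderiv ℝ fun y => A y i j) x (Pi.single u 1) (Pi.single v 1) := by
  have hd : DifferentiableAt ℝ (fderiv ℝ fun z => A z i j) x :=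
    ((hA i j).fderiv_right (m := 1) (by norm_num)).differentiable one_ne_zero x
  have := (((ContinuousLinearMap.apply ℝ ℂ (Pi.single v (1 : ℝ) : ι → ℝ)).hasFDerivAt.comp x
    hd.hasFDerivAt)).fderiv
  exact congrArg (fun L : (ι → ℝ) →L[ℝ] ℂ => L (Pi.single u 1)) this

theorem hsNorm_ddMat_le (hA : ∀ i j, ContDiff ℝ 2 fun x => A x i j) (x w v : ι → ℝ) :
    hsNorm (ddMat A x w v) ≤ (γ₂ A x).toReal * (l2 w * l2 v) := by
  have hR : 0 ≤ (γ₂ A x).toReal * (l2 w * l2 v) :=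
    mul_nonneg ENNReal.toReal_nonneg (mul_nonneg (l2_nonneg _) (l2_nonneg _))
  by_cases hM : hsNorm (ddMat A x w v) = 0
  · rw [hM]; exact hR
  by_cases hv : l2 v = 0
  · refine absurd ?_ hM
    rw [eq_zero_of_l2_eq_zero hv]
    have : ddMat A x w 0 = 0 := by ext i j; simp [ddMat]
    rw [this, hsNorm_zero]
  by_cases hw : l2 w = 0
  · refine absurd ?_ hM
    rw [eq_zero_of_l2_eq_zero hw]
    have : ddMat A x 0 v = 0 := by ext i j; simp [ddMat]
    rw [this, hsNorm_zero]
  have hv0 : 0 < l2 v := (l2_nonneg v).lt_of_ne' hv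
  have hw0 : 0 < l2 w := (l2_nonneg w).lt_of_ne' hw
  rw [← div_le_iff₀ (mul_pos hw0 hv0), ← ENNReal.ofReal_le_iff_le_toReal (γ₂_ne_top A x)]
  obtain ⟨β, hβ, hsum⟩ := exists_mem_sphereS hM
  refine le_trans (le_of_eq ?_) (le_iSup₂_of_le _ (mem_sphereR hw)
    (le_iSup₂_of_le _ (mem_sphereR hv) (le_iSup₂_of_le β hβ le_rfl)))
  rw [← ofReal_norm]
  congr 1
  have e : ∑ u, ∑ u', ∑ i, ∑ j, ((w u / l2 w : ℝ) : ℂ) * ((v u' / l2 v : ℝ) : ℂ) *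
      β i j * pd u (pd u' fun y => A y i j) x =
      ((hsNorm (ddMat A x w v) / (l2 w * l2 v) : ℝ) : ℂ) := by
    push_cast
    rw [← hsum, Finset.sum_div]
    rw [sum_comm_four]
    refine Finset.sum_congr rfl fun i _ => ?_
    rw [Finset.sum_div]
    refine Finset.sum_congr rfl fun j _ => ?_
    have : ddMat A x w v i j = ∑ u, ∑ u', w u • v u' • pd u (pd u' fun y => A y i j) x := by
      have h1 : ddMat A x w v i j = fderiv ℝ (fderiv ℝ fun y => A y i j) x w v := rfl
      rw [h1, fderiv_apply_eq_sum _ w, sum_apply]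
      refine Finset.sum_congr rfl fun u _ => ?_
      rw [smul_apply, fderiv_apply_eq_sum _ v, Finset.smul_sum]
      exact Finset.sum_congr rfl fun u' _ => by rw [pd_pd_eq hA]
    rw [this, Finset.mul_sum, Finset.sum_div]
    refine Finset.sum_congr rfl fun u _ => ?_
    rw [Finset.mul_sum, Finset.sum_div]
    refine Finset.sum_congr rfl fun u' _ => ?_
    rw [Complex.real_smul, Complex.real_smul]; ring
  rw [e, Complex.norm_real,
    Real.norm_of_nonneg (div_nonneg (hsNorm_nonneg _) (mul_pos hw0 hv0).le)]

theorem opNorm_smul (c : ℂ) (C : Matrix (Fin n) (Fin n) ℂ) : opNorm (c • C) = ‖c‖ * opNorm C := by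
  rw [opNorm, map_smul, norm_smul, opNorm]

theorem norm_trace_mul_dMat_single_le (C : Matrix (Fin n) (Fin n) ℂ) (x : ι → ℝ) (u : ι) :
    ‖(C * dMat A x (Pi.single u 1)).trace‖ ≤ opNorm C * (γ₀ A x).toReal := by
  by_cases hC : opNorm C = 0
  · have h := norm_trace_mul_le_rank C (dMat A x (Pi.single u 1))
    rw [hC] at h ⊢
    simpa using h
  have hC0 : 0 < opNorm C := (opNorm_nonneg C).lt_of_ne' hC
  rw [← div_le_iff₀' hC0, ← ENNReal.ofReal_le_iff_le_toReal (γ₀_ne_top A x)]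
  refine le_trans (le_of_eq ?_) (le_iSup_of_le u
    (le_iSup₂_of_le (((opNorm C)⁻¹ : ℂ) • C) ?_ le_rfl))
  · rw [← ofReal_norm, Matrix.smul_mul, Matrix.trace_smul, norm_smul, norm_inv,
      Complex.norm_real, Real.norm_of_nonneg hC0.le, div_eq_inv_mul]
    rfl
  · rw [opNorm_smul, norm_inv, Complex.norm_real, Real.norm_of_nonneg hC0.le, inv_mul_cancel₀ hC]

end Sup

end

/-! ### Chain rule for the transport map and rank bounds almost everywhere. -/

section

variable {ι : Type*} [Fintype ι] [DecidableEq ι] {n : ℕ}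

section Chain

variable {F : Type*} [NormedAddCommGroup F] [NormedSpace ℝ F] {Φ : (ι → ℝ) → ι → ℝ}

theorem fderiv_comp_apply {a : (ι → ℝ) → F} (ha : ContDiff ℝ 2 a) (hΦ : ContDiff ℝ 2 Φ)
    (y α : ι → ℝ) :
    fderiv ℝ (fun y => a (Φ y)) y α = fderiv ℝ a (Φ y) (fderiv ℝ Φ y α) := by
  have h := fderiv_comp y (ha.differentiable two_ne_zero (Φ y)) (hΦ.differentiable two_ne_zero y)
  exact congrArg (fun L : (ι → ℝ) →L[ℝ] F => L α) h

theorem fderiv_fderiv_apply {G : Type*} [NormedAddCommGroup G] [NormedSpace ℝ G] {a : G → F}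
    (ha : ContDiff ℝ 2 a) (y α β : G) :
    fderiv ℝ (fderiv ℝ a) y α β = fderiv ℝ (fun z => fderiv ℝ a z β) y α := by
  have hd : DifferentiableAt ℝ (fderiv ℝ a) y :=
    (ha.fderiv_right (m := 1) (by norm_num)).differentiable one_ne_zero y
  have := (((ContinuousLinearMap.apply ℝ F β).hasFDerivAt.comp y hd.hasFDerivAt)).fderiv
  exact (congrArg (fun L : G →L[ℝ] F => L α) this).symm

theorem fderiv_fderiv_comp_apply {a : (ι → ℝ) → F} (ha : ContDiff ℝ 2 a) (hΦ : ContDiff ℝ 2 Φ)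
    (y α β : ι → ℝ) :
    fderiv ℝ (fderiv ℝ fun y => a (Φ y)) y α β =
      fderiv ℝ (fderiv ℝ a) (Φ y) (fderiv ℝ Φ y α) (fderiv ℝ Φ y β) +
        fderiv ℝ a (Φ y) (fderiv ℝ (fderiv ℝ Φ) y α β) := by
  rw [fderiv_fderiv_apply (a := fun y => a (Φ y)) (ha.comp hΦ), fderiv_fderiv_apply hΦ]
  have e : (fun z => fderiv ℝ (fun y => a (Φ y)) z β) =
      fun z => fderiv ℝ a (Φ z) (fderiv ℝ Φ z β) := funext fun z => fderiv_comp_apply ha hΦ z β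
  have h1 : HasFDerivAt (fun z => fderiv ℝ a (Φ z)) _ y :=
    ((ha.fderiv_right (m := 1) (by norm_num)).differentiable one_ne_zero (Φ y)).hasFDerivAt.comp y
      (hΦ.differentiable two_ne_zero y).hasFDerivAt
  have h2 : DifferentiableAt ℝ (fun z => fderiv ℝ Φ z β) y :=
    (((hΦ.fderiv_right (m := 1) (by norm_num)).clm_apply contDiff_const).differentiable
      one_ne_zero y)
  have h3 := (h1.clm_apply h2.hasFDerivAt).fderiv
  rw [e]
  refine (congrArg (fun L : (ι → ℝ) →L[ℝ] F => L α) h3).trans ?_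
  simp [add_comm]

end Chain

section Tangent

variable {A : (ι → ℝ) → Matrix (Fin n) (Fin n) ℂ} {Φ : (ι → ℝ) → ι → ℝ}

/-- Rank bounds on the first two derivatives of `A` at `Φ y` along the derivative of `Φ`. -/
def RankTangentAt (A : (ι → ℝ) → Matrix (Fin n) (Fin n) ℂ) (Φ : (ι → ℝ) → ι → ℝ) (y : ι → ℝ) :
    Prop :=
  (∀ α, (dMat A (Φ y) (fderiv ℝ Φ y α)).rank ≤ 2 * (A (Φ y)).rank) ∧
    ∀ α β, (ddMat A (Φ y) (fderiv ℝ Φ y α) (fderiv ℝ Φ y β)).rank ≤ 4 * (A (Φ y)).rank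

theorem dMat_comp (hA : ∀ i j, ContDiff ℝ 2 fun x => A x i j) (hΦ : ContDiff ℝ 2 Φ) (y α : ι → ℝ) :
    dMat (fun y => A (Φ y)) y α = dMat A (Φ y) (fderiv ℝ Φ y α) := by
  ext i j
  exact fderiv_comp_apply (hA i j) hΦ y α

theorem ddMat_comp (hA : ∀ i j, ContDiff ℝ 2 fun x => A x i j) (hΦ : ContDiff ℝ 2 Φ)
    (y α β : ι → ℝ) :
    ddMat (fun y => A (Φ y)) y α β = ddMat A (Φ y) (fderiv ℝ Φ y α) (fderiv ℝ Φ y β) +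
      dMat A (Φ y) (fderiv ℝ (fderiv ℝ Φ) y α β) := by
  ext i j
  exact fderiv_fderiv_comp_apply (hA i j) hΦ y α β

theorem ddMat_polarization (hA : ∀ i j, ContDiff ℝ 2 fun x => A x i j) (x v w : ι → ℝ) :
    (4 : ℂ) • ddMat A x v w = ddMat A x (v + w) (v + w) + (-1 : ℂ) • ddMat A x (v - w) (v - w) := by
  ext i j
  have hs : fderiv ℝ (fderiv ℝ fun y => A y i j) x w v =
      fderiv ℝ (fderiv ℝ fun y => A y i j) x v w :=
    (((hA i j).contDiffAt (x := x)).isSymmSndFDerivAt (by simp)) w v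
  simp only [ddMat, Matrix.smul_apply, Matrix.add_apply, Matrix.of_apply, map_add, map_sub,
    add_apply, sub_apply, hs, smul_eq_mul]
  ring

/-- The compression statement is applied to `A ∘ Φ`. Its second derivative contains an unwanted
first derivative of `A` along `D²Φ`; by `hΦ2` this is a derivative along the range of `DΦ`, and the
first order compression kills it. -/
theorem ae_rankTangentAt (hA : ∀ i j, ContDiff ℝ 2 fun x => A x i j) (hΦ : ContDiff ℝ 2 Φ)
    (hΦ2 : ∀ᵐ y ∂(stdG ι), ∀ α, ∃ α', fderiv ℝ (fderiv ℝ Φ) y α α = fderiv ℝ Φ y α') :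
    ∀ᵐ y ∂(stdG ι), RankTangentAt A Φ y := by
  filter_upwards [ae_compression (B := fun y => A (Φ y)) fun i j => (hA i j).comp hΦ, hΦ2]
    with y hy hy2
  obtain ⟨C, hC⟩ := exists_generalized_inverse (A (Φ y))
  obtain ⟨h1, h2⟩ := hy C hC
  simp only [dMat_comp hA hΦ, ddMat_comp hA hΦ] at h1 h2
  have h3 : ∀ α, ((1 - A (Φ y) * C) * ddMat A (Φ y) (fderiv ℝ Φ y α) (fderiv ℝ Φ y α) *
      (1 - C * A (Φ y))).rank ≤ (A (Φ y)).rank := by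
    intro α
    have h := h2 α
    obtain ⟨α', hα'⟩ := hy2 α
    rwa [hα', mul_add, add_mul, h1 α', add_zero] at h
  refine ⟨fun α => ?_, fun α β => ?_⟩
  · refine (rank_le_of_compression (B := A (Φ y)) (C := C)).trans ?_
    rw [h1 α, Matrix.rank_zero, add_zero]
  · have e : ddMat A (Φ y) (fderiv ℝ Φ y α) (fderiv ℝ Φ y β) =
        (1 / 4 : ℂ) • ((4 : ℂ) • ddMat A (Φ y) (fderiv ℝ Φ y α) (fderiv ℝ Φ y β)) := by
      rw [smul_smul]; norm_num
    refine (rank_le_of_compression (B := A (Φ y)) (C := C)).trans ?_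
    -- `2` from the two sides of the compression, and `1 + 1` from polarization, since only diagonal
    -- second derivatives are controlled directly.
    rw [show 4 * (A (Φ y)).rank = 2 * (A (Φ y)).rank + ((A (Φ y)).rank + (A (Φ y)).rank) by ring]
    refine add_le_add le_rfl ?_
    rw [e, ddMat_polarization hA, Matrix.mul_smul, Matrix.smul_mul]
    refine (matrix_rank_smul_le _ _).trans ?_
    rw [mul_add, add_mul, Matrix.mul_smul, Matrix.smul_mul, ← map_add, ← map_sub]
    exact (matrix_rank_add_le _ _).trans
      (add_le_add (h3 _) ((matrix_rank_smul_le _ _).trans (h3 _)))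

end Tangent

/-! ### Pointwise bounds on the gradient and the Hessian. -/

section Pointwise

variable {A : (ι → ℝ) → Matrix (Fin n) (Fin n) ℂ} {f : ℂ → ℂ}

/-- `η₀` as a real number. -/
def η₀r (f : ℂ → ℂ) (A : (ι → ℝ) → Matrix (Fin n) (Fin n) ℂ) (x : ι → ℝ) : ℝ :=
  (γ₀ A x).toReal * f₁ f (opNorm (A x))

/-- `η₁` as a real number. -/
def η₁r (f : ℂ → ℂ) (A : (ι → ℝ) → Matrix (Fin n) (Fin n) ℂ) (x : ι → ℝ) : ℝ :=
  (γ₁ A x).toReal * f₁ f (opNorm (A x)) * √((A x).rank : ℝ)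

/-- `η₂` as a real number. -/
def η₂r (f : ℂ → ℂ) (A : (ι → ℝ) → Matrix (Fin n) (Fin n) ℂ) (x : ι → ℝ) : ℝ :=
  (γ₂ A x).toReal * f₁ f (opNorm (A x)) * √((A x).rank : ℝ) +
    (γ₁ A x).toReal ^ 2 * f₂ f (opNorm (A x))

theorem f₁_opNorm_nonneg (B : Matrix (Fin n) (Fin n) ℂ) : 0 ≤ f₁ f (opNorm B) :=
  f₁_nonneg (opNorm_nonneg B)

theorem f₂_opNorm_nonneg (B : Matrix (Fin n) (Fin n) ℂ) : 0 ≤ f₂ f (opNorm B) :=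
  f₂_nonneg (opNorm_nonneg B)

theorem η₀r_nonneg (x : ι → ℝ) : 0 ≤ η₀r f A x :=
  mul_nonneg ENNReal.toReal_nonneg (f₁_opNorm_nonneg _)

theorem η₁r_nonneg (x : ι → ℝ) : 0 ≤ η₁r f A x :=
  mul_nonneg (mul_nonneg ENNReal.toReal_nonneg (f₁_opNorm_nonneg _)) (Real.sqrt_nonneg _)

theorem η₂r_nonneg (x : ι → ℝ) : 0 ≤ η₂r f A x :=
  add_nonneg (mul_nonneg (mul_nonneg ENNReal.toReal_nonneg (f₁_opNorm_nonneg _))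
    (Real.sqrt_nonneg _)) (mul_nonneg (sq_nonneg _) (f₂_opNorm_nonneg _))

theorem ofReal_η₀r (x : ι → ℝ) : ENNReal.ofReal (η₀r f A x) = η₀ f A x := by
  rw [η₀r, ENNReal.ofReal_mul ENNReal.toReal_nonneg, ENNReal.ofReal_toReal (γ₀_ne_top A x), η₀]

theorem ofReal_η₁r (x : ι → ℝ) : ENNReal.ofReal (η₁r f A x) = η₁ f A x := by
  rw [η₁r, ENNReal.ofReal_mul (mul_nonneg ENNReal.toReal_nonneg (f₁_opNorm_nonneg _)),
    ENNReal.ofReal_mul ENNReal.toReal_nonneg, ENNReal.ofReal_toReal (γ₁_ne_top A x), η₁]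

theorem ofReal_η₂r (x : ι → ℝ) : ENNReal.ofReal (η₂r f A x) = η₂ f A x := by
  rw [η₂r, ENNReal.ofReal_add (mul_nonneg (mul_nonneg ENNReal.toReal_nonneg (f₁_opNorm_nonneg _))
    (Real.sqrt_nonneg _)) (mul_nonneg (sq_nonneg _) (f₂_opNorm_nonneg _)),
    ENNReal.ofReal_mul (mul_nonneg ENNReal.toReal_nonneg (f₁_opNorm_nonneg _)),
    ENNReal.ofReal_mul ENNReal.toReal_nonneg, ENNReal.ofReal_toReal (γ₂_ne_top A x),
    ENNReal.ofReal_mul (sq_nonneg _), ENNReal.ofReal_pow ENNReal.toReal_nonneg,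
    ENNReal.ofReal_toReal (γ₁_ne_top A x), η₂]

theorem sqrt_mul_natCast_le {a k : ℕ} {c : ℝ} (hc : 0 ≤ c) {r : ℕ} (h : r ≤ a * k)
    (hac : (a : ℝ) = c ^ 2) : √(r : ℝ) ≤ c * √(k : ℝ) := by
  refine (Real.sqrt_le_sqrt (Nat.cast_le.2 h)).trans (le_of_eq ?_)
  rw [Nat.cast_mul, hac, Real.sqrt_mul (sq_nonneg c), Real.sqrt_sq hc]

theorem abs_fderiv_trFun_le (hf : Differentiable ℂ f) (hA : ∀ i j, ContDiff ℝ 2 fun x => A x i j)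
    {x v : ι → ℝ} (hr : (dMat A x v).rank ≤ 2 * (A x).rank) :
    |fderiv ℝ (trFun f A) x v| ≤ √2 * η₁r f A x * l2 v := by
  rw [fderiv_trFun hf hA]
  refine (Complex.abs_re_le_norm _).trans ((norm_trace_mul_le_rank _ _).trans ?_)
  have h1 : √((dMat A x v).rank : ℝ) ≤ √2 * √((A x).rank : ℝ) :=
    sqrt_mul_natCast_le (Real.sqrt_nonneg 2) hr (by rw [Real.sq_sqrt] <;> norm_num)
  calc √((dMat A x v).rank : ℝ) * opNorm (matrixDeriv f (A x)) * hsNorm (dMat A x v)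
      ≤ (√2 * √((A x).rank : ℝ)) * f₁ f (opNorm (A x)) * ((γ₁ A x).toReal * l2 v) :=
        mul_le_mul (mul_le_mul h1 (opNorm_matrixDeriv_le hf _) (opNorm_nonneg _) (by positivity))
          (hsNorm_dMat_le x v) (hsNorm_nonneg _)
          (mul_nonneg (by positivity) (f₁_opNorm_nonneg _))
    _ = √2 * η₁r f A x * l2 v := by rw [η₁r]; ring

theorem abs_fderiv_fderiv_trFun_le (hf : Differentiable ℂ f)
    (hA : ∀ i j, ContDiff ℝ 2 fun x => A x i j) {x w v : ι → ℝ}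
    (hr : (ddMat A x w v).rank ≤ 4 * (A x).rank) :
    |fderiv ℝ (fderiv ℝ (trFun f A)) x w v| ≤ 2 * η₂r f A x * (l2 w * l2 v) := by
  obtain ⟨ρ, h, hρ⟩ := fderiv_fderiv_trFun hf hA x w v
  have hf2 := f₂_opNorm_nonneg (f := f) (A x)
  have hρ2 : |ρ| ≤ (γ₁ A x).toReal ^ 2 * f₂ f (opNorm (A x)) * (l2 w * l2 v) := by
    refine hρ.trans ((mul_le_mul_of_nonneg_left (mul_le_mul (hsNorm_dMat_le x w)
      (hsNorm_dMat_le x v) (hsNorm_nonneg _)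
      (mul_nonneg ENNReal.toReal_nonneg (l2_nonneg _))) hf2).trans (le_of_eq ?_))
    ring
  have h1 : √((ddMat A x w v).rank : ℝ) ≤ 2 * √((A x).rank : ℝ) :=
    sqrt_mul_natCast_le two_pos.le hr (by norm_num)
  have h2 : |(matrixDeriv f (A x) * ddMat A x w v).trace.re| ≤
      2 * ((γ₂ A x).toReal * f₁ f (opNorm (A x)) * √((A x).rank : ℝ)) * (l2 w * l2 v) := by
    refine (Complex.abs_re_le_norm _).trans ((norm_trace_mul_le_rank _ _).trans ?_)
    calc √((ddMat A x w v).rank : ℝ) * opNorm (matrixDeriv f (A x)) * hsNorm (ddMat A x w v)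
        ≤ (2 * √((A x).rank : ℝ)) * f₁ f (opNorm (A x)) * ((γ₂ A x).toReal * (l2 w * l2 v)) :=
          mul_le_mul (mul_le_mul h1 (opNorm_matrixDeriv_le hf _) (opNorm_nonneg _) (by positivity))
            (hsNorm_ddMat_le hA x w v) (hsNorm_nonneg _)
            (mul_nonneg (by positivity) (f₁_opNorm_nonneg _))
      _ = _ := by ring
  have h3 : 0 ≤ (γ₁ A x).toReal ^ 2 * f₂ f (opNorm (A x)) * (l2 w * l2 v) :=
    mul_nonneg (mul_nonneg (sq_nonneg _) hf2) (mul_nonneg (l2_nonneg _) (l2_nonneg _))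
  rw [h]
  refine (abs_add_le _ _).trans ?_
  -- Only the first term needs the factor `2`; spending it on both reproduces `η₂`.
  calc _ ≤ 2 * ((γ₂ A x).toReal * f₁ f (opNorm (A x)) * √((A x).rank : ℝ)) * (l2 w * l2 v) +
        2 * ((γ₁ A x).toReal ^ 2 * f₂ f (opNorm (A x)) * (l2 w * l2 v)) := by linarith
    _ = _ := by rw [η₂r]; ring

theorem abs_fderiv_trFun_single_le (hf : Differentiable ℂ f)
    (hA : ∀ i j, ContDiff ℝ 2 fun x => A x i j) (x : ι → ℝ) (u : ι) :
    |fderiv ℝ (trFun f A) x (Pi.single u 1)| ≤ η₀r f A x := by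
  rw [fderiv_trFun hf hA, η₀r, mul_comm]
  exact (Complex.abs_re_le_norm _).trans ((norm_trace_mul_dMat_single_le _ _ _).trans
    (mul_le_mul_of_nonneg_right (opNorm_matrixDeriv_le hf _) ENNReal.toReal_nonneg))

theorem l2_eq_norm (v : ι → ℝ) : l2 v = ‖WithLp.toLp 2 v‖ := by
  rw [EuclideanSpace.norm_eq, l2]
  simp

theorem l2_add_le (v w : ι → ℝ) : l2 (v + w) ≤ l2 v + l2 w := by
  rw [l2_eq_norm, l2_eq_norm, l2_eq_norm, WithLp.toLp_add]
  exact norm_add_le _ _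

/-- A linear functional bounded by `c` on the Euclidean unit ball has Euclidean norm at most `c`. -/
theorem l2_le_of_functional {L : (ι → ℝ) →L[ℝ] ℝ} {c : ℝ} (hc : 0 ≤ c)
    (h : ∀ α, |L α| ≤ c * l2 α) : l2 (fun i => L (Pi.single i 1)) ≤ c := by
  set a : ι → ℝ := fun i => L (Pi.single i 1) with ha
  by_cases h0 : l2 a = 0
  · rw [h0]; exact hc
  have h1 : l2 a ^ 2 = L a := by
    rw [l2_sq, fderiv_apply_eq_sum L a]
    exact Finset.sum_congr rfl fun i _ => by rw [smul_eq_mul, sq]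
  have h2 := (le_abs_self _).trans (h a)
  rw [← h1, sq] at h2
  exact le_of_mul_le_mul_right h2 ((l2_nonneg a).lt_of_ne' h0)

variable {Φ : (ι → ℝ) → ι → ℝ} {c : ℝ}

theorem l2_grad_le (hf : Differentiable ℂ f) (hA : ∀ i j, ContDiff ℝ 2 fun x => A x i j)
    (hΦ : ContDiff ℝ 2 Φ) (hc : 0 ≤ c) {z : ι → ℝ} (hJ : ∀ α, l2 (fderiv ℝ Φ z α) ≤ c * l2 α)
    (hz : RankTangentAt A Φ z) :
    l2 (fun j => par j (fun y => trFun f A (Φ y)) z) ≤ √2 * c * η₁r f A (Φ z) := by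
  have hη := η₁r_nonneg (f := f) (A := A) (Φ z)
  refine l2_le_of_functional (by positivity) fun α => ?_
  rw [fderiv_comp_apply (contDiff_trFun hf hA) hΦ]
  refine (abs_fderiv_trFun_le hf hA (hz.1 α)).trans ?_
  calc _ ≤ √2 * η₁r f A (Φ z) * (c * l2 α) := mul_le_mul_of_nonneg_left (hJ α) (by positivity)
    _ = _ := by ring

theorem par_par_eq {h : (ι → ℝ) → ℝ} (hh : ContDiff ℝ 2 h) (y : ι → ℝ) (i j : ι) :
    par i (par j h) y = fderiv ℝ (fderiv ℝ h) y (Pi.single i 1) (Pi.single j 1) :=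
  (fderiv_fderiv_apply hh y _ _).symm

theorem hessGrad_eq {h : (ι → ℝ) → ℝ} (hh : ContDiff ℝ 2 h) (y z : ι → ℝ) :
    hessGrad h y z =
      l2 (fun i => fderiv ℝ (fderiv ℝ h) y (Pi.single i 1) fun j => par j h z) ^ 2 := by
  rw [l2_sq, hessGrad]
  refine Finset.sum_congr rfl fun i _ => ?_
  rw [fderiv_apply_eq_sum _ (fun j => par j h z)]
  congr 1
  refine Finset.sum_congr rfl fun j _ => ?_
  rw [par_par_eq hh, smul_eq_mul, mul_comm]

theorem l2_hess_le (hf : Differentiable ℂ f) (hA : ∀ i j, ContDiff ℝ 2 fun x => A x i j)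
    (hc : 0 ≤ c) {y : ι → ℝ} (hJ : ∀ α, l2 (fderiv ℝ Φ y α) ≤ c * l2 α)
    (hy : RankTangentAt A Φ y) (β : ι → ℝ) :
    l2 (fun i => fderiv ℝ (fderiv ℝ (trFun f A)) (Φ y) (fderiv ℝ Φ y (Pi.single i 1))
      (fderiv ℝ Φ y β)) ≤ 2 * c ^ 2 * η₂r f A (Φ y) * l2 β := by
  have hη := η₂r_nonneg (f := f) (A := A) (Φ y)
  have hβ := l2_nonneg β
  refine l2_le_of_functional (L := ((fderiv ℝ (fderiv ℝ (trFun f A)) (Φ y)).flip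
    (fderiv ℝ Φ y β)) ∘L fderiv ℝ Φ y) (by positivity) fun α => ?_
  refine (abs_fderiv_fderiv_trFun_le hf hA (hy.2 α β)).trans ?_
  have hα := l2_nonneg α
  calc _ ≤ 2 * η₂r f A (Φ y) * ((c * l2 α) * (c * l2 β)) :=
        mul_le_mul_of_nonneg_left (mul_le_mul (hJ α) (hJ β) (l2_nonneg _) (by positivity))
          (by positivity)
    _ = _ := by ring

/-- The pointwise bound on the product of the Hessian with the gradient. -/
theorem hessGrad_le (hf : Differentiable ℂ f) (hA : ∀ i j, ContDiff ℝ 2 fun x => A x i j)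
    (hΦ : ContDiff ℝ 2 Φ) (hc : 0 ≤ c) {y z : ι → ℝ}
    (hJy : ∀ α, l2 (fderiv ℝ Φ y α) ≤ c * l2 α) (hJz : ∀ α, l2 (fderiv ℝ Φ z α) ≤ c * l2 α)
    (hy : RankTangentAt A Φ y) (hz : RankTangentAt A Φ z) {D : ℝ}
    (hD : l2 (fun i => fderiv ℝ (trFun f A) (Φ y) (fderiv ℝ (fderiv ℝ Φ) y (Pi.single i 1)
      fun j => par j (fun y => trFun f A (Φ y)) z)) ≤ D) :
    hessGrad (fun y => trFun f A (Φ y)) y z ≤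
      (2 * √2 * c ^ 3 * (η₂r f A (Φ y) * η₁r f A (Φ z)) + D) ^ 2 := by
  have hg := contDiff_trFun hf hA
  rw [hessGrad_eq (h := fun y => trFun f A (Φ y)) (hg.comp hΦ)]
  refine pow_le_pow_left₀ (l2_nonneg _) ?_ 2
  simp only [fderiv_fderiv_comp_apply hg hΦ]
  refine (l2_add_le _ _).trans (add_le_add ?_ hD)
  refine (l2_hess_le hf hA hc hJy hy _).trans ?_
  have hη := η₂r_nonneg (f := f) (A := A) (Φ y)
  calc _ ≤ 2 * c ^ 2 * η₂r f A (Φ y) * (√2 * c * η₁r f A (Φ z)) :=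
        mul_le_mul_of_nonneg_left (l2_grad_le hf hA hΦ hc hJz hz) (by positivity)
    _ = _ := by ring

end Pointwise

end

/-! ### Hölder estimates and measurability. -/

section

section Holder

variable {α β : Type*} [MeasurableSpace α] [MeasurableSpace β] {μ : Measure α} {ν : Measure β}

theorem lintegral_mul_sq_rpow_le {a b : β → α} (ha : MeasurePreserving a ν μ)
    (hb : MeasurePreserving b ν μ) {F G : α → ℝ≥0∞} (hF : Measurable F) (hG : Measurable G) :
    (∫⁻ ω, (F (a ω) * G (b ω)) ^ (2 : ℝ) ∂ν) ^ (1 / 2 : ℝ) ≤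
      (∫⁻ y, F y ^ 4 ∂μ) ^ (1 / 4 : ℝ) * (∫⁻ y, G y ^ 4 ∂μ) ^ (1 / 4 : ℝ) := by
  have h := ENNReal.lintegral_mul_le_Lp_mul_Lq ν (p := 2) (q := 2) (by constructor <;> norm_num)
    (f := fun ω => F (a ω) ^ (2 : ℝ)) (g := fun ω => G (b ω) ^ (2 : ℝ))
    ((hF.comp ha.measurable).pow_const _).aemeasurable
    ((hG.comp hb.measurable).pow_const _).aemeasurable
  have e4 : ∀ t : ℝ≥0∞, (t ^ (2 : ℝ)) ^ (2 : ℝ) = t ^ 4 := fun t => by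
    rw [← ENNReal.rpow_mul, ← ENNReal.rpow_natCast]; norm_num
  simp only [Pi.mul_apply, e4] at h
  rw [ha.lintegral_comp (f := fun y => F y ^ 4) (hF.pow_const 4),
    hb.lintegral_comp (f := fun y => G y ^ 4) (hG.pow_const 4)] at h
  simp_rw [ENNReal.mul_rpow_of_nonneg _ _ (zero_le_two (α := ℝ))]
  refine (ENNReal.rpow_le_rpow h (by norm_num)).trans (le_of_eq ?_)
  rw [ENNReal.mul_rpow_of_nonneg _ _ (by norm_num), ← ENNReal.rpow_mul, ← ENNReal.rpow_mul]
  norm_num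

/-- Minkowski in `L²` separates the two summands, then Cauchy-Schwarz separates the two points. Only
the marginal laws of `a` and `b` enter, so the result does not depend on their coupling. -/
theorem lintegral_le_of_le_sq_add {a b : β → α} (ha : MeasurePreserving a ν μ)
    (hb : MeasurePreserving b ν μ) {F₁ F₂ F₃ : α → ℝ≥0∞} (h1 : Measurable F₁) (h2 : Measurable F₂)
    (h3 : Measurable F₃) {c d : ℝ≥0∞} {H : α → α → ℝ≥0∞} {good : α → Prop}
    (hgood : ∀ᵐ y ∂μ, good y)
    (hH : ∀ y z, good y → good z → H y z ≤ (c * (F₂ y * F₁ z) + d * (F₃ y * F₃ z)) ^ 2) :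
    ∫⁻ ω, H (a ω) (b ω) ∂ν ≤
      (c * ((∫⁻ y, F₁ y ^ 4 ∂μ) ^ (1 / 4 : ℝ) * (∫⁻ y, F₂ y ^ 4 ∂μ) ^ (1 / 4 : ℝ)) +
        d * (∫⁻ y, F₃ y ^ 4 ∂μ) ^ (1 / 2 : ℝ)) ^ 2 := by
  have hae : ∀ᵐ ω ∂ν, H (a ω) (b ω) ≤
      (c * (F₂ (a ω) * F₁ (b ω)) + d * (F₃ (a ω) * F₃ (b ω))) ^ (2 : ℝ) := by
    filter_upwards [ha.quasiMeasurePreserving.ae hgood, hb.quasiMeasurePreserving.ae hgood]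
      with ω h h'
    rw [show (2 : ℝ) = ((2 : ℕ) : ℝ) by norm_num, ENNReal.rpow_natCast]
    exact hH _ _ h h'
  refine (lintegral_mono_ae hae).trans ?_
  have hm1 : Measurable fun ω => F₂ (a ω) * F₁ (b ω) :=
    (h2.comp ha.measurable).mul (h1.comp hb.measurable)
  have hm2 : Measurable fun ω => F₃ (a ω) * F₃ (b ω) :=
    (h3.comp ha.measurable).mul (h3.comp hb.measurable)
  have h := ENNReal.lintegral_Lp_add_le (μ := ν) (p := 2)
    (f := fun ω => c * (F₂ (a ω) * F₁ (b ω))) (g := fun ω => d * (F₃ (a ω) * F₃ (b ω)))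
    (hm1.const_mul c).aemeasurable (hm2.const_mul d).aemeasurable one_le_two
  simp only [Pi.add_apply] at h
  have hconst : ∀ (k : ℝ≥0∞) (G : β → ℝ≥0∞), Measurable G →
      (∫⁻ ω, (k * G ω) ^ (2 : ℝ) ∂ν) ^ (1 / 2 : ℝ) =
        k * (∫⁻ ω, G ω ^ (2 : ℝ) ∂ν) ^ (1 / 2 : ℝ) := by
    intro k G hG
    simp_rw [ENNReal.mul_rpow_of_nonneg _ _ (zero_le_two (α := ℝ))]
    rw [lintegral_const_mul _ (hG.pow_const _), ENNReal.mul_rpow_of_nonneg _ _ (by norm_num),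
      ← ENNReal.rpow_mul]
    norm_num
  rw [hconst c _ hm1, hconst d _ hm2] at h
  have h4 : ∀ t : ℝ≥0∞, t ^ (1 / 4 : ℝ) * t ^ (1 / 4 : ℝ) = t ^ (1 / 2 : ℝ) := fun t => by
    rw [← ENNReal.rpow_add_of_nonneg _ _ (by norm_num) (by norm_num)]; norm_num
  have h5 := h.trans (add_le_add (mul_le_mul_right (lintegral_mul_sq_rpow_le ha hb h2 h1) c)
    (mul_le_mul_right (lintegral_mul_sq_rpow_le ha hb h3 h3) d))
  rw [h4, mul_comm ((∫⁻ y, F₂ y ^ 4 ∂μ) ^ (1 / 4 : ℝ))] at h5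
  have h6 := ENNReal.rpow_le_rpow h5 (zero_le_two (α := ℝ))
  rw [← ENNReal.rpow_mul] at h6
  norm_num at h6 ⊢
  exact h6

end Holder

section Measurability

variable {ι : Type*} [Fintype ι] [DecidableEq ι] {n : ℕ}
  {A : (ι → ℝ) → Matrix (Fin n) (Fin n) ℂ} {f : ℂ → ℂ}

theorem continuous_pd (hA : ∀ i j, ContDiff ℝ 2 fun x => A x i j) (u : ι) (i j : Fin n) :
    Continuous (pd u fun y => A y i j) :=
  ((hA i j).continuous_fderiv two_ne_zero).clm_apply continuous_const

theorem continuous_pd_pd (hA : ∀ i j, ContDiff ℝ 2 fun x => A x i j) (u v : ι) (i j : Fin n) :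
    Continuous (pd u (pd v fun y => A y i j)) := by
  have h : ContDiff ℝ 1 (pd v fun y => A y i j) :=
    ((hA i j).fderiv_right (m := 1) (by norm_num)).clm_apply contDiff_const
  exact (h.continuous_fderiv one_ne_zero).clm_apply continuous_const

/-- An uncountable supremum of continuous functions is lower semicontinuous, hence measurable. -/
theorem measurable_γ₀ (hA : ∀ i j, ContDiff ℝ 2 fun x => A x i j) : Measurable (γ₀ A) := by
  refine LowerSemicontinuous.measurable ?_
  refine lowerSemicontinuous_iSup fun u => lowerSemicontinuous_iSup fun B =>
    lowerSemicontinuous_iSup fun _ => Continuous.lowerSemicontinuous ?_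
  have : Continuous fun x => pdMatrix u A x := continuous_matrix fun i j => continuous_pd hA u i j
  fun_prop

theorem measurable_γ₁ (hA : ∀ i j, ContDiff ℝ 2 fun x => A x i j) : Measurable (γ₁ A) := by
  refine LowerSemicontinuous.measurable ?_
  refine lowerSemicontinuous_iSup fun α => lowerSemicontinuous_iSup fun _ =>
    lowerSemicontinuous_iSup fun β => lowerSemicontinuous_iSup fun _ =>
    Continuous.lowerSemicontinuous ?_
  have := continuous_pd hA
  exact (continuous_finsetSum _ fun u _ => continuous_finsetSum _ fun i _ =>
    continuous_finsetSum _ fun j _ => continuous_const.mul (this u i j)).enorm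

theorem measurable_γ₂ (hA : ∀ i j, ContDiff ℝ 2 fun x => A x i j) : Measurable (γ₂ A) := by
  refine LowerSemicontinuous.measurable ?_
  refine lowerSemicontinuous_iSup fun α => lowerSemicontinuous_iSup fun _ =>
    lowerSemicontinuous_iSup fun α' => lowerSemicontinuous_iSup fun _ =>
    lowerSemicontinuous_iSup fun β => lowerSemicontinuous_iSup fun _ =>
    Continuous.lowerSemicontinuous ?_
  have := continuous_pd_pd hA
  exact (continuous_finsetSum _ fun u _ => continuous_finsetSum _ fun v _ =>
    continuous_finsetSum _ fun i _ => continuous_finsetSum _ fun j _ =>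
    continuous_const.mul (this u v i j)).enorm

open scoped Matrix.Norms.L2Operator in
theorem measurable_opNorm_comp (hA : ∀ i j, ContDiff ℝ 2 fun x => A x i j) :
    Measurable fun x => opNorm (A x) :=
  (continuous_norm.comp (contDiff_of_entries hA).continuous).measurable

theorem measurable_f₁_opNorm (hf : Differentiable ℂ f) (hA : ∀ i j, ContDiff ℝ 2 fun x => A x i j) :
    Measurable fun x => f₁ f (opNorm (A x)) := by
  have h := measurable_opNorm_comp hA
  have e : (fun x => f₁ f (opNorm (A x))) = fun x => (∑' m : ℕ, ENNReal.ofReal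
      (‖derivCoeff (coeff f) m‖ * opNorm (A x) ^ m)).toReal := by
    ext x
    have hs := hasSum_f₁ hf (opNorm_nonneg (A x))
    rw [← ENNReal.ofReal_tsum_of_nonneg (fun m => mul_nonneg (norm_nonneg _)
      (pow_nonneg (opNorm_nonneg _) _)) hs.summable, hs.tsum_eq,
      ENNReal.toReal_ofReal (f₁_opNorm_nonneg _)]
  rw [e]
  exact (Measurable.tsum fun m =>
    ((h.pow_const m).const_mul _).ennreal_ofReal).ennreal_toReal

theorem measurable_f₂_opNorm (hf : Differentiable ℂ f) (hA : ∀ i j, ContDiff ℝ 2 fun x => A x i j) :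
    Measurable fun x => f₂ f (opNorm (A x)) := by
  have h := measurable_opNorm_comp hA
  have e : (fun x => f₂ f (opNorm (A x))) = fun x => (∑' m : ℕ, ENNReal.ofReal
      (‖derivCoeff (coeff f) m‖ * (m * opNorm (A x) ^ (m - 1)))).toReal := by
    ext x
    have hs := hasSum_f₂ hf (opNorm_nonneg (A x))
    rw [← ENNReal.ofReal_tsum_of_nonneg (fun m => mul_nonneg (norm_nonneg _)
      (mul_nonneg (Nat.cast_nonneg _) (pow_nonneg (opNorm_nonneg _) _))) hs.summable, hs.tsum_eq,
      ENNReal.toReal_ofReal (f₂_opNorm_nonneg _)]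
  rw [e]
  exact (Measurable.tsum fun m =>
    (((h.pow_const _).const_mul _).const_mul _).ennreal_ofReal).ennreal_toReal

theorem measurable_sqrt_rank (hA : ∀ i j, ContDiff ℝ 2 fun x => A x i j) :
    Measurable fun x => √((A x).rank : ℝ) := by
  have h : Measurable fun x => (A x).rank :=
    measurable_of_Iic fun k =>
      ((isClosed_rank_le k).preimage (continuous_of_entries hA)).measurableSet
  exact (measurable_from_top (f := fun r : ℕ => √(r : ℝ))).comp h

theorem measurable_η₀r (hf : Differentiable ℂ f) (hA : ∀ i j, ContDiff ℝ 2 fun x => A x i j) :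
    Measurable (η₀r f A) :=
  (measurable_γ₀ hA).ennreal_toReal.mul (measurable_f₁_opNorm hf hA)

theorem measurable_η₁r (hf : Differentiable ℂ f) (hA : ∀ i j, ContDiff ℝ 2 fun x => A x i j) :
    Measurable (η₁r f A) :=
  ((measurable_γ₁ hA).ennreal_toReal.mul (measurable_f₁_opNorm hf hA)).mul
    (measurable_sqrt_rank hA)

theorem measurable_η₂r (hf : Differentiable ℂ f) (hA : ∀ i j, ContDiff ℝ 2 fun x => A x i j) :
    Measurable (η₂r f A) :=
  (((measurable_γ₂ hA).ennreal_toReal.mul (measurable_f₁_opNorm hf hA)).mul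
    (measurable_sqrt_rank hA)).add
    (((measurable_γ₁ hA).ennreal_toReal.pow_const 2).mul (measurable_f₂_opNorm hf hA))

end Measurability

/-! ### The total variation bound for a general transport map. -/

section Main

variable {ι : Type*} [Fintype ι] [DecidableEq ι] {n : ℕ}
  {A : (ι → ℝ) → Matrix (Fin n) (Fin n) ℂ} {f : ℂ → ℂ} {Φ : (ι → ℝ) → ι → ℝ}

/-- `√(η₀ η₁)`. -/
def η₃r (f : ℂ → ℂ) (A : (ι → ℝ) → Matrix (Fin n) (Fin n) ℂ) (x : ι → ℝ) : ℝ :=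
  √(η₀r f A x * η₁r f A x)

theorem η₃r_nonneg (x : ι → ℝ) : 0 ≤ η₃r f A x := Real.sqrt_nonneg _

/-- The square root is chosen so that the curvature term splits as a product over the two points,
with fourth moment equal to the square of `κ₀`. -/
theorem ofReal_η₃r_pow (x : ι → ℝ) :
    ENNReal.ofReal (η₃r f A x) ^ 4 = η₀ f A x ^ 2 * η₁ f A x ^ 2 := by
  have h : 0 ≤ η₀r f A x * η₁r f A x := mul_nonneg (η₀r_nonneg x) (η₁r_nonneg x)
  rw [← ofReal_η₀r, ← ofReal_η₁r, ← mul_pow, ← ENNReal.ofReal_mul (η₀r_nonneg x),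
    show 4 = 2 * 2 by norm_num, pow_mul, ← ENNReal.ofReal_pow (η₃r_nonneg x), η₃r,
    Real.sq_sqrt h]

theorem exists_nnreal_coe_eq_of_ne_top {K : ℝ≥0∞} (h : K ≠ ⊤) : ∃ k : ℝ≥0, (k : ℝ≥0∞) = K :=
  ⟨K.toNNReal, ENNReal.coe_toNNReal h⟩

/-- The hypotheses on the transport map `Φ` under which the bound holds. -/
structure Transport (f : ℂ → ℂ) (A : (ι → ℝ) → Matrix (Fin n) (Fin n) ℂ) (Φ : (ι → ℝ) → ι → ℝ)
    (c d : ℝ≥0) : Prop where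
  contDiff : ContDiff ℝ 2 Φ
  l2_le : ∀ y α, l2 (fderiv ℝ Φ y α) ≤ c * l2 α
  tangent : ∀ᵐ y ∂(stdG ι), ∀ α, ∃ α', fderiv ℝ (fderiv ℝ Φ) y α α = fderiv ℝ Φ y α'
  second : ∃ good : (ι → ℝ) → Prop, (∀ᵐ y ∂(stdG ι), good y) ∧ ∀ y z, good y → good z →
    l2 (fun i => fderiv ℝ (trFun f A) (Φ y) (fderiv ℝ (fderiv ℝ Φ) y (Pi.single i 1)
      fun j => par j (fun y => trFun f A (Φ y)) z)) ≤
        √2 * d * (η₃r f A (Φ y) * η₃r f A (Φ z))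

theorem contDiff_trFun_comp (hf : Differentiable ℂ f) (hA : ∀ i j, ContDiff ℝ 2 fun x => A x i j)
    (hΦ : ContDiff ℝ 2 Φ) : ContDiff ℝ 2 fun y => trFun f A (Φ y) :=
  (contDiff_trFun hf hA).comp hΦ

theorem dTV_trFun_le (hf : Differentiable ℂ f) (hA : ∀ i j, ContDiff ℝ 2 fun x => A x i j)
    {c d : ℝ≥0} (hT : Transport f A Φ c d)
    (m0 : MemLp (fun y => trFun f A (Φ y)) 4 (stdG ι))
    (m1 : ∀ i, MemLp (par i fun y => trFun f A (Φ y)) 4 (stdG ι))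
    (m2 : ∀ i j, MemLp (par i (par j fun y => trFun f A (Φ y))) 4 (stdG ι)) :
    dTV ((stdG ι).map fun y => trFun f A (Φ y)) (gaussianReal (∫ y, trFun f A (Φ y) ∂stdG ι)
      (variance (fun y => trFun f A (Φ y)) (stdG ι)).toNNReal) ≤
      ENNReal.ofReal (2 * √5) * (d * (∫⁻ y, η₀ f A (Φ y) ^ 2 * η₁ f A (Φ y) ^ 2 ∂stdG ι) ^
        (1 / 2 : ℝ) + c ^ 3 * (∫⁻ y, η₁ f A (Φ y) ^ 4 ∂stdG ι) ^ (1 / 4 : ℝ) *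
          (∫⁻ y, η₂ f A (Φ y) ^ 4 ∂stdG ι) ^ (1 / 4 : ℝ)) /
        ENNReal.ofReal (variance (fun y => trFun f A (Φ y)) (stdG ι)) := by
  set k0 := (∫⁻ y, η₀ f A (Φ y) ^ 2 * η₁ f A (Φ y) ^ 2 ∂stdG ι) ^ (1 / 2 : ℝ) with hk0
  set k1 := (∫⁻ y, η₁ f A (Φ y) ^ 4 ∂stdG ι) ^ (1 / 4 : ℝ) with hk1
  set k2 := (∫⁻ y, η₂ f A (Φ y) ^ 4 ∂stdG ι) ^ (1 / 4 : ℝ) with hk2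
  set K : ℝ≥0∞ := ENNReal.ofReal (2 * √2 * c ^ 3) * (k1 * k2) + ENNReal.ofReal (√2 * d) * k0 with hK
  have hle : ENNReal.ofReal (3 / 2) * K ≤ ENNReal.ofReal (2 * √5) * (d * k0 + c ^ 3 * k1 * k2) := by
    -- This is `18 ≤ 20`, the only slack used in the term with `c ^ 3`.
    have hs : 3 * √2 ≤ 2 * √5 := by
      rw [← pow_le_pow_iff_left₀ (by positivity) (by positivity) two_ne_zero, mul_pow, mul_pow,
        Real.sq_sqrt (by norm_num), Real.sq_sqrt (by norm_num)]
      norm_num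
    have e3 : (c : ℝ≥0∞) ^ 3 = ENNReal.ofReal ((c : ℝ) ^ 3) := by
      rw [ENNReal.ofReal_pow c.coe_nonneg, ENNReal.ofReal_coe_nnreal]
    have e4 : (d : ℝ≥0∞) = ENNReal.ofReal (d : ℝ) := (ENNReal.ofReal_coe_nnreal).symm
    rw [hK, mul_add, mul_add, add_comm, e3, e4, mul_assoc (ENNReal.ofReal ((c : ℝ) ^ 3)),
      ← mul_assoc, ← mul_assoc, ← mul_assoc (ENNReal.ofReal (2 * √5)),
      ← mul_assoc (ENNReal.ofReal (2 * √5)), ← ENNReal.ofReal_mul (by norm_num),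
      ← ENNReal.ofReal_mul (by norm_num), ← ENNReal.ofReal_mul (by positivity),
      ← ENNReal.ofReal_mul (by positivity)]
    have h2 : 0 ≤ √2 := Real.sqrt_nonneg 2
    have hd := d.2
    have hc3 : (0 : ℝ) ≤ (c : ℝ) ^ 3 := by positivity
    gcongr ?_ * _ + ?_ * _
    · refine ENNReal.ofReal_le_ofReal ?_
      calc 3 / 2 * (√2 * (d : ℝ)) = (3 / 2 * √2) * d := by ring
        _ ≤ (2 * √5) * d := mul_le_mul_of_nonneg_right (by linarith) d.2
    · refine ENNReal.ofReal_le_ofReal ?_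
      calc 3 / 2 * (2 * √2 * (c : ℝ) ^ 3) = (3 * √2) * c ^ 3 := by ring
        _ ≤ (2 * √5) * c ^ 3 := mul_le_mul_of_nonneg_right hs hc3
  -- If `K` is infinite, so is the right-hand side.
  by_cases hKt : K = ⊤
  · have h3 : ENNReal.ofReal (2 * √5) * (d * k0 + c ^ 3 * k1 * k2) = ⊤ := by
      rw [hKt, ENNReal.mul_top (by simp)] at hle
      exact top_le_iff.1 hle
    rw [h3, ENNReal.top_div_of_ne_top ENNReal.ofReal_ne_top]
    exact le_top
  obtain ⟨k, hk⟩ := exists_nnreal_coe_eq_of_ne_top hKt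
  obtain ⟨good, hgood, hsecond⟩ := hT.second
  have hm := hT.contDiff.continuous.measurable
  have bound : ∀ {a b : (ι → ℝ) × (ι → ℝ) → ι → ℝ},
      MeasurePreserving a ((stdG ι).prod (stdG ι)) (stdG ι) →
      MeasurePreserving b ((stdG ι).prod (stdG ι)) (stdG ι) →
      ∫⁻ p, ENNReal.ofReal (hessGrad (fun y => trFun f A (Φ y)) (a p) (b p))
        ∂(stdG ι).prod (stdG ι) ≤ (k : ℝ≥0∞) ^ 2 := by
    intro a b ha hb
    refine (lintegral_le_of_le_sq_add ha hb
      (H := fun y z => ENNReal.ofReal (hessGrad (fun y => trFun f A (Φ y)) y z))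
      (F₁ := fun y => ENNReal.ofReal (η₁r f A (Φ y)))
      (F₂ := fun y => ENNReal.ofReal (η₂r f A (Φ y)))
      (F₃ := fun y => ENNReal.ofReal (η₃r f A (Φ y)))
      ((measurable_η₁r hf hA).comp hm).ennreal_ofReal
      ((measurable_η₂r hf hA).comp hm).ennreal_ofReal
      (((measurable_η₀r hf hA).mul (measurable_η₁r hf hA)).sqrt.comp hm).ennreal_ofReal
      (c := ENNReal.ofReal (2 * √2 * c ^ 3)) (d := ENNReal.ofReal (√2 * d))
      (hgood.and (ae_rankTangentAt hA hT.contDiff hT.tangent)) ?_).trans (le_of_eq ?_)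
    · rintro y z ⟨hy, hy'⟩ ⟨hz, hz'⟩
      have hnn : ∀ y z, 0 ≤ η₃r f A y * η₃r f A z := fun y z =>
        mul_nonneg (η₃r_nonneg _) (η₃r_nonneg _)
      have h1 := hessGrad_le hf hA hT.contDiff c.2 (hT.l2_le y) (hT.l2_le z) hy' hz'
        (hsecond y z hy hz)
      rw [← ENNReal.ofReal_mul (η₂r_nonneg _), ← ENNReal.ofReal_mul (η₃r_nonneg _),
        ← ENNReal.ofReal_mul (by positivity), ← ENNReal.ofReal_mul (by positivity),
        ← ENNReal.ofReal_add
          (mul_nonneg (by positivity) (mul_nonneg (η₂r_nonneg _) (η₁r_nonneg _)))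
          (mul_nonneg (by positivity) (hnn _ _)), ← ENNReal.ofReal_pow
          (add_nonneg (mul_nonneg (by positivity) (mul_nonneg (η₂r_nonneg _) (η₁r_nonneg _)))
          (mul_nonneg (by positivity) (hnn _ _)))]
      exact ENNReal.ofReal_le_ofReal h1
    · simp only [ofReal_η₁r, ofReal_η₂r, ofReal_η₃r_pow]
      rw [hk]
  have hfst : MeasurePreserving (Prod.fst : (ι → ℝ) × (ι → ℝ) → ι → ℝ)
      ((stdG ι).prod (stdG ι)) (stdG ι) := measurePreserving_fst
  have hmix : ∀ t, MeasurePreserving (mix t : (ι → ℝ) × (ι → ℝ) → ι → ℝ)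
      ((stdG ι).prod (stdG ι)) (stdG ι) := fun t => ⟨(continuous_mix t).measurable, map_mix_stdG t⟩
  refine (dTV_map_stdG_le (contDiff_trFun_comp hf hA hT.contDiff) m0 m1 m2 (K := k)
    (fun t => bound hfst (hmix t)) (fun t => bound (hmix t) hfst)).trans ?_
  rw [hk]
  exact ENNReal.div_le_div_right hle _

theorem ae_abs_par_le (hf : Differentiable ℂ f) (hA : ∀ i j, ContDiff ℝ 2 fun x => A x i j)
    {c d : ℝ≥0} (hT : Transport f A Φ c d) :
    ∀ᵐ y ∂(stdG ι), ∀ i, |par i (fun y => trFun f A (Φ y)) y| ≤ √2 * c * η₁r f A (Φ y) := by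
  filter_upwards [ae_rankTangentAt hA hT.contDiff hT.tangent] with y hy i
  exact (abs_le_l2 (fun j => par j (fun y => trFun f A (Φ y)) y) i).trans
    (l2_grad_le hf hA hT.contDiff c.2 (hT.l2_le y) hy)

theorem l2_single (i : ι) : l2 (Pi.single i 1 : ι → ℝ) = 1 := by
  rw [l2_eq_norm]
  simp

theorem par_par_trFun_comp (hf : Differentiable ℂ f) (hA : ∀ i j, ContDiff ℝ 2 fun x => A x i j)
    (hΦ : ContDiff ℝ 2 Φ) (i j : ι) (y : ι → ℝ) :
    par i (par j fun y => trFun f A (Φ y)) y =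
      fderiv ℝ (fderiv ℝ (trFun f A)) (Φ y) (fderiv ℝ Φ y (Pi.single i 1))
        (fderiv ℝ Φ y (Pi.single j 1)) +
      fderiv ℝ (trFun f A) (Φ y) (fderiv ℝ (fderiv ℝ Φ) y (Pi.single i 1) (Pi.single j 1)) := by
  rw [par_par_eq (contDiff_trFun_comp hf hA hΦ),
    fderiv_fderiv_comp_apply (contDiff_trFun hf hA) hΦ]

theorem ae_abs_hess_le (hf : Differentiable ℂ f) (hA : ∀ i j, ContDiff ℝ 2 fun x => A x i j)
    {c d : ℝ≥0} (hT : Transport f A Φ c d) :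
    ∀ᵐ y ∂(stdG ι), ∀ i j, |fderiv ℝ (fderiv ℝ (trFun f A)) (Φ y) (fderiv ℝ Φ y (Pi.single i 1))
        (fderiv ℝ Φ y (Pi.single j 1))| ≤ 2 * c ^ 2 * η₂r f A (Φ y) := by
  filter_upwards [ae_rankTangentAt hA hT.contDiff hT.tangent] with y hy i j
  have h := l2_hess_le hf hA c.2 (hT.l2_le y) hy (Pi.single j 1)
  rw [l2_single, mul_one] at h
  exact (abs_le_l2 (fun i => fderiv ℝ (fderiv ℝ (trFun f A)) (Φ y)
    (fderiv ℝ Φ y (Pi.single i 1)) (fderiv ℝ Φ y (Pi.single j 1))) i).trans h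

theorem memLp_four_of_lintegral {F : (ι → ℝ) → ℝ} (hF : Measurable F) (hF0 : ∀ y, 0 ≤ F y)
    (h : ∫⁻ y, ENNReal.ofReal (F y) ^ 4 ∂stdG ι ≠ ⊤) : MemLp F 4 (stdG ι) := by
  refine ⟨hF.aestronglyMeasurable, ?_⟩
  rw [eLpNorm_lt_top_iff_lintegral_rpow_enorm_lt_top (by norm_num) (by norm_num)]
  refine lt_of_le_of_lt (le_of_eq (lintegral_congr fun y => ?_)) h.lt_top
  rw [Real.enorm_of_nonneg (hF0 y), ← ENNReal.rpow_natCast]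
  norm_num

theorem continuous_eq_zero_of_ae {F : (ι → ℝ) → ℝ} (hF : Continuous F)
    (h : ∀ᵐ y ∂(stdG ι), F y = 0) : F = 0 := by
  have := isOpenPosMeasure_stdG ι
  exact (Continuous.ae_eq_iff_eq (stdG ι) hF continuous_const).1 h

/-- It remains to obtain the `L⁴` integrability of the derivatives. Because `0 · ∞ = 0`, the bound
keeps its content when one of the two moments vanishes and the other is infinite. If `c` or the
first moment vanishes, the gradient is zero; if the second vanishes, the Hessian of `trFun` along
`DΦ` is zero and `hdeg` supplies integrability. Otherwise either both moments are finite, or the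
right-hand side is infinite. -/
theorem dTV_trFun_le_of_transport (hf : Differentiable ℂ f)
    (hA : ∀ i j, ContDiff ℝ 2 fun x => A x i j) {c d : ℝ≥0} (hT : Transport f A Φ c d)
    (m0 : MemLp (fun y => trFun f A (Φ y)) 4 (stdG ι))
    (hB : ∃ C : ℝ, ∀ᵐ y ∂(stdG ι), ∀ i j, |fderiv ℝ (trFun f A) (Φ y)
      (fderiv ℝ (fderiv ℝ Φ) y (Pi.single i 1) (Pi.single j 1))| ≤ C * η₁r f A (Φ y))
    (hdeg : (∀ y i j, fderiv ℝ (fderiv ℝ (trFun f A)) (Φ y) (fderiv ℝ Φ y (Pi.single i 1))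
        (fderiv ℝ Φ y (Pi.single j 1)) = 0) →
      (∀ i, MemLp (par i fun y => trFun f A (Φ y)) 4 (stdG ι)) ∧
      ∀ i j, MemLp (par i (par j fun y => trFun f A (Φ y))) 4 (stdG ι)) :
    dTV ((stdG ι).map fun y => trFun f A (Φ y)) (gaussianReal (∫ y, trFun f A (Φ y) ∂stdG ι)
      (variance (fun y => trFun f A (Φ y)) (stdG ι)).toNNReal) ≤
      ENNReal.ofReal (2 * √5) * (d * (∫⁻ y, η₀ f A (Φ y) ^ 2 * η₁ f A (Φ y) ^ 2 ∂stdG ι) ^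
        (1 / 2 : ℝ) + c ^ 3 * (∫⁻ y, η₁ f A (Φ y) ^ 4 ∂stdG ι) ^ (1 / 4 : ℝ) *
          (∫⁻ y, η₂ f A (Φ y) ^ 4 ∂stdG ι) ^ (1 / 4 : ℝ)) /
        ENNReal.ofReal (variance (fun y => trFun f A (Φ y)) (stdG ι)) := by
  have hh := contDiff_trFun_comp hf hA hT.contDiff
  have hm := hT.contDiff.continuous.measurable
  have hm1 : Measurable fun y => η₁r f A (Φ y) := (measurable_η₁r hf hA).comp hm
  have hm2 : Measurable fun y => η₂r f A (Φ y) := (measurable_η₂r hf hA).comp hm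
  have hpar := ae_abs_par_le hf hA hT
  have hhess := ae_abs_hess_le hf hA hT
  -- the gradient vanishes
  by_cases hzero : c = 0 ∨ ∫⁻ y, η₁ f A (Φ y) ^ 4 ∂stdG ι = 0
  · have hp : ∀ i, par i (fun y => trFun f A (Φ y)) = 0 := by
      intro i
      refine continuous_eq_zero_of_ae (continuous_par (hh.of_le one_le_two) i) ?_
      rcases hzero with hc | h1
      · filter_upwards [hpar] with y hy
        have := hy i
        rw [hc] at this
        simpa using this
      · simp_rw [← ofReal_η₁r] at h1
        rw [lintegral_eq_zero_iff (hm1.ennreal_ofReal.pow_const 4)] at h1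
        filter_upwards [hpar, h1] with y hy h1y
        have h2 : η₁r f A (Φ y) ≤ 0 := by simpa using h1y
        rw [le_antisymm h2 (η₁r_nonneg _)] at hy
        simpa using hy i
    refine dTV_trFun_le hf hA hT m0 (fun i => ?_) fun i j => ?_
    · rw [hp]; exact MemLp.zero
    · rw [hp]
      have : par i (0 : (ι → ℝ) → ℝ) = 0 := by ext y; simp [par]
      rw [this]; exact MemLp.zero
  push Not at hzero
  obtain ⟨hc, hκ1⟩ := hzero
  -- the second order term vanishes
  by_cases hκ2 : ∫⁻ y, η₂ f A (Φ y) ^ 4 ∂stdG ι = 0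
  · simp_rw [← ofReal_η₂r] at hκ2
    rw [lintegral_eq_zero_iff (hm2.ennreal_ofReal.pow_const 4)] at hκ2
    obtain ⟨m1, m2⟩ := hdeg fun y i j => by
      have hcont : Continuous fun y => fderiv ℝ (fderiv ℝ (trFun f A)) (Φ y)
          (fderiv ℝ Φ y (Pi.single i 1)) (fderiv ℝ Φ y (Pi.single j 1)) := by
        have c1 := ((contDiff_trFun hf hA).fderiv_right (m := 1) (by norm_num)).continuous_fderiv
          one_ne_zero
        have c2 := hT.contDiff.continuous_fderiv two_ne_zero
        exact ((c1.comp hT.contDiff.continuous).clm_apply (c2.clm_apply continuous_const)).clm_apply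
          (c2.clm_apply continuous_const)
      refine congrFun (continuous_eq_zero_of_ae hcont ?_) y
      filter_upwards [hhess, hκ2] with y hy h2y
      have h2 : η₂r f A (Φ y) ≤ 0 := by simpa using h2y
      rw [le_antisymm h2 (η₂r_nonneg _)] at hy
      simpa using hy i j
    exact dTV_trFun_le hf hA hT m0 m1 m2
  by_cases htop : ∫⁻ y, η₁ f A (Φ y) ^ 4 ∂stdG ι ≠ ⊤ ∧ ∫⁻ y, η₂ f A (Φ y) ^ 4 ∂stdG ι ≠ ⊤
  · obtain ⟨t1, t2⟩ := htop
    simp_rw [← ofReal_η₁r] at t1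
    simp_rw [← ofReal_η₂r] at t2
    have M1 := memLp_four_of_lintegral hm1 (fun y => η₁r_nonneg _) t1
    have M2 := memLp_four_of_lintegral hm2 (fun y => η₂r_nonneg _) t2
    refine dTV_trFun_le hf hA hT m0 (fun i => ?_) fun i j => ?_
    · refine (M1.const_mul (√2 * c)).mono'
        (continuous_par (hh.of_le one_le_two) i).aestronglyMeasurable ?_
      filter_upwards [hpar] with y hy using hy i
    · obtain ⟨C, hC⟩ := hB
      refine ((M2.const_mul (2 * c ^ 2)).add (M1.const_mul C)).mono'
        (continuous_par (contDiff_par hh j) i).aestronglyMeasurable ?_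
      filter_upwards [hhess, hC] with y hy hCy
      rw [par_par_trFun_comp hf hA hT.contDiff]
      exact (abs_add_le _ _).trans (add_le_add (hy i j) (hCy i j))
  · have h14 : (0 : ℝ) < 1 / 4 := by norm_num
    -- One moment is infinite and neither is zero, so the product is infinite.
    have ht : (∫⁻ y, η₁ f A (Φ y) ^ 4 ∂stdG ι) ^ (1 / 4 : ℝ) *
        (∫⁻ y, η₂ f A (Φ y) ^ 4 ∂stdG ι) ^ (1 / 4 : ℝ) = ⊤ := by
      rw [ENNReal.mul_eq_top]
      by_cases h1 : ∫⁻ y, η₁ f A (Φ y) ^ 4 ∂stdG ι = ⊤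
      · right
        rw [h1, ENNReal.top_rpow_of_pos h14]
        exact ⟨rfl, by simpa [ENNReal.rpow_eq_zero_iff, h14.not_gt] using hκ2⟩
      · left
        have h2 : ∫⁻ y, η₂ f A (Φ y) ^ 4 ∂stdG ι = ⊤ := by
          by_contra h2
          exact htop ⟨h1, h2⟩
        rw [h2, ENNReal.top_rpow_of_pos h14]
        exact ⟨by simpa [ENNReal.rpow_eq_zero_iff, h14.not_gt] using hκ1, rfl⟩
    have hc3 : (c : ℝ≥0∞) ^ 3 ≠ 0 := pow_ne_zero 3 (by simpa using hc)
    rw [mul_assoc ((c : ℝ≥0∞) ^ 3), ht, ENNReal.mul_top hc3, add_top, ENNReal.mul_top (by simp),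
      ENNReal.top_div_of_ne_top ENNReal.ofReal_ne_top]
    exact le_top

end Main

end

/-! ### Passage to the law of `X`. -/

section

section Law

variable {ι : Type*} [Fintype ι] [DecidableEq ι] {n : ℕ}
  {A : (ι → ℝ) → Matrix (Fin n) (Fin n) ℂ} {f : ℂ → ℂ} {Φ : (ι → ℝ) → ι → ℝ}
  {Ω : Type*} [MeasurableSpace Ω] {P : Measure Ω} {X : ι → Ω → ℝ}

/-- Every quantity in the bound depends on `X` only through its law, which is that of `Φ(Y)`. -/
theorem dTV_linStat_le (hf : Differentiable ℂ f) (hA : ∀ i j, ContDiff ℝ 2 fun x => A x i j)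
    (hX : ∀ u, Measurable (X u)) (hW : MemLp (linStat f A X) 4 P)
    (hmap : P.map (fun ω u => X u ω) = (stdG ι).map Φ) {c d : ℝ≥0} (hT : Transport f A Φ c d)
    (hB : ∃ C : ℝ, ∀ᵐ y ∂(stdG ι), ∀ i j, |fderiv ℝ (trFun f A) (Φ y)
      (fderiv ℝ (fderiv ℝ Φ) y (Pi.single i 1) (Pi.single j 1))| ≤ C * η₁r f A (Φ y))
    (hdeg : (∀ y i j, fderiv ℝ (fderiv ℝ (trFun f A)) (Φ y) (fderiv ℝ Φ y (Pi.single i 1))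
        (fderiv ℝ Φ y (Pi.single j 1)) = 0) →
      (∀ i, MemLp (par i fun y => trFun f A (Φ y)) 4 (stdG ι)) ∧
      ∀ i j, MemLp (par i (par j fun y => trFun f A (Φ y))) 4 (stdG ι)) :
    dTV (P.map (linStat f A X)) (gaussianReal (∫ ω, linStat f A X ω ∂P)
        (variance (linStat f A X) P).toNNReal) ≤
      ENNReal.ofReal (2 * √5) * (d * κ₀ f A P X + c ^ 3 * κ₁ f A P X * κ₂ f A P X) /
        ENNReal.ofReal (variance (linStat f A X) P) := by
  have hXm : Measurable fun ω u => X u ω := measurable_pi_lambda _ hX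
  have hΦm := hT.contDiff.continuous.measurable
  have hid : IdentDistrib (fun ω u => X u ω) Φ P (stdG ι) :=
    ⟨hXm.aemeasurable, hΦm.aemeasurable, hmap⟩
  have hW' : IdentDistrib (linStat f A X) (fun y => trFun f A (Φ y)) P (stdG ι) :=
    hid.comp (contDiff_trFun hf hA).continuous.measurable
  have hη₀ : Measurable (η₀ f A) := by
    rw [show η₀ f A = fun x => ENNReal.ofReal (η₀r f A x) from funext fun x => (ofReal_η₀r x).symm]
    exact (measurable_η₀r hf hA).ennreal_ofReal
  have hη₁ : Measurable (η₁ f A) := by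
    rw [show η₁ f A = fun x => ENNReal.ofReal (η₁r f A x) from funext fun x => (ofReal_η₁r x).symm]
    exact (measurable_η₁r hf hA).ennreal_ofReal
  have hη₂ : Measurable (η₂ f A) := by
    rw [show η₂ f A = fun x => ENNReal.ofReal (η₂r f A x) from funext fun x => (ofReal_η₂r x).symm]
    exact (measurable_η₂r hf hA).ennreal_ofReal
  have e0 : κ₀ f A P X = (∫⁻ y, η₀ f A (Φ y) ^ 2 * η₁ f A (Φ y) ^ 2 ∂stdG ι) ^ (1 / 2 : ℝ) :=
    congrArg (· ^ (1 / 2 : ℝ))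
      (hid.comp (u := fun x => η₀ f A x ^ 2 * η₁ f A x ^ 2) (by fun_prop)).lintegral_eq
  have e1 : κ₁ f A P X = (∫⁻ y, η₁ f A (Φ y) ^ 4 ∂stdG ι) ^ (1 / 4 : ℝ) :=
    congrArg (· ^ (1 / 4 : ℝ)) (hid.comp (u := fun x => η₁ f A x ^ 4) (by fun_prop)).lintegral_eq
  have e2 : κ₂ f A P X = (∫⁻ y, η₂ f A (Φ y) ^ 4 ∂stdG ι) ^ (1 / 4 : ℝ) :=
    congrArg (· ^ (1 / 4 : ℝ)) (hid.comp (u := fun x => η₂ f A x ^ 4) (by fun_prop)).lintegral_eq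
  rw [e0, e1, e2, hW'.map_eq, hW'.integral_eq, hW'.variance_eq]
  exact dTV_trFun_le_of_transport hf hA hT (hW'.memLp_iff.1 hW) hB hdeg

end Law

/-! ### Gaussian vectors: the linear transport `√Σ`. -/

section Gaussian

open scoped MatrixOrder

variable {ι : Type*} [Fintype ι] [DecidableEq ι] {n : ℕ}
  {A : (ι → ℝ) → Matrix (Fin n) (Fin n) ℂ} {f : ℂ → ℂ}

theorem fderiv_clm (T : (ι → ℝ) →L[ℝ] ι → ℝ) (y : ι → ℝ) : fderiv ℝ (fun y => T y) y = T := T.fderiv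

theorem fderiv_fderiv_clm (T : (ι → ℝ) →L[ℝ] ι → ℝ) (y : ι → ℝ) :
    fderiv ℝ (fderiv ℝ fun y => T y) y = 0 := by
  rw [show (fderiv ℝ fun y => T y) = fun _ => T from funext fun y => fderiv_clm T y]
  exact fderiv_const_apply T

/-- A linear map has no second derivative: the curvature constant `d` is `0` and tangency is
trivial. -/
theorem transport_clm (T : (ι → ℝ) →L[ℝ] ι → ℝ) {c : ℝ≥0} (hT : ∀ α, l2 (T α) ≤ c * l2 α) :
    Transport f A (fun y => T y) c 0 where
  contDiff := T.contDiff
  l2_le y α := by rw [fderiv_clm]; exact hT α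
  tangent := Eventually.of_forall fun y α => ⟨0, by rw [fderiv_fderiv_clm]; simp⟩
  second := ⟨fun _ => True, by simp, fun y z _ _ => by
    simp only [fderiv_fderiv_clm]
    simp [l2]⟩

theorem eq_of_par_eq_zero {F : (ι → ℝ) → ℝ} (hF : ContDiff ℝ 1 F) {w : ι → ℝ}
    (h : ∀ i, w i ≠ 0 → ∀ y, par i F y = 0) (y : ι → ℝ) : F (y + w) = F y := by
  have hd : ∀ t : ℝ, HasDerivAt (fun t : ℝ => F (y + t • w)) 0 t := by
    intro t
    have h1 : HasDerivAt (fun t : ℝ => y + t • w) w t := by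
      simpa using ((hasDerivAt_id t).smul_const w).const_add y
    have h2 := (hF.differentiable one_ne_zero (y + t • w)).hasFDerivAt.comp_hasDerivAt t h1
    rw [fderiv_eq_sum_par, Finset.sum_eq_zero] at h2
    · exact h2
    · intro i _
      by_cases hi : w i = 0
      · rw [hi, zero_mul]
      · rw [h i hi, mul_zero]
  have := is_const_of_deriv_eq_zero (fun t => (hd t).differentiableAt) (fun t => (hd t).deriv) 1 0
  simpa using this

/-- A vanishing Hessian forces a constant gradient. -/
theorem memLp_of_hess_eq_zero {h : (ι → ℝ) → ℝ} (hh : ContDiff ℝ 2 h)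
    (h0 : ∀ i j y, par i (par j h) y = 0) :
    (∀ i, MemLp (par i h) 4 (stdG ι)) ∧ ∀ i j, MemLp (par i (par j h)) 4 (stdG ι) := by
  constructor
  · intro i
    have : par i h = fun _ => par i h 0 := by
      ext y
      have := eq_of_par_eq_zero (contDiff_par hh i) (w := y) (fun k _ z => h0 k i z) 0
      rwa [zero_add] at this
    rw [this]
    exact memLp_const _
  · intro i j
    rw [show par i (par j h) = 0 from funext fun y => h0 i j y]
    exact MemLp.zero

theorem opNorm_sq_of_sqrt {S R : Matrix ι ι ℝ} (hR : R.IsHermitian) (h : R * R = S) :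
    opNorm R ^ 2 = opNorm S := by
  have hs : IsSelfAdjoint (Matrix.toEuclideanCLM (n := ι) (𝕜 := ℝ) R) := by
    have : IsSelfAdjoint R := hR
    exact this.map _
  rw [opNorm, opNorm, ← h, map_mul, hs.norm_mul_self]

theorem map_eq_of_hasLaw {Ω : Type*} [MeasurableSpace Ω] {P : Measure Ω} {X : ι → Ω → ℝ}
    (hX : ∀ u, Measurable (X u)) {S : Matrix ι ι ℝ}
    (h : HasLaw (fun ω => WithLp.toLp 2 fun u => X u ω) (multivariateGaussian 0 S) P) :
    P.map (fun ω u => X u ω) = (stdG ι).map fun y => (CFC.sqrt S).mulVec y := by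
  have hXm : Measurable fun ω u => X u ω := measurable_pi_lambda _ hX
  have h1 := congrArg (Measure.map (WithLp.ofLp (p := 2) (V := ι → ℝ))) h.map_eq
  rw [Measure.map_map (by fun_prop) (by fun_prop), multivariateGaussian,
    ← map_pi_eq_stdGaussian, Measure.map_map (by fun_prop) (by fun_prop),
    Measure.map_map (by fun_prop) (by fun_prop)] at h1
  refine h1.trans ?_
  rw [stdG]
  congr 1
  ext y : 1
  simp [Matrix.toEuclideanCLM_toLp]

theorem dTV_linStat_le_of_multivariateGaussian (hf : Differentiable ℂ f)
    (hA : ∀ i j, ContDiff ℝ 2 fun x => A x i j)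
    {Ω : Type*} [MeasurableSpace Ω] {P : Measure Ω} {X : ι → Ω → ℝ}
    (hX : ∀ u, Measurable (X u)) (hW : MemLp (linStat f A X) 4 P) {S : Matrix ι ι ℝ}
    (hS : S.PosSemidef)
    (h : HasLaw (fun ω => WithLp.toLp 2 fun u => X u ω) (multivariateGaussian 0 S) P) :
    dTV (P.map (linStat f A X)) (gaussianReal (∫ ω, linStat f A X ω ∂P)
        (variance (linStat f A X) P).toNNReal) ≤
      ENNReal.ofReal (2 * √5) * (ENNReal.ofReal (opNorm S ^ (3 / 2 : ℝ)) *
        κ₁ f A P X * κ₂ f A P X) / ENNReal.ofReal (variance (linStat f A X) P) := by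
  obtain ⟨R, hR⟩ : ∃ R : Matrix ι ι ℝ, R = CFC.sqrt S := ⟨_, rfl⟩
  have hRR : opNorm R ^ 2 = opNorm S := by
    have h1 : R * R = S := by rw [hR]; exact CFC.sqrt_mul_sqrt_self S hS.nonneg
    have h2 : R.PosSemidef := by
      rw [hR]; exact Matrix.nonneg_iff_posSemidef.1 (CFC.sqrt_nonneg S)
    exact opNorm_sq_of_sqrt h2.isHermitian h1
  have hRn : 0 ≤ opNorm R := norm_nonneg _
  let T : (ι → ℝ) →L[ℝ] ι → ℝ := LinearMap.toContinuousLinearMap R.mulVecLin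
  have hmap : P.map (fun ω u => X u ω) = (stdG ι).map fun y => T y := by
    rw [map_eq_of_hasLaw hX h, ← hR]; rfl
  obtain ⟨c, hc⟩ : ∃ c : ℝ≥0, (c : ℝ) = opNorm R := ⟨⟨opNorm R, hRn⟩, rfl⟩
  have hTc : ∀ α, l2 (T α) ≤ c * l2 α := by
    intro α
    rw [hc]
    have := (Matrix.toEuclideanCLM (n := ι) (𝕜 := ℝ) R).le_opNorm (WithLp.toLp 2 α)
    rw [Matrix.toEuclideanCLM_toLp] at this
    rw [l2_eq_norm, l2_eq_norm]
    exact this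
  have hT := transport_clm (f := f) (A := A) T hTc
  have key := dTV_linStat_le hf hA hX hW hmap hT
    ⟨0, Eventually.of_forall fun y i j => by rw [fderiv_fderiv_clm]; simp⟩ fun h0 =>
      memLp_of_hess_eq_zero (contDiff_trFun_comp hf hA hT.contDiff) fun i j y => by
        rw [par_par_trFun_comp hf hA hT.contDiff, h0, fderiv_fderiv_clm]; simp
  -- `c` is the norm of the square root of `S`, so `c ^ 2` is the norm of `S`.
  have e3 : (c : ℝ≥0∞) ^ 3 = ENNReal.ofReal (opNorm S ^ (3 / 2 : ℝ)) := by
    rw [← hRR, ← hc, ← Real.rpow_natCast (c : ℝ) 2, ← Real.rpow_mul c.coe_nonneg,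
      show ((2 : ℕ) : ℝ) * (3 / 2) = (3 : ℕ) by norm_num, Real.rpow_natCast,
      ENNReal.ofReal_pow c.coe_nonneg, ENNReal.ofReal_coe_nnreal]
  rw [e3] at key
  -- The term `0 * κ₀` disappears even if `κ₀` is infinite.
  simpa using key

end Gaussian

end

/-! ### Independent variables: the coordinatewise transport. -/

section

section Independent

variable {ι : Type*} [Fintype ι] [DecidableEq ι] {n : ℕ}
  {A : (ι → ℝ) → Matrix (Fin n) (Fin n) ℂ} {f : ℂ → ℂ} {u : ι → ℝ → ℝ}

theorem fderiv_coordwise {w : ι → ℝ → ℝ} (hw : ∀ i, Differentiable ℝ (w i)) (y α : ι → ℝ) :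
    fderiv ℝ (fun y : ι → ℝ => fun i => w i (y i)) y α = fun i => deriv (w i) (y i) * α i := by
  have h : ∀ i, HasFDerivAt (fun y : ι → ℝ => w i (y i))
      (deriv (w i) (y i) • ContinuousLinearMap.proj (R := ℝ) (φ := fun _ : ι => ℝ) i) y := fun i =>
    (hw i (y i)).hasDerivAt.comp_hasFDerivAt y (hasFDerivAt_apply i y)
  rw [(hasFDerivAt_pi.2 h).fderiv]
  ext i
  simp

theorem contDiff_coordwise (hu : ∀ i, ContDiff ℝ 2 (u i)) :
    ContDiff ℝ 2 (fun y : ι → ℝ => fun i => u i (y i)) :=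
  contDiff_pi.2 fun i => (hu i).comp (contDiff_apply ℝ ℝ i)

theorem contDiff_one_deriv {v : ℝ → ℝ} (hv : ContDiff ℝ 2 v) : ContDiff ℝ 1 (deriv v) :=
  ((contDiff_succ_iff_deriv (n := 1)).1 hv).2.2

theorem fderiv_fderiv_coordwise (hu : ∀ i, ContDiff ℝ 2 (u i)) (y α β : ι → ℝ) :
    fderiv ℝ (fderiv ℝ fun y : ι → ℝ => fun i => u i (y i)) y α β =
      fun i => deriv (deriv (u i)) (y i) * α i * β i := by
  have hd : ∀ i, Differentiable ℝ (deriv (u i)) := fun i =>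
    (contDiff_one_deriv (hu i)).differentiable one_ne_zero
  rw [fderiv_fderiv_apply (contDiff_coordwise hu)]
  have e : (fun z : ι → ℝ => fderiv ℝ (fun y : ι → ℝ => fun i => u i (y i)) z β) =
      fun z i => (fun t => deriv (u i) t * β i) (z i) :=
    funext fun z => fderiv_coordwise (fun i => (hu i).differentiable two_ne_zero) z β
  rw [e, fderiv_coordwise (w := fun i t => deriv (u i) t * β i) fun i => (hd i).mul_const (β i)]
  ext i
  rw [deriv_mul_const (hd i (y i))]
  ring

/-- The partial derivatives of `Re Tr f(A)` in the coordinates where `u` is regular. -/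
def regGrad (f : ℂ → ℂ) (A : (ι → ℝ) → Matrix (Fin n) (Fin n) ℂ) (u : ι → ℝ → ℝ) (y : ι → ℝ)
    (i : ι) : ℝ :=
  if deriv (u i) (y i) = 0 then 0
  else fderiv ℝ (trFun f A) (fun i => u i (y i)) (Pi.single i 1)

theorem single_eq_smul (i : ι) (t : ℝ) : (Pi.single i t : ι → ℝ) = t • Pi.single i 1 := by
  rw [← Pi.single_smul', smul_eq_mul, mul_one]

theorem par_coordwise (hf : Differentiable ℂ f) (hA : ∀ i j, ContDiff ℝ 2 fun x => A x i j)
    (hu : ∀ i, ContDiff ℝ 2 (u i)) (y : ι → ℝ) (i : ι) :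
    par i (fun y => trFun f A fun i => u i (y i)) y =
      deriv (u i) (y i) * fderiv ℝ (trFun f A) (fun i => u i (y i)) (Pi.single i 1) := by
  have e : fderiv ℝ (fun y : ι → ℝ => fun i => u i (y i)) y (Pi.single i 1) =
      deriv (u i) (y i) • Pi.single i 1 := by
    rw [fderiv_coordwise fun i => (hu i).differentiable two_ne_zero, ← single_eq_smul]
    ext k
    by_cases hk : k = i
    · subst hk; simp
    · simp [hk]
  have h := fderiv_comp_apply (contDiff_trFun hf hA) (contDiff_coordwise hu) y (Pi.single i 1)
  rw [e, map_smul, smul_eq_mul] at h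
  exact h

theorem l2_regGrad_le (hf : Differentiable ℂ f) (hA : ∀ i j, ContDiff ℝ 2 fun x => A x i j)
    (hu : ∀ i, ContDiff ℝ 2 (u i)) {y : ι → ℝ}
    (hy : RankTangentAt A (fun y : ι → ℝ => fun i => u i (y i)) y) :
    l2 (regGrad f A u y) ≤ √2 * η₁r f A (fun i => u i (y i)) := by
  set q := regGrad f A u y with hq
  by_cases h0 : l2 q = 0
  · rw [h0]; exact mul_nonneg (Real.sqrt_nonneg 2) (η₁r_nonneg _)
  have e : q = fderiv ℝ (fun y : ι → ℝ => fun i => u i (y i)) y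
      fun i => q i / deriv (u i) (y i) := by
    rw [fderiv_coordwise fun i => (hu i).differentiable two_ne_zero]
    ext i
    by_cases hi : deriv (u i) (y i) = 0
    · simp [hq, regGrad, hi]
    · field_simp
  have h1 : l2 q ^ 2 = fderiv ℝ (trFun f A) (fun i => u i (y i)) q := by
    rw [l2_sq, fderiv_apply_eq_sum _ q]
    refine Finset.sum_congr rfl fun i _ => ?_
    by_cases hi : deriv (u i) (y i) = 0
    · simp [hq, regGrad, hi]
    · simp [hq, regGrad, hi, sq]
  have hr := hy.1 fun i => q i / deriv (u i) (y i)
  rw [← e] at hr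
  have h2 := (le_abs_self _).trans (abs_fderiv_trFun_le hf hA hr)
  rw [← h1, sq] at h2
  exact le_of_mul_le_mul_right h2 ((l2_nonneg q).lt_of_ne' h0)

theorem abs_regGrad_le (hf : Differentiable ℂ f) (hA : ∀ i j, ContDiff ℝ 2 fun x => A x i j)
    (y : ι → ℝ) (i : ι) : |regGrad f A u y i| ≤ η₀r f A (fun i => u i (y i)) := by
  rw [regGrad]
  split_ifs
  · rw [abs_zero]; exact η₀r_nonneg _
  · exact abs_fderiv_trFun_single_le hf hA _ i

/-- `∑ q⁴ ≤ (max q²) ∑ q²`, with the maximum bounded by `η₀²` and the sum by `2 η₁²`. -/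
theorem sqrt_sum_regGrad_pow_le (hf : Differentiable ℂ f)
    (hA : ∀ i j, ContDiff ℝ 2 fun x => A x i j) (hu : ∀ i, ContDiff ℝ 2 (u i)) {y : ι → ℝ}
    (hy : RankTangentAt A (fun y : ι → ℝ => fun i => u i (y i)) y) :
    √(∑ i, (regGrad f A u y i ^ 2) ^ 2) ≤ √2 * η₃r f A (fun i => u i (y i)) ^ 2 := by
  set x : ι → ℝ := fun i => u i (y i) with hx
  have h0 := η₀r_nonneg (f := f) (A := A) x
  have h1 := η₁r_nonneg (f := f) (A := A) x
  rw [η₃r, Real.sq_sqrt (mul_nonneg h0 h1)]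
  refine Real.sqrt_le_iff.2 ⟨by positivity, ?_⟩
  have h2 : ∑ i, (regGrad f A u y i ^ 2) ^ 2 ≤ ∑ i, η₀r f A x ^ 2 * regGrad f A u y i ^ 2 := by
    refine Finset.sum_le_sum fun i _ => ?_
    rw [sq (regGrad f A u y i ^ 2)]
    refine mul_le_mul_of_nonneg_right ?_ (sq_nonneg _)
    rw [← sq_abs]
    exact pow_le_pow_left₀ (abs_nonneg _) (abs_regGrad_le hf hA y i) 2
  refine h2.trans ?_
  rw [← Finset.mul_sum, ← l2_sq]
  have h3 := pow_le_pow_left₀ (l2_nonneg _) (l2_regGrad_le hf hA hu hy) 2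
  calc η₀r f A x ^ 2 * l2 (regGrad f A u y) ^ 2
      ≤ η₀r f A x ^ 2 * (√2 * η₁r f A x) ^ 2 := mul_le_mul_of_nonneg_left h3 (sq_nonneg _)
    _ = _ := by ring

/-- The truncation costs nothing in front of `u''`, which vanishes where `u'` does. -/
theorem fderiv_mul_fderiv_eq_regGrad {y : ι → ℝ}
    (hy : ∀ i, deriv (u i) (y i) = 0 → deriv (deriv (u i)) (y i) = 0) (i : ι) :
    deriv (deriv (u i)) (y i) * fderiv ℝ (trFun f A) (fun i => u i (y i)) (Pi.single i 1) =
      deriv (deriv (u i)) (y i) * regGrad f A u y i := by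
  rw [regGrad]
  split_ifs with h
  · rw [hy i h, zero_mul, zero_mul]
  · rfl

theorem transport_coordwise (hf : Differentiable ℂ f) (hA : ∀ i j, ContDiff ℝ 2 fun x => A x i j)
    (hu : ∀ i, ContDiff ℝ 2 (u i)) {c₁ c₂ : ℝ≥0} (h1 : ∀ i t, |deriv (u i) t| ≤ c₁)
    (h2 : ∀ i t, |deriv (deriv (u i)) t| ≤ c₂) :
    Transport f A (fun y : ι → ℝ => fun i => u i (y i)) c₁ (c₁ * c₂) := by
  have hdu : ∀ i, Differentiable ℝ (u i) := fun i => (hu i).differentiable two_ne_zero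
  have htan : ∀ᵐ y ∂(stdG ι), ∀ α, ∃ α',
      fderiv ℝ (fderiv ℝ fun y : ι → ℝ => fun i => u i (y i)) y α α =
        fderiv ℝ (fun y : ι → ℝ => fun i => u i (y i)) y α' := by
    filter_upwards [ae_deriv_deriv_eq_zero hu] with y hy α
    -- Where `u'` vanishes the quotient has the value `0`, which is harmless because `u''` vanishes
    -- there too.
    refine ⟨fun i => deriv (deriv (u i)) (y i) * α i * α i / deriv (u i) (y i), ?_⟩
    rw [fderiv_fderiv_coordwise hu, fderiv_coordwise hdu]
    ext i
    by_cases hi : deriv (u i) (y i) = 0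
    · simp [hi, hy i hi]
    · field_simp
  refine ⟨contDiff_coordwise hu, fun y α => ?_, htan, fun y =>
    RankTangentAt A (fun y : ι → ℝ => fun i => u i (y i)) y ∧
      ∀ i, deriv (u i) (y i) = 0 → deriv (deriv (u i)) (y i) = 0,
    (ae_rankTangentAt hA (contDiff_coordwise hu) htan).and (ae_deriv_deriv_eq_zero hu), ?_⟩
  · rw [fderiv_coordwise hdu, ← pow_le_pow_iff_left₀ (l2_nonneg _)
      (mul_nonneg c₁.coe_nonneg (l2_nonneg _)) two_ne_zero, mul_pow, l2_sq, l2_sq, Finset.mul_sum]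
    refine Finset.sum_le_sum fun i _ => ?_
    rw [mul_pow, ← sq_abs (deriv _ _)]
    exact mul_le_mul_of_nonneg_right (pow_le_pow_left₀ (abs_nonneg _) (h1 i _) 2) (sq_nonneg _)
  · rintro y z ⟨hy, hy2⟩ ⟨hz, hz2⟩
    have e : ∀ i, fderiv ℝ (trFun f A) (fun i => u i (y i))
        (fderiv ℝ (fderiv ℝ fun y : ι → ℝ => fun i => u i (y i)) y (Pi.single i 1)
          fun j => par j (fun y => trFun f A fun i => u i (y i)) z) =
        deriv (deriv (u i)) (y i) * deriv (u i) (z i) *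
          (regGrad f A u y i * regGrad f A u z i) := by
      intro i
      rw [fderiv_fderiv_coordwise hu]
      have e1 : (fun k => deriv (deriv (u k)) (y k) * (Pi.single i 1 : ι → ℝ) k *
          par k (fun y => trFun f A fun i => u i (y i)) z) =
          (deriv (deriv (u i)) (y i) * par i (fun y => trFun f A fun i => u i (y i)) z) •
            (Pi.single i 1 : ι → ℝ) := by
        ext k
        by_cases hk : k = i
        · subst hk; simp
        · simp [hk]
      rw [e1, map_smul, smul_eq_mul, mul_right_comm, fderiv_mul_fderiv_eq_regGrad hy2,
        par_coordwise hf hA hu]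
      have e2 : deriv (u i) (z i) * fderiv ℝ (trFun f A) (fun i => u i (z i)) (Pi.single i 1) =
          deriv (u i) (z i) * regGrad f A u z i := by
        rw [regGrad]
        split_ifs with h
        · rw [h, zero_mul, zero_mul]
        · rfl
      rw [e2]; ring
    simp only [e]
    have hn := mul_nonneg (η₃r_nonneg (f := f) (A := A) fun i => u i (y i))
      (η₃r_nonneg (f := f) (A := A) fun i => u i (z i))
    have hcc : (0 : ℝ) ≤ ((c₁ * c₂ : ℝ≥0) : ℝ) := NNReal.coe_nonneg _
    rw [← pow_le_pow_iff_left₀ (l2_nonneg _) (by positivity) two_ne_zero, l2_sq]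
    have h3 : ∀ i, (deriv (deriv (u i)) (y i) * deriv (u i) (z i) *
        (regGrad f A u y i * regGrad f A u z i)) ^ 2 ≤
        ((c₁ * c₂ : ℝ≥0) : ℝ) ^ 2 * (regGrad f A u y i ^ 2 * regGrad f A u z i ^ 2) := by
      intro i
      rw [mul_pow, mul_pow (regGrad f A u y i), ← sq_abs (deriv (deriv (u i)) (y i) * _), abs_mul,
        mul_comm |_|, NNReal.coe_mul]
      refine mul_le_mul_of_nonneg_right (pow_le_pow_left₀ (by positivity) ?_ 2) (by positivity)
      exact mul_le_mul (h1 i _) (h2 i _) (abs_nonneg _) c₁.2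
    refine (Finset.sum_le_sum fun i _ => h3 i).trans ?_
    rw [← Finset.mul_sum]
    -- Cauchy-Schwarz over the coordinates separates the factors at `y` and `z`.
    have h4 := (Real.sum_mul_le_sqrt_mul_sqrt Finset.univ (fun i => regGrad f A u y i ^ 2)
      fun i => regGrad f A u z i ^ 2).trans
        (mul_le_mul (sqrt_sum_regGrad_pow_le hf hA hu hy) (sqrt_sum_regGrad_pow_le hf hA hu hz)
          (Real.sqrt_nonneg _) (by positivity))
    refine (mul_le_mul_of_nonneg_left h4 (sq_nonneg _)).trans (le_of_eq ?_)
    ring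

theorem par_comp_coord {w : ℝ → ℝ} (hw : Differentiable ℝ w) (i k : ι) (y : ι → ℝ) :
    par k (fun y : ι → ℝ => w (y i)) y = deriv w (y i) * (Pi.single k 1 : ι → ℝ) i := by
  have h := (hw (y i)).hasDerivAt.comp_hasFDerivAt y (hasFDerivAt_apply (𝕜 := ℝ) i y)
  have h2 := congrArg (fun L : (ι → ℝ) →L[ℝ] ℝ => L (Pi.single k 1)) h.fderiv
  exact h2

/-- Although `Φ` is curved, the vanishing of the Hessian along `DΦ` makes `∂_i h` a function of `y
i` alone, namely a constant multiple of `u_i'`. The bounds on `u'` and `u''` then make all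
derivatives bounded. -/
theorem memLp_of_coordwise_hess_eq_zero (hf : Differentiable ℂ f)
    (hA : ∀ i j, ContDiff ℝ 2 fun x => A x i j)
    (hu : ∀ i, ContDiff ℝ 2 (u i)) {c₁ c₂ : ℝ≥0} (h1 : ∀ i t, |deriv (u i) t| ≤ c₁)
    (h2 : ∀ i t, |deriv (deriv (u i)) t| ≤ c₂)
    (h0 : ∀ (y : ι → ℝ) i j, fderiv ℝ (fderiv ℝ (trFun f A)) (fun i => u i (y i))
      (fderiv ℝ (fun y : ι → ℝ => fun i => u i (y i)) y (Pi.single i 1))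
        (fderiv ℝ (fun y : ι → ℝ => fun i => u i (y i)) y (Pi.single j 1)) = 0) :
    (∀ i, MemLp (par i fun y => trFun f A fun i => u i (y i)) 4 (stdG ι)) ∧
      ∀ i j, MemLp (par i (par j fun y => trFun f A fun i => u i (y i))) 4 (stdG ι) := by
  have hΦ := contDiff_coordwise hu
  have hg := contDiff_trFun hf hA
  have hdu : ∀ i, Differentiable ℝ (u i) := fun i => (hu i).differentiable two_ne_zero
  have hd1 : ∀ i, Differentiable ℝ (deriv (u i)) := fun i =>
    (contDiff_one_deriv (hu i)).differentiable one_ne_zero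
  have hJ : ∀ (y : ι → ℝ) i, fderiv ℝ (fun y : ι → ℝ => fun i => u i (y i)) y (Pi.single i 1) =
      deriv (u i) (y i) • (Pi.single i 1 : ι → ℝ) := by
    intro y i
    rw [fderiv_coordwise hdu]
    ext k
    by_cases hk : k = i
    · subst hk; simp
    · simp [hk]
  -- the gradient of `Re Tr f(A)` at the image point
  let D : ι → (ι → ℝ) → ℝ := fun i y => fderiv ℝ (trFun f A) (fun i => u i (y i)) (Pi.single i 1)
  have hDc : ∀ i, ContDiff ℝ 1 (D i) := fun i =>
    ((hg.fderiv_right (m := 1) (by norm_num)).comp (hΦ.of_le one_le_two)).clm_apply contDiff_const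
  -- Where `u_i'` vanishes, `Φ` does not move along the coordinate `i` to first order; elsewhere the
  -- factor `u_i'` in the hypothesis can be cancelled.
  have hDi : ∀ i y, par i (D i) y = 0 := by
    intro i y
    have hd : DifferentiableAt ℝ (fderiv ℝ (trFun f A)) (fun i => u i (y i)) :=
      (hg.fderiv_right (m := 1) (by norm_num)).differentiable one_ne_zero _
    have h3 := ((ContinuousLinearMap.apply ℝ ℝ (Pi.single i (1 : ℝ) : ι → ℝ)).hasFDerivAt.comp y
      (hd.hasFDerivAt.comp y (hΦ.differentiable two_ne_zero y).hasFDerivAt)).fderiv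
    have h4 : par i (D i) y = fderiv ℝ (fderiv ℝ (trFun f A)) (fun i => u i (y i))
        (fderiv ℝ (fun y : ι → ℝ => fun i => u i (y i)) y (Pi.single i 1)) (Pi.single i 1) := by
      have h5 := congrArg (fun L : (ι → ℝ) →L[ℝ] ℝ => L (Pi.single i 1)) h3
      exact h5
    have h5 := h0 y i i
    rw [h4]
    rw [hJ] at h5 ⊢
    by_cases hi : deriv (u i) (y i) = 0
    · simp [hi]
    · rw [map_smul, smul_eq_mul] at h5
      exact (mul_eq_zero.1 h5).resolve_left hi
  have hG : ∀ i, par i (fun y => trFun f A fun i => u i (y i)) =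
      fun y => deriv (u i) (y i) * D i y := fun i => funext fun y => par_coordwise hf hA hu y i
  have hoff : ∀ i k, k ≠ i → ∀ y,
      par k (par i fun y => trFun f A fun i => u i (y i)) y = 0 := by
    intro i k hk y
    have e := par_par_trFun_comp hf hA hΦ k i y
    rw [h0, fderiv_fderiv_coordwise hu, zero_add] at e
    refine e.trans ?_
    have : (fun l => deriv (deriv (u l)) (y l) * (Pi.single k 1 : ι → ℝ) l *
        (Pi.single i 1 : ι → ℝ) l) = 0 := by
      ext l
      by_cases hl : l = i
      · subst hl; simp [hk.symm]
      · simp [hl]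
    rw [this, map_zero]
  have hconst : ∀ i, par i (fun y => trFun f A fun i => u i (y i)) =
      fun y => deriv (u i) (y i) * D i 0 := by
    intro i
    ext y
    have hC := contDiff_par (contDiff_trFun_comp hf hA hΦ) i
    -- Move first from `y` to the `i`-th axis, along which `∂_i h` does not change by `hoff`, then
    -- along the axis to `0`, where `D i` is constant by `hDi`.
    have h3 := eq_of_par_eq_zero hC (w := y - Pi.single i (y i)) (fun k hk z => by
      refine hoff i k ?_ z
      rintro rfl
      simp at hk) (Pi.single i (y i))
    rw [add_sub_cancel] at h3
    have h4 := eq_of_par_eq_zero (hDc i) (w := Pi.single i (y i)) (fun k hk z => by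
      have : k = i := by
        by_contra hne
        exact hk (by simp [hne])
      rw [this]
      exact hDi i z) 0
    rw [zero_add] at h4
    rw [h3, hG]
    simp only [Pi.single_eq_same]
    rw [h4]
  have hdu' : ∀ i, Differentiable ℝ fun t => deriv (u i) t * D i 0 := fun i =>
    (hd1 i).mul_const _
  constructor
  · intro i
    refine MemLp.of_bound (C := c₁ * |D i 0|) (continuous_par
      ((contDiff_trFun_comp hf hA hΦ).of_le one_le_two) i).aestronglyMeasurable
      (Eventually.of_forall fun y => ?_)
    rw [hconst, Real.norm_eq_abs, abs_mul]
    exact mul_le_mul_of_nonneg_right (h1 i _) (abs_nonneg _)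
  · intro k i
    refine MemLp.of_bound (C := c₂ * |D i 0|) (continuous_par
      (contDiff_par (contDiff_trFun_comp hf hA hΦ) i) k).aestronglyMeasurable
      (Eventually.of_forall fun y => ?_)
    by_cases hk : k = i
    · subst hk
      rw [hconst, par_comp_coord (w := fun t => deriv (u k) t * D k 0) (hdu' k),
        deriv_mul_const (hd1 k _), Real.norm_eq_abs, Pi.single_eq_same, mul_one, abs_mul]
      exact mul_le_mul_of_nonneg_right (h2 k _) (abs_nonneg _)
    · rw [hoff i k hk, norm_zero]
      exact mul_nonneg c₂.2 (abs_nonneg _)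

theorem ae_abs_fderiv_coordwise_le (hf : Differentiable ℂ f)
    (hA : ∀ i j, ContDiff ℝ 2 fun x => A x i j)
    (hu : ∀ i, ContDiff ℝ 2 (u i)) {c₁ c₂ : ℝ≥0} (h1 : ∀ i t, |deriv (u i) t| ≤ c₁)
    (h2 : ∀ i t, |deriv (deriv (u i)) t| ≤ c₂) :
    ∀ᵐ y ∂(stdG ι), ∀ i j, |fderiv ℝ (trFun f A) (fun i => u i (y i))
      (fderiv ℝ (fderiv ℝ fun y : ι → ℝ => fun i => u i (y i)) y (Pi.single i 1)
        (Pi.single j 1))| ≤ c₂ * √2 * η₁r f A (fun i => u i (y i)) := by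
  have hT := transport_coordwise hf hA hu h1 h2
  filter_upwards [ae_rankTangentAt hA hT.contDiff hT.tangent, ae_deriv_deriv_eq_zero hu]
    with y hy hy2 i j
  have hn : 0 ≤ c₂ * √2 * η₁r f A (fun i => u i (y i)) :=
    mul_nonneg (mul_nonneg c₂.2 (Real.sqrt_nonneg 2)) (η₁r_nonneg _)
  rw [fderiv_fderiv_coordwise hu]
  by_cases hij : i = j
  · subst hij
    have e : (fun l => deriv (deriv (u l)) (y l) * (Pi.single i 1 : ι → ℝ) l *
        (Pi.single i 1 : ι → ℝ) l) = deriv (deriv (u i)) (y i) • (Pi.single i 1 : ι → ℝ) := by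
      ext l
      by_cases hl : l = i
      · subst hl; simp
      · simp [hl]
    rw [e, map_smul, smul_eq_mul, fderiv_mul_fderiv_eq_regGrad hy2, abs_mul, mul_assoc]
    exact mul_le_mul (h2 i _) ((abs_le_l2 _ i).trans (l2_regGrad_le hf hA hu hy)) (abs_nonneg _)
      c₂.2
  · have e : (fun l => deriv (deriv (u l)) (y l) * (Pi.single i 1 : ι → ℝ) l *
        (Pi.single j 1 : ι → ℝ) l) = 0 := by
      ext l
      by_cases hl : l = i
      · subst hl; simp [hij]
      · simp [hl]
    rw [e, map_zero, abs_zero]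
    exact hn

theorem dTV_linStat_le_of_iIndepFun (hf : Differentiable ℂ f)
    (hA : ∀ i j, ContDiff ℝ 2 fun x => A x i j)
    {Ω : Type*} [MeasurableSpace Ω] {P : Measure Ω} [IsProbabilityMeasure P] {X : ι → Ω → ℝ}
    (hX : ∀ u, Measurable (X u)) (hW : MemLp (linStat f A X) 4 P) {c₁ c₂ : ℝ≥0}
    (hi : iIndepFun X P) (hL : ∀ u, P.map (X u) ∈ ClassL c₁ c₂) :
    dTV (P.map (linStat f A X)) (gaussianReal (∫ ω, linStat f A X ω ∂P)
        (variance (linStat f A X) P).toNNReal) ≤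
      ENNReal.ofReal (2 * √5) * (c₁ * c₂ * κ₀ f A P X + c₁ ^ 3 * κ₁ f A P X * κ₂ f A P X) /
        ENNReal.ofReal (variance (linStat f A X) P) := by
  choose u hu h1 h2 h3 using hL
  have hmap : P.map (fun ω i => X i ω) = (stdG ι).map fun y i => u i (y i) := by
    rw [(iIndepFun_iff_map_fun_eq_pi_map fun i => (hX i).aemeasurable).1 hi]
    simp only [h3]
    have : ∀ i, IsProbabilityMeasure ((gaussianReal 0 1).map (u i)) := fun i =>
      Measure.isProbabilityMeasure_map (hu i).continuous.measurable.aemeasurable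
    exact (Measure.pi_map_pi fun i => (hu i).continuous.measurable.aemeasurable).symm
  have hT := transport_coordwise hf hA hu h1 h2
  have key := dTV_linStat_le hf hA hX hW hmap hT
    ⟨c₂ * √2, ae_abs_fderiv_coordwise_le hf hA hu h1 h2⟩
    (memLp_of_coordwise_hess_eq_zero hf hA hu h1 h2)
  rwa [ENNReal.coe_mul] at key

end Independent

end

end
end MatrixCLT

theorem mainTheorem3
    {ι : Type*} [Fintype ι] [DecidableEq ι] {n : ℕ}
    (A : (ι → ℝ) → Matrix (Fin n) (Fin n) ℂ) (hA : ∀ i j, ContDiff ℝ 2 fun x => A x i j)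
    (f : ℂ → ℂ) (hf : Differentiable ℂ f)
    {Ω : Type*} [MeasurableSpace Ω] (P : Measure Ω) [IsProbabilityMeasure P]
    (X : ι → Ω → ℝ) (hX : ∀ u, Measurable (X u))
    (hW : MemLp (MatrixCLT.linStat f A X) 4 P) :
    (∀ c₁ c₂ : ℝ≥0, iIndepFun X P → (∀ u, P.map (X u) ∈ MatrixCLT.ClassL c₁ c₂) →
      MatrixCLT.dTV (P.map (MatrixCLT.linStat f A X))
          (gaussianReal (∫ ω, MatrixCLT.linStat f A X ω ∂P)
            (variance (MatrixCLT.linStat f A X) P).toNNReal) ≤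
        ENNReal.ofReal (2 * √5) *
            (c₁ * c₂ * MatrixCLT.κ₀ f A P X +
              c₁ ^ 3 * MatrixCLT.κ₁ f A P X * MatrixCLT.κ₂ f A P X) /
          ENNReal.ofReal (variance (MatrixCLT.linStat f A X) P)) ∧
    (∀ Sigma : Matrix ι ι ℝ, Sigma.PosSemidef →
      HasLaw (fun ω => WithLp.toLp 2 fun u => X u ω) (multivariateGaussian 0 Sigma) P →
      MatrixCLT.dTV (P.map (MatrixCLT.linStat f A X))
          (gaussianReal (∫ ω, MatrixCLT.linStat f A X ω ∂P)
            (variance (MatrixCLT.linStat f A X) P).toNNReal) ≤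
        ENNReal.ofReal (2 * √5) *
            (ENNReal.ofReal (MatrixCLT.opNorm Sigma ^ (3 / 2 : ℝ)) *
              MatrixCLT.κ₁ f A P X * MatrixCLT.κ₂ f A P X) /
          ENNReal.ofReal (variance (MatrixCLT.linStat f A X) P)) :=
  ⟨fun _ _ hi hL => MatrixCLT.dTV_linStat_le_of_iIndepFun hf hA hX hW hi hL,
    fun _ hS h => MatrixCLT.dTV_linStat_le_of_multivariateGaussian hf hA hX hW hS h⟩
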